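/- A Turing ideal is a nonempty set of Turing degrees that is closed downward under Turing reducibility and closed under joins. Let $F$ be a computable field (its elements are identified with natural numbers forming a computable set, and its operations are computable), and let $V_\infty$ be the $\aleph_0$-dimensional vector space over $F$ whose vectors are the (codes of) finitely nonzero $\omega$-sequences of elements of $F$. For a Turing ideal $I$, let $\mathcal{L}_I(V_\infty)$ be the lattice, under inclusion, of all subspaces of $V_\infty$ that are computably enumerable in some $\mathbf{d}\in I$. Let $\mathcal{B}_\eta$ be the interval Boolean algebra of the rationals, that is, the algebra of subsets of $\mathbb{Q}$ generated by the left-closed right-open intervals (bounded or unbounded), with its standard computable coding by the finitely many endpoints of an element. Let $Aut_I(\mathcal{B}_\eta)$ be the group of all automorphisms of $\mathcal{B}_\eta$ that are $\mathbf{d}$-computable for some $\mathbf{d}\in I$, and let $\mathcal{L}_I(\mathcal{B}_\eta)$ be the lattice, under inclusion, of all Boolean subalgebras of $\mathcal{B}_\eta$ that are computably enumerable in some $\mathbf{d}\in I$. For groups, write $G\hookrightarrow H$ if there is an injective group homomorphism $G\to H$, and let $Aut(\mathcal{L})$ be the group of automorphisms of the lattice $\mathcal{L}$. **Theorem.** For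 any Turing ideals $I$ and $J$: (a) $Aut(\mathcal{L}_I(V_\infty))\hookrightarrow Aut(\mathcal{L}_J(V_\infty))$ if and only if $I\subseteq J$; (b) $Aut_I(\mathcal{B}_\eta)\hookrightarrow Aut_J(\mathcal{B}_\eta)$ if and only if $I\subseteq J$; (c) $Aut(\mathcal{L}_I(\mathcal{B}_\eta))\hookrightarrow Aut(\mathcal{L}_J(\mathcal{B}_\eta))$ if and only if $I\subseteq J$. -/

import Mathlib

namespace SubstructureLattice

/-! ### Turing degrees of sets of natural numbers -/

/-- The characteristic function of `A ⊆ ℕ`, in the form in which it is used as an oracle. -/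
noncomputable def charFun (A : Set ℕ) : ℕ →. ℕ :=
  fun n => Part.some (A.indicator (fun _ => 1) n)

/-- `A` is Turing reducible to `B`. -/
def TuringLE (A B : Set ℕ) : Prop := TuringReducible (charFun A) (charFun B)

instance : IsPreorder (Set ℕ) TuringLE where
  refl A := TuringReducible.refl (charFun A)
  trans _ _ _ h₁ h₂ := TuringReducible.trans h₁ h₂

theorem TuringLE.trans {A B C : Set ℕ} (h₁ : TuringLE A B) (h₂ : TuringLE B C) :
    TuringLE A C := _root_.trans h₁ h₂

/-- The Turing degrees: sets of natural numbers modulo mutual Turing reducibility. (Mathlib's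
`TuringDegree` consists of degrees of *partial* functions, which is a larger structure.) -/
def Degree : Type := Antisymmetrization (Set ℕ) TuringLE

/-- The Turing degree of a set. -/
def deg (A : Set ℕ) : Degree := toAntisymmetrization TuringLE A

/-- The join `A ⊕ B = {2n | n ∈ A} ∪ {2n+1 | n ∈ B}`. -/
def setJoin (A B : Set ℕ) : Set ℕ :=
  {n | (n % 2 = 0 ∧ n / 2 ∈ A) ∨ (n % 2 = 1 ∧ n / 2 ∈ B)}

theorem recursiveIn_of_primrec {O : Set (ℕ →. ℕ)} {f : ℕ → ℕ} (hf : Primrec f) :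
    Nat.RecursiveIn O (fun n => Part.some (f n)) :=
  Nat.Primrec.recursiveIn (Primrec.nat_iff.1 hf)

theorem recursiveIn_comp {O : Set (ℕ →. ℕ)} {f g : ℕ → ℕ}
    (hf : Nat.RecursiveIn O (fun n => Part.some (f n)))
    (hg : Nat.RecursiveIn O (fun n => Part.some (g n))) :
    Nat.RecursiveIn O (fun n => Part.some (f (g n))) :=
  (Nat.RecursiveIn.comp hf hg).of_eq fun n => by simp

theorem recursiveIn_pair {O : Set (ℕ →. ℕ)} {f g : ℕ → ℕ}
    (hf : Nat.RecursiveIn O (fun n => Part.some (f n)))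
    (hg : Nat.RecursiveIn O (fun n => Part.some (g n))) :
    Nat.RecursiveIn O (fun n => Part.some (Nat.pair (f n) (g n))) :=
  (Nat.RecursiveIn.pair hf hg).of_eq fun n => by simp [Seq.seq]

theorem recursiveIn_search {O : Set (ℕ →. ℕ)} {t G : ℕ → ℕ}
    (ht : Nat.RecursiveIn O (fun n => Part.some (t n)))
    (h0 : ∀ m, t (Nat.pair m (G m)) = 0) (h1 : ∀ m, ∀ k < G m, t (Nat.pair m k) ≠ 0) :
    Nat.RecursiveIn O (fun m => Part.some (G m)) :=
  (Nat.RecursiveIn.rfind ht).of_eq_tot fun m => Nat.mem_rfind.2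
    ⟨by simp [h0], fun {k} hk => by simp [h1 m k hk]⟩

theorem turingLE_iff {A B : Set ℕ} :
    TuringLE A B ↔
      Nat.RecursiveIn {charFun B} (fun n => Part.some (A.indicator (fun _ => 1) n)) :=
  RecursiveIn.iff_nat

theorem left_le_setJoin (A B : Set ℕ) : TuringLE A (setJoin A B) := by
  rw [turingLE_iff]
  have h := recursiveIn_comp (O := {charFun (setJoin A B)})
    (Nat.RecursiveIn.oracle _ (Set.mem_singleton _))
    (recursiveIn_of_primrec (f := fun n => 2 * n) (Primrec.nat_mul.comp (.const 2) .id))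
  refine h.of_eq fun n => ?_
  have : 2 * n ∈ setJoin A B ↔ n ∈ A := by simp [setJoin]
  by_cases hn : n ∈ A <;> simp [Set.indicator, this, hn]

theorem right_le_setJoin (A B : Set ℕ) : TuringLE B (setJoin A B) := by
  rw [turingLE_iff]
  have h := recursiveIn_comp (O := {charFun (setJoin A B)})
    (Nat.RecursiveIn.oracle _ (Set.mem_singleton _))
    (recursiveIn_of_primrec (f := fun n => 2 * n + 1)
      (Primrec.succ.comp (Primrec.nat_mul.comp (.const 2) .id)))
  refine h.of_eq fun n => ?_
  have : 2 * n + 1 ∈ setJoin A B ↔ n ∈ B := by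
    have h1 : (2 * n + 1) % 2 = 1 := by omega
    have h2 : (2 * n + 1) / 2 = n := by omega
    simp [setJoin, h1, h2]
  by_cases hn : n ∈ B <;> simp [Set.indicator, this, hn]

theorem setJoin_le {A B C : Set ℕ} (hA : TuringLE A C) (hB : TuringLE B C) :
    TuringLE (setJoin A B) C := by
  rw [turingLE_iff] at *
  have half : Primrec fun n : ℕ => n / 2 := Primrec.nat_div.comp .id (.const 2)
  have h1 := recursiveIn_comp hA (recursiveIn_of_primrec half)
  have h2 := recursiveIn_comp hB (recursiveIn_of_primrec half)
  have h3 := recursiveIn_pair (recursiveIn_of_primrec Primrec.id) (recursiveIn_pair h1 h2)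
  have sel : Primrec fun p : ℕ => if p.unpair.1 % 2 = 0 then p.unpair.2.unpair.1
      else p.unpair.2.unpair.2 := by
    have u1 : Primrec fun p : ℕ => p.unpair.1 := Primrec.fst.comp Primrec.unpair
    have u2 : Primrec fun p : ℕ => p.unpair.2.unpair :=
      Primrec.unpair.comp (Primrec.snd.comp Primrec.unpair)
    exact Primrec.ite (Primrec.eq.comp (Primrec.nat_mod.comp u1 (.const 2)) (.const 0))
      (Primrec.fst.comp u2) (Primrec.snd.comp u2)
  refine (recursiveIn_comp (recursiveIn_of_primrec sel) h3).of_eq fun n => ?_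
  have key : n ∈ setJoin A B ↔ (n % 2 = 0 ∧ n / 2 ∈ A) ∨ (n % 2 = 1 ∧ n / 2 ∈ B) := Iff.rfl
  by_cases hA' : n / 2 ∈ A <;> by_cases hB' : n / 2 ∈ B <;>
    rcases Nat.mod_two_eq_zero_or_one n with hn | hn <;>
    simp [Set.indicator, key, hn, hA', hB']

/-- The degrees form an upper semilattice: `deg A ≤ deg B` iff `A` is Turing reducible to `B`, and
`deg A ⊔ deg B = deg (A ⊕ B)`. -/
instance : SemilatticeSup Degree where
  le := Quotient.lift₂ TuringLE fun _ _ _ _ h₁ h₂ =>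
    propext ⟨fun h => TuringLE.trans h₁.2 (TuringLE.trans h h₂.1),
      fun h => TuringLE.trans h₁.1 (TuringLE.trans h h₂.2)⟩
  le_refl a := Quotient.inductionOn a fun A => refl_of TuringLE A
  le_trans a b c := Quotient.inductionOn₃ a b c fun _ _ _ h₁ h₂ => TuringLE.trans h₁ h₂
  le_antisymm a b := Quotient.inductionOn₂ a b fun _ _ h₁ h₂ => Quotient.sound ⟨h₁, h₂⟩
  sup := Quotient.lift₂ (fun A B => deg (setJoin A B)) fun _ _ _ _ h₁ h₂ =>
    Quotient.sound
      ⟨setJoin_le (TuringLE.trans h₁.1 (left_le_setJoin _ _))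
          (TuringLE.trans h₂.1 (right_le_setJoin _ _)),
        setJoin_le (TuringLE.trans h₁.2 (left_le_setJoin _ _))
          (TuringLE.trans h₂.2 (right_le_setJoin _ _))⟩
  le_sup_left a b := Quotient.inductionOn₂ a b fun A B => left_le_setJoin A B
  le_sup_right a b := Quotient.inductionOn₂ a b fun A B => right_le_setJoin A B
  sup_le a b c := Quotient.inductionOn₃ a b c fun _ _ _ h₁ h₂ => setJoin_le h₁ h₂

theorem deg_le_deg {A B : Set ℕ} : deg A ≤ deg B ↔ TuringLE A B := Iff.rfl

theorem deg_sup_deg (A B : Set ℕ) : deg A ⊔ deg B = deg (setJoin A B) := rfl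

/-- Turing ideals: nonempty sets of degrees closed downward and under joins. (In an upper
semilattice, the directedness required in `Order.Ideal` amounts to closure under joins.) -/
abbrev TuringIdeal : Type := Order.Ideal Degree

/-- `B` is computably enumerable in the degree `d`: it is the domain of a partial function
recursive in a set of degree `d`. -/
def CEIn (d : Degree) (B : Set ℕ) : Prop :=
  ∃ A : Set ℕ, deg A = d ∧
    ∃ f : ℕ →. ℕ, RecursiveIn {charFun A} f ∧ ∀ n, n ∈ B ↔ (f n).Dom

/-- The total function `g` is computable in the degree `d`. -/
def FunComputableIn (d : Degree) (g : ℕ → ℕ) : Prop :=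
  ∃ A : Set ℕ, deg A = d ∧ ComputableIn {charFun A} g

/-! ### Computable fields, the space `V_∞` and the lattices of its subspaces -/

/-- A computable presentation of the field `F`: elements are identified with their codes in `ℕ`,
the set of codes is computable, and addition and multiplication are computable on codes. -/
structure ComputableField (F : Type*) [Field F] where
  /-- the code of an element -/
  code : F → ℕ
  code_injective : Function.Injective code
  computable_range : ComputablePred fun n => n ∈ Set.range code
  computable_add : ∃ f : ℕ → ℕ → ℕ, Computable₂ f ∧
    ∀ x y, f (code x) (code y) = code (x + y)
  computable_mul : ∃ f : ℕ → ℕ → ℕ, Computable₂ f ∧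
    ∀ x y, f (code x) (code y) = code (x * y)

section VectorSpace

variable {F : Type*} [Field F]

/-- The code of a finitely nonzero sequence `v` of elements of `F`: the code of the list of (the
codes of) its entries up to the last nonzero one. -/
noncomputable def vecCode (C : ComputableField F) (v : ℕ →₀ F) : ℕ :=
  Encodable.encode
    ((List.range (v.support.sup fun i => i + 1)).map fun i => C.code (v i))

/-- The lattice `L_I(V_∞)` of those subspaces of `V_∞ = ℕ →₀ F` that are c.e. in some degree of
`I`, ordered by inclusion. -/
def SubspaceLattice (C : ComputableField F) (I : TuringIdeal) : Type _ :=
  {W : Submodule F (ℕ →₀ F) // ∃ d ∈ I, CEIn d (vecCode C '' (W : Set (ℕ →₀ F)))}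

instance (C : ComputableField F) (I : TuringIdeal) : PartialOrder (SubspaceLattice C I) :=
  inferInstanceAs (PartialOrder {W : Submodule F (ℕ →₀ F) //
    ∃ d ∈ I, CEIn d (vecCode C '' (W : Set (ℕ →₀ F)))})

end VectorSpace

/-! ### The interval Boolean algebra of the rationals -/

/-- The left-closed right-open intervals of `ℚ`, bounded or not. -/
def intervals : Set (Set ℚ) :=
  {A | (∃ a b, A = Set.Ico a b) ∨ (∃ a, A = Set.Ici a) ∨ ∃ b, A = Set.Iio b}

/-- The interval algebra `B_η`: the algebra of sets generated by the left-closed right-open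
intervals of `ℚ`. -/
def intervalAlgebra : BooleanSubalgebra (Set ℚ) := BooleanSubalgebra.closure intervals

/-- `B_η` as a type; it is a Boolean algebra under the set operations. -/
abbrev Beta : Type := intervalAlgebra

/-- The set of rationals that changes its membership exactly at the points of `p.2`, and that
contains all sufficiently small rationals iff `p.1 = true`. -/
def jumpSet (p : Bool × Finset ℚ) : Set ℚ :=
  {x | p.1 = true ↔ Even (p.2.filter (· ≤ x)).card}

theorem Ici_mem_intervalAlgebra (a : ℚ) : Set.Ici a ∈ intervalAlgebra :=
  BooleanSubalgebra.subset_closure (Or.inr (Or.inl ⟨a, rfl⟩))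

theorem jumpSet_insert_of_le {e : Bool} {S : Finset ℚ} {a x : ℚ} (ha : a ∉ S) (h : a ≤ x) :
    x ∈ jumpSet (e, insert a S) ↔ x ∉ jumpSet (e, S) := by
  have : a ∉ S.filter (· ≤ x) := fun h' => ha (Finset.mem_filter.1 h').1
  simp only [jumpSet, Set.mem_ofPred_eq, Finset.filter_insert, h, if_true,
    Finset.card_insert_of_notMem this, Nat.even_add_one]
  tauto

theorem jumpSet_insert_of_lt {e : Bool} {S : Finset ℚ} {a x : ℚ} (h : x < a) :
    x ∈ jumpSet (e, insert a S) ↔ x ∈ jumpSet (e, S) := by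
  simp [jumpSet, Finset.filter_insert, not_le.2 h]

theorem jumpSet_mem (p : Bool × Finset ℚ) : jumpSet p ∈ intervalAlgebra := by
  obtain ⟨e, S⟩ := p
  induction S using Finset.induction_on with
  | empty =>
    cases e
    · convert! intervalAlgebra.bot_mem
      ext x; simp [jumpSet]
    · convert! BooleanSubalgebra.top_mem (L := intervalAlgebra)
      ext x; simp [jumpSet]
  | insert a S ha ih =>
    have h1 := Ici_mem_intervalAlgebra a
    convert! BooleanSubalgebra.sup_mem (BooleanSubalgebra.sdiff_mem ih h1)
      (BooleanSubalgebra.sdiff_mem h1 ih)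
    ext x
    simp only [Set.sup_eq_union, Set.mem_union, Set.mem_sdiff, Set.mem_Ici]
    rcases le_or_gt a x with h | h
    · rw [jumpSet_insert_of_le ha h]; simp [h]
    · rw [jumpSet_insert_of_lt h]; simp [not_le.2 h]

/-- Every element of the interval algebra has finitely many jumps. -/
theorem exists_finset_of_mem {A : Set ℚ} (hA : A ∈ intervalAlgebra) :
    ∃ S : Finset ℚ, ∀ x y, (∀ s ∈ S, s ≤ x ↔ s ≤ y) → (x ∈ A ↔ y ∈ A) := by
  refine BooleanSubalgebra.closure_bot_sup_induction
    (p := fun A _ => ∃ S : Finset ℚ, ∀ x y, (∀ s ∈ S, s ≤ x ↔ s ≤ y) → (x ∈ A ↔ y ∈ A))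
    ?_ ?_ ?_ ?_ hA
  · rintro A (⟨a, b, rfl⟩ | ⟨a, rfl⟩ | ⟨b, rfl⟩)
    · refine ⟨{a, b}, fun x y h => ?_⟩
      have h1 := h a (by simp)
      have h2 := h b (by simp)
      simp only [Set.mem_Ico, ← not_le, h1, h2]
    · exact ⟨{a}, fun x y h => h a (by simp)⟩
    · refine ⟨{b}, fun x y h => ?_⟩
      have h2 := h b (by simp)
      simp only [Set.mem_Iio, ← not_le, h2]
  · exact ⟨∅, fun x y _ => Iff.rfl⟩
  · rintro A _ B _ ⟨S, hS⟩ ⟨T, hT⟩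
    refine ⟨S ∪ T, fun x y h => ?_⟩
    exact or_congr (hS x y fun s hs => h s (Finset.mem_union_left _ hs))
      (hT x y fun s hs => h s (Finset.mem_union_right _ hs))
  · rintro A _ ⟨S, hS⟩
    exact ⟨S, fun x y h => not_congr (hS x y h)⟩

theorem exists_jumpSet_eq (S : Finset ℚ) : ∀ A : Set ℚ,
    (∀ x y, (∀ s ∈ S, s ≤ x ↔ s ≤ y) → (x ∈ A ↔ y ∈ A)) → ∃ p, jumpSet p = A := by
  classical
  suffices H : ∀ A : Set ℚ, (∀ x y, (∀ s ∈ S, s ≤ x ↔ s ≤ y) → (x ∈ A ↔ y ∈ A)) →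
      ∃ e T, T ⊆ S ∧ jumpSet (e, T) = A from
    fun A hA => let ⟨e, T, _, h⟩ := H A hA; ⟨(e, T), h⟩
  induction S using Finset.induction_on_max with
  | empty =>
    intro A hA
    refine ⟨decide ((0 : ℚ) ∈ A), ∅, subset_rfl, ?_⟩
    ext x
    simp [jumpSet, hA 0 x (by simp)]
  | insert a S hlt ih =>
    intro A hA
    have haS : a ∉ S := fun h => lt_irrefl _ (hlt a h)
    obtain ⟨c, hca, hc⟩ : ∃ c < a, ∀ s ∈ S, s ≤ c := by
      rcases S.eq_empty_or_nonempty with rfl | hne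
      · exact ⟨a - 1, by linarith, by simp⟩
      · exact ⟨S.max' hne, hlt _ (S.max'_mem hne), fun s hs => S.le_max' s hs⟩
    let A' : Set ℚ := {x | min x c ∈ A}
    obtain ⟨e, T, hTS, hT⟩ := ih A' fun x y h => by
      refine hA _ _ fun s hs => ?_
      rcases Finset.mem_insert.1 hs with rfl | hs
      · simp [not_le.2 hca]
      · simp [hc s hs, h s hs]
    have haT : a ∉ T := fun h => haS (hTS h)
    have low : ∀ x, x < a → (x ∈ A ↔ x ∈ A') := fun x hx => by
      refine hA _ _ fun s hs => ?_
      rcases Finset.mem_insert.1 hs with rfl | hs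
      · simp [not_le.2 hca, not_le.2 hx]
      · simp [hc s hs]
    have high : ∀ x, a ≤ x → ((x ∈ A ↔ a ∈ A) ∧ (x ∈ A' ↔ c ∈ A)) := fun x hx => by
      refine ⟨hA _ _ fun s hs => ?_, ?_⟩
      · rcases Finset.mem_insert.1 hs with rfl | hs
        · simp [hx]
        · simp [(hlt s hs).le, (hlt s hs).le.trans hx]
      · simp [A', min_eq_right (hca.le.trans hx)]
    by_cases hac : a ∈ A ↔ c ∈ A
    · refine ⟨e, T, hTS.trans (Finset.subset_insert _ _), ?_⟩
      rw [hT]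
      ext x
      rcases lt_or_ge x a with hx | hx
      · exact (low x hx).symm
      · have := high x hx; tauto
    · refine ⟨e, insert a T, Finset.insert_subset_insert _ hTS, ?_⟩
      ext x
      rcases lt_or_ge x a with hx | hx
      · rw [jumpSet_insert_of_lt hx, hT, low x hx]
      · rw [jumpSet_insert_of_le haT hx, hT]
        have := high x hx; tauto

theorem jumpSet_injective : Function.Injective jumpSet := by
  classical
  rintro ⟨e, S⟩ ⟨e', T⟩ h
  have hx : ∀ x, x ∈ jumpSet (e, S) ↔ x ∈ jumpSet (e', T) := fun x => by rw [h]
  simp only [jumpSet, Set.mem_ofPred_eq] at hx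
  have he : e = e' := by
    obtain ⟨x, hx'⟩ : ∃ x : ℚ, ∀ s ∈ S ∪ T, x < s := by
      rcases (S ∪ T).eq_empty_or_nonempty with h0 | hne
      · exact ⟨0, by simp [h0]⟩
      · exact ⟨(S ∪ T).min' hne - 1, fun s hs => by
          have := (S ∪ T).min'_le s hs; linarith⟩
    have h1 : S.filter (· ≤ x) = ∅ := Finset.filter_eq_empty_iff.2 fun s hs =>
      not_le.2 (hx' s (Finset.mem_union_left _ hs))
    have h2 : T.filter (· ≤ x) = ∅ := Finset.filter_eq_empty_iff.2 fun s hs =>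
      not_le.2 (hx' s (Finset.mem_union_right _ hs))
    have := hx x
    rw [h1, h2] at this
    cases e <;> cases e' <;> simp_all
  subst he
  have par : ∀ x, Even (S.filter (· ≤ x)).card ↔ Even (T.filter (· ≤ x)).card := fun x => by
    have := hx x
    tauto
  have key : ∀ n : ℕ, ∀ q : ℚ, ((S ∪ T).filter (· < q)).card = n → (q ∈ S ↔ q ∈ T) := by
    intro n
    induction n using Nat.strong_induction_on with
    | _ n ih =>
      intro q hq
      have hlt : S.filter (· < q) = T.filter (· < q) := by
        ext s
        simp only [Finset.mem_filter]
        refine and_congr_left fun hs => ?_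
        by_cases hm : s ∈ S ∪ T
        · refine ih _ ?_ s rfl
          rw [← hq]
          refine Finset.card_lt_card (Finset.ssubset_iff_of_subset ?_ |>.2
            ⟨s, by simp only [Finset.mem_filter]; exact ⟨hm, hs⟩, by simp⟩)
          intro t ht
          simp only [Finset.mem_filter] at ht ⊢
          exact ⟨ht.1, ht.2.trans hs⟩
        · simp only [Finset.mem_union] at hm; tauto
      have split : ∀ U : Finset ℚ, (U.filter (· ≤ q)).card
          = (U.filter (· < q)).card + if q ∈ U then 1 else 0 := by
        intro U
        by_cases hqU : q ∈ U
        · have : U.filter (· ≤ q) = insert q (U.filter (· < q)) := by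
            ext t
            simp only [Finset.mem_filter, Finset.mem_insert, le_iff_lt_or_eq]
            constructor
            · rintro ⟨h1, h2 | h2⟩ <;> tauto
            · rintro (rfl | h1) <;> tauto
          rw [this, Finset.card_insert_of_notMem (by simp)]
          simp [hqU]
        · have : U.filter (· ≤ q) = U.filter (· < q) := by
            ext t
            simp only [Finset.mem_filter, le_iff_lt_or_eq]
            constructor
            · rintro ⟨h1, h2 | rfl⟩ <;> tauto
            · tauto
          rw [this]; simp [hqU]
      have := par q
      rw [split S, split T, hlt] at this
      by_cases h1 : q ∈ S <;> by_cases h2 : q ∈ T <;>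
        simp only [h1, h2, if_true, if_false, Nat.even_add_one, add_zero] at this ⊢ <;> tauto
  have : S = T := by ext q; exact key _ q rfl
  rw [this]

/-- Every element of `B_η` is `jumpSet p` for a unique `p`. -/
noncomputable def jumpEquiv : Bool × Finset ℚ ≃ Beta :=
  Equiv.ofBijective (fun p => ⟨jumpSet p, jumpSet_mem p⟩)
    ⟨fun _ _ h => jumpSet_injective (congrArg Subtype.val h), fun b => by
      obtain ⟨S, hS⟩ := exists_finset_of_mem b.2
      obtain ⟨p, hp⟩ := exists_jumpSet_eq S b.1 hS
      exact ⟨p, Subtype.ext hp⟩⟩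

theorem jumpEquiv_coe (p : Bool × Finset ℚ) : (jumpEquiv p : Set ℚ) = jumpSet p := rfl

/-- The code of a rational number, from its sign, numerator and denominator in lowest terms. -/
def ratCode (q : ℚ) : ℕ :=
  Nat.pair (2 * q.num.natAbs + if q.num < 0 then 1 else 0) q.den

/-- The code of `b ∈ B_η`: its last binary digit tells whether `b` contains all sufficiently small
rationals, and the other nonzero digits mark the codes of the points where `b` jumps. -/
noncomputable def betaCode (b : Beta) : ℕ :=
  2 * (∑ q ∈ (jumpEquiv.symm b).2, 2 ^ ratCode q) + (jumpEquiv.symm b).1.toNat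

theorem ratCode_injective : Function.Injective ratCode := by
  intro p q h
  simp only [ratCode, Nat.pair_eq_pair] at h
  obtain ⟨h1, h2⟩ := h
  refine Rat.ext ?_ h2
  split_ifs at h1 <;> omega

theorem mem_range_ratCode (n : ℕ) : n ∈ Set.range ratCode ↔
    n.unpair.2 ≠ 0 ∧ Nat.Coprime (n.unpair.1 / 2) n.unpair.2 ∧
      (n.unpair.1 % 2 = 1 → n.unpair.1 / 2 ≠ 0) := by
  constructor
  · rintro ⟨q, rfl⟩
    simp only [ratCode, Nat.unpair_pair]
    refine ⟨q.den_nz, ?_, ?_⟩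
    · convert! q.reduced using 2
      split_ifs <;> omega
    · split_ifs <;> omega
  · rintro ⟨h1, h2, h3⟩
    rcases Nat.mod_two_eq_zero_or_one n.unpair.1 with h | h
    · refine ⟨⟨(n.unpair.1 / 2 : ℕ), n.unpair.2, h1, by rwa [Int.natAbs_natCast]⟩, ?_⟩
      have : ¬ (((n.unpair.1 / 2 : ℕ) : ℤ) < 0) := by omega
      simp only [ratCode, this, if_false, Int.natAbs_natCast]
      conv_rhs => rw [← Nat.pair_unpair n]
      congr 1; omega
    · have h4 := h3 h
      refine ⟨⟨-(n.unpair.1 / 2 : ℕ), n.unpair.2, h1, by rwa [Int.natAbs_neg, Int.natAbs_natCast]⟩, ?_⟩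
      have : (-((n.unpair.1 / 2 : ℕ) : ℤ) < 0) := by omega
      simp only [ratCode, this, if_true, Int.natAbs_neg, Int.natAbs_natCast]
      conv_rhs => rw [← Nat.pair_unpair n]
      congr 1; omega

theorem testBit_sum (S : Finset ℚ) (k : ℕ) :
    (∑ q ∈ S, 2 ^ ratCode q).testBit k = true ↔ ∃ q ∈ S, ratCode q = k := by
  classical
  have h1 : ∑ q ∈ S, 2 ^ ratCode q = Finset.equivBitIndices.symm (S.image ratCode) := by
    rw [Finset.equivBitIndices_symm_apply, Finset.sum_image fun _ _ _ _ h => ratCode_injective h]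
  rw [← Nat.mem_bitIndices, ← List.mem_toFinset, h1]
  have := Finset.equivBitIndices.apply_symm_apply (S.image ratCode)
  rw [Finset.equivBitIndices_apply] at this
  rw [this]; simp

theorem betaCode_injective : Function.Injective betaCode := by
  intro b c h
  apply jumpEquiv.symm.injective
  generalize hp : jumpEquiv.symm b = p at *
  generalize hq : jumpEquiv.symm c = q at *
  simp only [betaCode, hp, hq] at h
  obtain ⟨e, S⟩ := p
  obtain ⟨e', T⟩ := q
  have h1 : e = e' := by cases e <;> cases e' <;> simp at h ⊢ <;> omega
  subst h1
  have h2 : ∑ q ∈ S, 2 ^ ratCode q = ∑ q ∈ T, 2 ^ ratCode q := by simpa using h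
  have : S = T := by
    ext q
    have h3 := testBit_sum S (ratCode q)
    have h4 := testBit_sum T (ratCode q)
    rw [h2, h4] at h3
    constructor
    · intro hS
      obtain ⟨r, hr, hrq⟩ := h3.2 ⟨q, hS, rfl⟩
      rwa [← ratCode_injective hrq]
    · intro hT
      obtain ⟨r, hr, hrq⟩ := h3.1 ⟨q, hT, rfl⟩
      rwa [← ratCode_injective hrq]
  rw [this]

theorem mem_range_betaCode (n : ℕ) : n ∈ Set.range betaCode ↔
    ∀ k < n, n / 2 / 2 ^ k % 2 = 1 → k ∈ Set.range ratCode := by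
  classical
  constructor
  · rintro ⟨b, rfl⟩ k _ hk
    have h1 : betaCode b / 2 = ∑ q ∈ (jumpEquiv.symm b).2, 2 ^ ratCode q := by
      have : (jumpEquiv.symm b).1.toNat ≤ 1 := Bool.toNat_le _
      simp only [betaCode]; omega
    rw [h1] at hk
    obtain ⟨q, _, rfl⟩ := (testBit_sum _ k).1
      (by rw [Nat.testBit_eq_decide_div_mod_eq]; simpa using hk)
    exact ⟨q, rfl⟩
  · intro h
    have h' : ∀ k ∈ Finset.equivBitIndices (n / 2), k ∈ Set.range ratCode := by
      intro k hk
      rw [Finset.equivBitIndices_apply, List.mem_toFinset, Nat.mem_bitIndices] at hk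
      refine h k ?_ (by rw [Nat.testBit_eq_decide_div_mod_eq] at hk; simpa using hk)
      have := Nat.ge_two_pow_of_testBit hk
      have := Nat.lt_two_pow_self (n := k)
      omega
    refine ⟨jumpEquiv (decide (n % 2 = 1),
      (Finset.equivBitIndices (n / 2)).preimage ratCode ratCode_injective.injOn), ?_⟩
    simp only [betaCode, Equiv.symm_apply_apply]
    have h1 : ∑ q ∈ (Finset.equivBitIndices (n / 2)).preimage ratCode ratCode_injective.injOn,
        2 ^ ratCode q = n / 2 := by
      rw [Finset.sum_preimage ratCode (Finset.equivBitIndices (n / 2)) ratCode_injective.injOn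
        (fun k => 2 ^ k) fun k hk hk' => absurd (h' k hk) hk']
      exact Finset.equivBitIndices.symm_apply_apply (n / 2)
    rw [h1]
    rcases Nat.mod_two_eq_zero_or_one n with hn | hn <;> simp [hn] <;> omega

theorem primrecPred_mem_range_ratCode : PrimrecPred fun n => n ∈ Set.range ratCode := by
  have u1 : Primrec fun n : ℕ => n.unpair.1 := Primrec.fst.comp Primrec.unpair
  have u2 : Primrec fun n : ℕ => n.unpair.2 := Primrec.snd.comp Primrec.unpair
  have half : Primrec fun n : ℕ => n.unpair.1 / 2 := Primrec.nat_div.comp u1 (.const 2)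
  have cop : PrimrecRel fun (n p : ℕ) =>
      ∀ d < n, p.unpair.1 % d = 0 → p.unpair.2 % d = 0 → d ≤ 1 := by
    refine PrimrecRel.forall_lt (R := fun d p : ℕ =>
      p.unpair.1 % d = 0 → p.unpair.2 % d = 0 → d ≤ 1) ?_
    have a1 : PrimrecPred fun x : ℕ × ℕ => x.2.unpair.1 % x.1 = 0 :=
      Primrec.eq.comp (Primrec.nat_mod.comp (u1.comp .snd) .fst) (.const 0)
    have a2 : PrimrecPred fun x : ℕ × ℕ => x.2.unpair.2 % x.1 = 0 :=
      Primrec.eq.comp (Primrec.nat_mod.comp (u2.comp .snd) .fst) (.const 0)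
    have a3 : PrimrecPred fun x : ℕ × ℕ => x.1 ≤ 1 := Primrec.nat_le.comp .fst (.const 1)
    exact ((a1.not).or ((a2.not).or a3)).of_eq fun x => by tauto
  have c1 : PrimrecPred fun n : ℕ => n.unpair.2 ≠ 0 := (Primrec.eq.comp u2 (.const 0)).not
  have c2 : PrimrecPred fun n : ℕ => ∀ d < n.unpair.2 + 1,
      (Nat.pair (n.unpair.1 / 2) n.unpair.2).unpair.1 % d = 0 →
      (Nat.pair (n.unpair.1 / 2) n.unpair.2).unpair.2 % d = 0 → d ≤ 1 :=
    cop.comp (Primrec.succ.comp u2) (Primrec₂.natPair.comp half u2)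
  have c3 : PrimrecPred fun n : ℕ => n.unpair.1 % 2 = 1 :=
    Primrec.eq.comp (Primrec.nat_mod.comp u1 (.const 2)) (.const 1)
  have c4 : PrimrecPred fun n : ℕ => n.unpair.1 / 2 ≠ 0 := (Primrec.eq.comp half (.const 0)).not
  refine (c1.and (c2.and ((c3.not).or c4))).of_eq fun n => ?_
  rw [mem_range_ratCode]
  refine and_congr_right fun h => and_congr ?_ (by tauto)
  simp only [Nat.unpair_pair]
  constructor
  · intro h'
    have hpos : 0 < n.unpair.2 := Nat.pos_of_ne_zero h
    have hle := Nat.le_of_dvd hpos (Nat.gcd_dvd_right (n.unpair.1 / 2) n.unpair.2)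
    have h1 := h' _ (Nat.lt_succ_of_le hle) (Nat.mod_eq_zero_of_dvd (Nat.gcd_dvd_left _ _))
      (Nat.mod_eq_zero_of_dvd (Nat.gcd_dvd_right _ _))
    have h2 := Nat.gcd_pos_of_pos_right (n.unpair.1 / 2) hpos
    exact le_antisymm h1 h2
  · intro h' d _ h1 h2
    exact (Nat.Coprime.eq_one_of_dvd (h'.coprime_dvd_left (Nat.dvd_of_mod_eq_zero h1))
      (Nat.dvd_of_mod_eq_zero h2)).le

theorem primrecPred_mem_range_betaCode : PrimrecPred fun n => n ∈ Set.range betaCode := by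
  have pow2 : Primrec fun k : ℕ => 2 ^ k :=
    (Primrec₂.unpaired'.1 Nat.Primrec.pow).comp (.const 2) .id
  have a1 : PrimrecPred fun x : ℕ × ℕ => x.2 / 2 / 2 ^ x.1 % 2 = 1 :=
    Primrec.eq.comp (Primrec.nat_mod.comp (Primrec.nat_div.comp
      (Primrec.nat_div.comp .snd (.const 2)) (pow2.comp .fst)) (.const 2)) (.const 1)
  have a2 : PrimrecRel fun k n : ℕ => n / 2 / 2 ^ k % 2 = 1 → k ∈ Set.range ratCode :=
    ((a1.not).or (primrecPred_mem_range_ratCode.comp .fst)).of_eq fun x => by tauto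
  exact ((PrimrecRel.forall_lt a2).comp .id .id).of_eq fun n => (mem_range_betaCode n).symm

theorem FunComputableIn.mono {d e : Degree} (h : d ≤ e) {g : ℕ → ℕ} (hg : FunComputableIn d g) :
    FunComputableIn e g := by
  obtain ⟨A, rfl, hA⟩ := hg
  induction e using Quotient.inductionOn with
  | _ B =>
    exact ⟨B, rfl, RecursiveIn.subst hA fun f hf => by
      rw [Set.mem_singleton_iff.1 hf]; exact h⟩

theorem FunComputableIn.comp {d : Degree} {f g : ℕ → ℕ} (hf : FunComputableIn d f)
    (hg : FunComputableIn d g) : FunComputableIn d (f ∘ g) := by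
  obtain ⟨A, rfl, hA⟩ := hf
  obtain ⟨B, hBA, hB⟩ := hg
  have h : deg B ≤ deg A := hBA.le
  have hB' : RecursiveIn {charFun A} (fun n => Part.some (g n)) :=
    RecursiveIn.subst hB fun f hf => by rw [Set.mem_singleton_iff.1 hf]; exact h
  exact ⟨A, rfl, RecursiveIn.iff_nat.2 (recursiveIn_comp (f := f) (g := g)
    (RecursiveIn.iff_nat.1 hA) (RecursiveIn.iff_nat.1 hB'))⟩

/-- The automorphism `φ` of `B_η` is computable in the degree `d`. (The set of codes is computable,
so it does not matter how the function acting on codes behaves elsewhere.) -/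
def AutComputableIn (d : Degree) (φ : Beta ≃o Beta) : Prop :=
  ∃ g : ℕ → ℕ, FunComputableIn d g ∧ ∀ b, g (betaCode b) = betaCode (φ b)

theorem AutComputableIn.symm {d : Degree} {φ : Beta ≃o Beta} (h : AutComputableIn d φ) :
    AutComputableIn d φ.symm := by
  classical
  obtain ⟨g, ⟨A, rfl, hA⟩, hg⟩ := h
  have hA' := RecursiveIn.iff_nat.1 hA
  have sel : Primrec fun x : ℕ => if x.unpair.1.unpair.1 ∈ Set.range betaCode then
      (if x.unpair.1.unpair.2 ∈ Set.range betaCode ∧ x.unpair.2 = x.unpair.1.unpair.1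
        then 0 else 1) else 0 := by
    have v1 : Primrec fun x : ℕ => x.unpair.1.unpair.1 :=
      Primrec.fst.comp (Primrec.unpair.comp (Primrec.fst.comp Primrec.unpair))
    have v2 : Primrec fun x : ℕ => x.unpair.1.unpair.2 :=
      Primrec.snd.comp (Primrec.unpair.comp (Primrec.fst.comp Primrec.unpair))
    have v3 : Primrec fun x : ℕ => x.unpair.2 := Primrec.snd.comp Primrec.unpair
    exact Primrec.ite (primrecPred_mem_range_betaCode.comp v1)
      (Primrec.ite ((primrecPred_mem_range_betaCode.comp v2).and (Primrec.eq.comp v3 v1))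
        (.const 0) (.const 1)) (.const 0)
  have h1 := recursiveIn_comp (recursiveIn_of_primrec (O := {charFun A}) sel)
    (recursiveIn_pair (recursiveIn_of_primrec Primrec.id)
      (recursiveIn_comp hA' (recursiveIn_of_primrec (Primrec.snd.comp Primrec.unpair))))
  let G : ℕ → ℕ := fun m => if h : m ∈ Set.range betaCode then betaCode (φ.symm h.choose) else 0
  refine ⟨G, ⟨A, rfl, RecursiveIn.iff_nat.2
    (recursiveIn_search h1 (fun m => ?_) fun m k hk => ?_)⟩, fun b => ?_⟩
  · by_cases hm : m ∈ Set.range betaCode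
    · have hG : G m = betaCode (φ.symm hm.choose) := dif_pos hm
      have hch := hm.choose_spec
      generalize hm.choose = b at *
      subst hch
      simp [hG, hg]
    · simp only [id, Nat.unpair_pair, hm, if_false]
  · by_cases hm : m ∈ Set.range betaCode
    · have hG : G m = betaCode (φ.symm hm.choose) := dif_pos hm
      have hch := hm.choose_spec
      generalize hm.choose = b at *
      subst hch
      rw [hG] at hk
      simp only [id, Nat.unpair_pair, hm, if_true]
      intro h0
      have h0' : k ∈ Set.range betaCode ∧ g k = betaCode b := by
        by_contra hc
        rw [if_neg hc] at h0
        exact one_ne_zero h0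
      obtain ⟨⟨c, rfl⟩, hc⟩ := h0'
      rw [hg] at hc
      rw [← betaCode_injective hc, φ.symm_apply_apply] at hk
      exact lt_irrefl _ hk
    · have hG : G m = 0 := dif_neg hm
      rw [hG] at hk
      exact absurd hk (Nat.not_lt_zero k)
  · have hm : betaCode b ∈ Set.range betaCode := ⟨b, rfl⟩
    have hG : G (betaCode b) = betaCode (φ.symm hm.choose) := dif_pos hm
    rw [hG, betaCode_injective hm.choose_spec]

/-- The group `Aut_I(B_η)` of the automorphisms of the Boolean algebra `B_η` that are computable in
some degree of `I`. -/
def autIdeal (I : TuringIdeal) : Subgroup (Beta ≃o Beta) where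
  carrier := {φ | ∃ d ∈ I, AutComputableIn d φ}
  one_mem' := by
    obtain ⟨d, hd⟩ := I.nonempty
    induction d using Quotient.inductionOn with
    | _ A =>
      exact ⟨deg A, hd, id, ⟨A, rfl, ComputableIn.id⟩, fun _ => rfl⟩
  mul_mem' := by
    rintro φ ψ ⟨d, hd, f, hf, hf'⟩ ⟨e, he, g, hg, hg'⟩
    refine ⟨d ⊔ e, Order.Ideal.sup_mem hd he, f ∘ g,
      (hf.mono le_sup_left).comp (hg.mono le_sup_right), fun b => ?_⟩
    simp [hg', hf', RelIso.mul_apply]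
  inv_mem' := by
    rintro φ ⟨d, hd, h⟩
    exact ⟨d, hd, h.symm⟩

/-- The lattice `L_I(B_η)` of those subalgebras of `B_η` that are c.e. in some degree of `I`,
ordered by inclusion. -/
def SubalgebraLattice (I : TuringIdeal) : Type :=
  {S : BooleanSubalgebra Beta // ∃ d ∈ I, CEIn d (betaCode '' (S : Set Beta))}

instance (I : TuringIdeal) : PartialOrder (SubalgebraLattice I) :=
  inferInstanceAs (PartialOrder {S : BooleanSubalgebra Beta //
    ∃ d ∈ I, CEIn d (betaCode '' (S : Set Beta))})

/-- The group `G` embeds in the group `H`. -/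
def GroupEmbeds (G H : Type*) [Group G] [Group H] : Prop :=
  ∃ f : G →* H, Function.Injective f

end SubstructureLattice

namespace SubstructureLattice

/-! ### Relativized `Σ₁` predicates on the natural numbers -/

/-! Write `permIdeal I ℕ` for the group of permutations of ℕ computable in the ideal `I`. The three
equivalences share one scheme.

An embedding forces `I ⊆ J`. A set `A` of degree in `I` is coded by three permutations `s`, `a`,
`b`: the commutator of `b` with the conjugate of `a` by the `n`-th power of `s` is a fixed `c ≠ 1`
if `n ∈ A`, and is `1` otherwise (`codesSet_permIdeal`). Group embeddings preserve such a code, and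
`permIdeal I ℕ` embeds in each of the three groups for `I`, by permuting the unit vectors or the
blocks `[k, k + 1)`. In each of the groups for `J` an element acts through a relation that is c.e.
in `J`; hence both "the `n`-th commutator is `c`" and "it is `1`" can be enumerated at suitable
arguments, and Post's theorem puts the degree of `A` into `J` (`CodesSet.deg_mem`).

The inclusion `I ⊆ J` gives an embedding. For computable automorphisms of `B_η` this is an inclusion
of groups. For the lattices, an automorphism is extended to the lattice of all substructures by its
action on one-generated ones (`restrictEquiv`). It remains to see that an automorphism preserving
"c.e. in `I`" also preserves "c.e. in `J`". This follows, as does the representation used above,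
from one fact: the relation `Φ (gen x) = gen y` is c.e. in `I` (`cep_apply_gen_eq`,
`cep_apply_gen_eq_beta`).

For subspaces, let `Γ ∩ K = 0`, `k ∈ K`, `x ∉ K` and `x + k ∈ Γ`. If `Φ` takes the line of `x` to
that of `u`, it takes the line of `k` to that of any `y ∈ Φ K` with `u + y ∈ Φ Γ`. When `Γ` and `K`
are c.e., so are their images, and `y` is found by search. Spaces `K` given by vanishing at the
indices in one residue class modulo 3 let one pass from each unit vector to the next, then to all
lines inside such a `K`, and finally to an arbitrary line, which is an intersection of two planes
spanned by lines of that kind.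

For subalgebras, symmetric difference takes the place of addition: `gen (p ∆ t)` is determined in
the lattice by `gen p` and `gen t` (`gen_eq_gen_symmDiff`). Subalgebras `L`, `D` with trivial
intersection again transport values. Three such pairs, built from fractional linear maps, lead from
`[0, q)` to `[0, q + 1)` and to `[0, q / (q + 1))`; by the Euclidean algorithm all positive
rationals are reached from `1`, and symmetric differences give the rest. -/

/-- The total function `g` is recursive in the set `A`. -/
def TotIn (A : Set ℕ) (g : ℕ → ℕ) : Prop :=
  Nat.RecursiveIn {charFun A} (fun n => Part.some (g n))

namespace TotIn

variable {A : Set ℕ} {f g : ℕ → ℕ}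

theorem of_primrec (hf : Primrec f) : TotIn A f := recursiveIn_of_primrec hf

theorem of_computable (hf : Computable f) : TotIn A f :=
  Nat.Partrec.recursiveIn (Partrec.nat_iff.1 hf)

theorem comp (hf : TotIn A f) (hg : TotIn A g) : TotIn A (fun n => f (g n)) :=
  recursiveIn_comp hf hg

theorem pair (hf : TotIn A f) (hg : TotIn A g) : TotIn A (fun n => Nat.pair (f n) (g n)) :=
  recursiveIn_pair hf hg

theorem of_eq (hf : TotIn A f) (h : ∀ n, f n = g n) : TotIn A g := (funext h : f = g) ▸ hf

theorem comp₂ {k : ℕ → ℕ → ℕ} (hk : Primrec₂ k) (hf : TotIn A f) (hg : TotIn A g) :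
    TotIn A (fun n => k (f n) (g n)) := by
  have h : Primrec fun n : ℕ => k n.unpair.1 n.unpair.2 :=
    hk.comp (Primrec.fst.comp Primrec.unpair) (Primrec.snd.comp Primrec.unpair)
  exact ((of_primrec h).comp (hf.pair hg)).of_eq fun n => by simp

theorem fst (hf : TotIn A f) : TotIn A (fun n => (f n).unpair.1) :=
  (of_primrec (Primrec.fst.comp Primrec.unpair)).comp hf

theorem snd (hf : TotIn A f) : TotIn A (fun n => (f n).unpair.2) :=
  (of_primrec (Primrec.snd.comp Primrec.unpair)).comp hf

theorem id : TotIn A (fun n => n) := of_primrec Primrec.id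

theorem const (c : ℕ) : TotIn A (fun _ => c) := of_primrec (Primrec.const c)

theorem iterate (hf : TotIn A f) : TotIn A (fun p => f^[p.unpair.1] p.unpair.2) := by
  have h1 := Nat.RecursiveIn.prec (O := {charFun A}) (TotIn.id (A := A))
    (hf.comp (TotIn.id.snd.snd))
  have h2 : TotIn A (fun p => f^[p.unpair.2] p.unpair.1) := by
    refine Nat.RecursiveIn.of_eq h1 fun p => ?_
    simp only
    generalize p.unpair.2 = n
    induction n with
    | zero => rfl
    | succ n ih =>
      simp only at ih ⊢
      rw [ih, Function.iterate_succ_apply']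
      simp
  exact (h2.comp (TotIn.id.snd.pair TotIn.id.fst)).of_eq fun n => by simp

theorem mono {B : Set ℕ} (h : TuringLE A B) (hf : TotIn A f) : TotIn B f :=
  Nat.RecursiveIn.subst hf fun g hg => by
    rw [Set.mem_singleton_iff.1 hg]
    exact RecursiveIn.iff_nat.1 h

end TotIn

/-- `P` is `Σ₁` relative to `A`. -/
def Sig1 (A : Set ℕ) (P : ℕ → Prop) : Prop :=
  ∃ g, TotIn A g ∧ ∀ x, P x ↔ ∃ k, g (Nat.pair x k) = 0

/-- Iterates of a relation. -/
def iterRel {X : Type*} (R : X → X → Prop) : ℕ → X → X → Prop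
  | 0, x, y => x = y
  | n + 1, x, z => ∃ y, R x y ∧ iterRel R n y z

theorem iterRel_succ_right {X : Type*} {R : X → X → Prop} {n : ℕ} {x z : X} :
    iterRel R (n + 1) x z ↔ ∃ y, iterRel R n x y ∧ R y z := by
  induction n generalizing x with
  | zero => simp [iterRel]
  | succ n ih =>
    rw [iterRel]
    simp only [ih]
    constructor
    · rintro ⟨y, h1, w, h2, h3⟩
      exact ⟨w, ⟨y, h1, h2⟩, h3⟩
    · rintro ⟨w, ⟨y, h1, h2⟩, h3⟩
      exact ⟨y, h1, w, h2, h3⟩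

theorem reflTransGen_iff_iterRel {X : Type*} {R : X → X → Prop} {x y : X} :
    Relation.ReflTransGen R x y ↔ ∃ n, iterRel R n x y := by
  constructor
  · intro h
    induction h with
    | refl => exact ⟨0, rfl⟩
    | tail _ h ih => exact ⟨_, iterRel_succ_right.2 ⟨_, ih.choose_spec, h⟩⟩
  · rintro ⟨n, h⟩
    induction n generalizing x with
    | zero => cases h; exact .refl
    | succ n ih => obtain ⟨z, h1, h2⟩ := h; exact .head h1 (ih h2)

/-! ### Closure properties of relativized `Σ₁` predicates. -/

namespace Sig1

variable {A : Set ℕ} {P Q : ℕ → Prop}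

theorem of_iff (hP : Sig1 A P) (h : ∀ x, Q x ↔ P x) : Sig1 A Q :=
  (funext fun x => propext (h x) : Q = P) ▸ hP

theorem mono {B : Set ℕ} (h : TuringLE A B) (hP : Sig1 A P) : Sig1 B P := by
  obtain ⟨g, hg, h'⟩ := hP
  exact ⟨g, hg.mono h, h'⟩

theorem of_totIn {g : ℕ → ℕ} (hg : TotIn A g) : Sig1 A (fun x => g x = 0) :=
  ⟨_, hg.comp TotIn.id.fst, fun x => by simp⟩

theorem of_primrecPred (hP : PrimrecPred P) : Sig1 A P := by
  classical
  have : Primrec fun n => if P n then 0 else 1 := Primrec.ite hP (.const 0) (.const 1)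
  exact (of_totIn (TotIn.of_primrec this)).of_iff fun x => by by_cases h : P x <;> simp [h]

theorem and (hP : Sig1 A P) (hQ : Sig1 A Q) : Sig1 A (fun x => P x ∧ Q x) := by
  obtain ⟨f, hf, hP⟩ := hP
  obtain ⟨g, hg, hQ⟩ := hQ
  refine ⟨_, TotIn.comp₂ Primrec.nat_add (hf.comp (TotIn.id.fst.pair TotIn.id.snd.fst))
    (hg.comp (TotIn.id.fst.pair TotIn.id.snd.snd)), fun x => ?_⟩
  simp only [hP, hQ, Nat.unpair_pair, Nat.add_eq_zero_iff]
  constructor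
  · rintro ⟨⟨a, ha⟩, b, hb⟩
    exact ⟨Nat.pair a b, by simpa using ⟨ha, hb⟩⟩
  · rintro ⟨k, h1, h2⟩
    exact ⟨⟨_, h1⟩, _, h2⟩

theorem or (hP : Sig1 A P) (hQ : Sig1 A Q) : Sig1 A (fun x => P x ∨ Q x) := by
  obtain ⟨f, hf, hP⟩ := hP
  obtain ⟨g, hg, hQ⟩ := hQ
  refine ⟨_, TotIn.comp₂ Primrec.nat_mul hf hg, fun x => ?_⟩
  simp only [hP, hQ, mul_eq_zero, exists_or]

theorem ex {R : ℕ → ℕ → Prop} (hR : Sig1 A (fun p => R p.unpair.1 p.unpair.2)) :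
    Sig1 A (fun x => ∃ y, R x y) := by
  obtain ⟨g, hg, hR⟩ := hR
  refine ⟨_, hg.comp ((TotIn.id.fst.pair TotIn.id.snd.fst).pair TotIn.id.snd.snd), fun x => ?_⟩
  have h := fun y => hR (Nat.pair x y)
  simp only [Nat.unpair_pair] at h ⊢
  simp only [h]
  constructor
  · rintro ⟨y, k, h⟩
    exact ⟨Nat.pair y k, by simpa using h⟩
  · rintro ⟨k, h⟩
    exact ⟨_, _, h⟩

theorem comp {f : ℕ → ℕ} (hP : Sig1 A P) (hf : TotIn A f) : Sig1 A (fun x => P (f x)) := by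
  obtain ⟨g, hg, hP⟩ := hP
  refine ⟨_, hg.comp ((hf.comp TotIn.id.fst).pair TotIn.id.snd), fun x => ?_⟩
  simp only [hP, Nat.unpair_pair]

/-- A path of `n` steps is guessed as one number that lists its points together with the witnesses
for the steps. All later recursive enumerations rest on this uniformity in `n`. -/
theorem iter {R : ℕ → ℕ → Prop} (hR : Sig1 A (fun p => R p.unpair.1 p.unpair.2)) :
    Sig1 A (fun p => iterRel R p.unpair.1 p.unpair.2.unpair.1 p.unpair.2.unpair.2) := by
  obtain ⟨g, hg, hR⟩ := hR
  have hR' : ∀ x y, R x y ↔ ∃ k, g (Nat.pair (Nat.pair x y) k) = 0 := fun x y => by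
    simpa using hR (Nat.pair x y)
  -- A state `⟨x, ⟨s, c⟩⟩` holds the current point, the unread part `⟨next point, ⟨witness, rest⟩⟩`
  -- of the guess, and the sum of the values of `g` so far.
  let step : ℕ → ℕ := fun st => Nat.pair st.unpair.2.unpair.1.unpair.1
    (Nat.pair st.unpair.2.unpair.1.unpair.2.unpair.2 (st.unpair.2.unpair.2 +
      g (Nat.pair (Nat.pair st.unpair.1 st.unpair.2.unpair.1.unpair.1)
        st.unpair.2.unpair.1.unpair.2.unpair.1)))
  have hstep : TotIn A step := by
    have s : TotIn A fun st => st.unpair.2.unpair.1 := TotIn.id.snd.fst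
    exact s.fst.pair (s.snd.snd.pair (TotIn.comp₂ Primrec.nat_add TotIn.id.snd.snd
      (hg.comp ((TotIn.id.fst.pair s.fst).pair s.snd.fst))))
  have step_eq : ∀ x x' k s c, step (Nat.pair x (Nat.pair (Nat.pair x' (Nat.pair k s)) c)) =
      Nat.pair x' (Nat.pair s (c + g (Nat.pair (Nat.pair x x') k))) := fun x x' k s c => by
    simp [step]
  -- The sum only grows, so it is `0` at the end exactly if it started at `0` and every guessed
  -- witness was correct.
  have key : ∀ n x y c, (∃ s, (step^[n] (Nat.pair x (Nat.pair s c))).unpair.1 = y ∧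
      (step^[n] (Nat.pair x (Nat.pair s c))).unpair.2.unpair.2 = 0) ↔
      c = 0 ∧ iterRel R n x y := by
    intro n
    induction n with
    | zero => intro x y c; simp [iterRel, and_comm]
    | succ n ih =>
      intro x y c
      constructor
      · rintro ⟨s, hs⟩
        rw [← Nat.pair_unpair s, ← Nat.pair_unpair s.unpair.2, Function.iterate_succ_apply,
          step_eq] at hs
        obtain ⟨h1, h2⟩ := (ih _ _ _).1 ⟨_, hs⟩
        exact ⟨by omega, _, (hR' _ _).2 ⟨s.unpair.2.unpair.1, by omega⟩, h2⟩
      · rintro ⟨rfl, x', h1, h2⟩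
        obtain ⟨k, hk⟩ := (hR' _ _).1 h1
        obtain ⟨s, hs⟩ := (ih x' y 0).2 ⟨rfl, h2⟩
        refine ⟨Nat.pair x' (Nat.pair k s), ?_⟩
        rw [Function.iterate_succ_apply, step_eq, hk]
        exact hs
  have F : TotIn A fun p => step^[p.unpair.1.unpair.1]
      (Nat.pair p.unpair.1.unpair.2.unpair.1 (Nat.pair p.unpair.2 0)) :=
    (hstep.iterate.comp (TotIn.id.fst.fst.pair
      (TotIn.id.fst.snd.fst.pair (TotIn.id.snd.pair (TotIn.const 0))))).of_eq fun p => by simp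
  have Y : TotIn A fun p => p.unpair.1.unpair.2.unpair.2 := TotIn.id.fst.snd.snd
  -- Two opposite truncated differences test that the path ends at the required point; the last
  -- summand tests the witnesses.
  refine ⟨_, TotIn.comp₂ Primrec.nat_add (TotIn.comp₂ Primrec.nat_add
    (TotIn.comp₂ Primrec.nat_sub F.fst Y) (TotIn.comp₂ Primrec.nat_sub Y F.fst)) F.snd.snd,
    fun p => ?_⟩
  have := key p.unpair.1 p.unpair.2.unpair.1 p.unpair.2.unpair.2 0
  simp only [true_and] at this
  simp only [← this, Nat.unpair_pair]
  exact exists_congr fun s => by omega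

end Sig1

/-! ### Relative computability expressed through graphs. -/

/-- The graph of a partial function recursive in `A` is `Σ₁` relative to `A`. -/
theorem Sig1.graph {A : Set ℕ} {f : ℕ →. ℕ} (hf : Nat.RecursiveIn {charFun A} f) :
    Sig1 A (fun p => p.unpair.2 ∈ f p.unpair.1) := by
  have tot : ∀ {g : ℕ → ℕ}, TotIn A g →
      Sig1 A (fun p => p.unpair.2 ∈ (Part.some (g p.unpair.1) : Part ℕ)) := fun {g} hg => by
    refine (Sig1.of_totIn (TotIn.comp₂ Primrec.nat_add
      (TotIn.comp₂ Primrec.nat_sub (hg.comp TotIn.id.fst) TotIn.id.snd)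
      (TotIn.comp₂ Primrec.nat_sub TotIn.id.snd (hg.comp TotIn.id.fst)))).of_iff fun p => ?_
    rw [Part.mem_some_iff]
    omega
  have eqs : ∀ {g h : ℕ → ℕ}, TotIn A g → TotIn A h → Sig1 A (fun p => g p = h p) :=
    fun {g h} hg hh => by
    refine (Sig1.of_totIn (TotIn.comp₂ Primrec.nat_add
      (TotIn.comp₂ Primrec.nat_sub hg hh) (TotIn.comp₂ Primrec.nat_sub hh hg))).of_iff
        fun p => ?_
    omega
  induction hf with
  | zero => exact tot (TotIn.const 0)
  | succ => exact tot (TotIn.of_primrec Primrec.succ)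
  | left => exact tot TotIn.id.fst
  | right => exact tot TotIn.id.snd
  | oracle g hg =>
    rw [Set.mem_singleton_iff.1 hg]
    exact tot (Nat.RecursiveIn.oracle _ rfl)
  | @pair f h _ _ ihf ihh =>
    have h1 := (ihf.comp (TotIn.id.fst.pair TotIn.id.snd.fst)).and
      (ihh.comp (TotIn.id.fst.pair TotIn.id.snd.snd))
    refine h1.of_iff fun p => ?_
    simp only [Nat.unpair_pair, Seq.seq, Part.map_eq_map, Part.mem_bind_iff,
      Part.mem_map_iff]
    constructor
    · rintro ⟨_, ⟨a, ha, rfl⟩, b, hb, h⟩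
      rw [← h]
      simpa using ⟨ha, hb⟩
    · rintro ⟨ha, hb⟩
      exact ⟨_, ⟨_, ha, rfl⟩, _, hb, by simp⟩
  | @comp f h _ _ ihf ihh =>
    have h1 := Sig1.ex (R := fun p z => z ∈ h p.unpair.1 ∧ p.unpair.2 ∈ f z)
      (((ihh.comp (TotIn.id.fst.fst.pair TotIn.id.snd)).and
      (ihf.comp (TotIn.id.snd.pair TotIn.id.fst.snd))).of_iff fun p => by simp)
    exact h1.of_iff fun p => Part.mem_bind_iff.trans (by simp)
  | @prec f h _ _ ihf ihh =>
    -- A state `⟨a, ⟨m, i⟩⟩` says that the recursion with parameter `a` has value `i` at stage `m`;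
    -- `R` performs one stage.
    let R : ℕ → ℕ → Prop := fun s t => (t.unpair.1 = s.unpair.1 ∧
      t.unpair.2.unpair.1 = s.unpair.2.unpair.1 + 1) ∧ t.unpair.2.unpair.2 ∈ h s
    have hR : Sig1 A (fun p => R p.unpair.1 p.unpair.2) :=
      ((eqs TotIn.id.snd.fst TotIn.id.fst.fst).and
        (eqs TotIn.id.snd.snd.fst (TotIn.comp₂ Primrec.nat_add TotIn.id.fst.snd.fst
          (TotIn.const 1)))).and
        ((ihh.comp (TotIn.id.fst.pair TotIn.id.snd.snd.snd)).of_iff fun p => by simp)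
    have key : ∀ a n y, (∃ i, i ∈ f a ∧ iterRel R n (Nat.pair a (Nat.pair 0 i))
        (Nat.pair a (Nat.pair n y))) ↔
        y ∈ (Nat.rec (f a) (fun y IH => IH >>= fun i => h (Nat.pair a (Nat.pair y i))) n :
          Part ℕ) := by
      intro a n
      induction n with
      | zero =>
        intro y
        simp only [iterRel, Nat.pair_eq_pair, true_and]
        exact ⟨fun ⟨i, h1, h2⟩ => h2 ▸ h1, fun h => ⟨y, h, rfl⟩⟩
      | succ n ih =>
        intro y
        simp only [Part.bind_eq_bind, Part.mem_bind_iff]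
        simp only [Part.bind_eq_bind] at ih
        simp only [← ih, iterRel_succ_right]
        constructor
        · rintro ⟨i, hi, z, hz, hR⟩
          simp only [R, Nat.unpair_pair] at hR
          have hz' : z = Nat.pair a (Nat.pair n z.unpair.2.unpair.2) := by
            have h1 : z.unpair.2.unpair.1 = n := by omega
            have h2 : a = z.unpair.1 := hR.1.1
            rw [h2, ← h1, Nat.pair_unpair, Nat.pair_unpair]
          rw [hz'] at hz hR
          exact ⟨_, ⟨i, hi, hz⟩, hR.2⟩
        · rintro ⟨w, ⟨i, hi, hz⟩, hw⟩
          exact ⟨i, hi, _, hz, by simpa [R] using hw⟩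
    have h1 := Sig1.ex (R := fun p i => i ∈ f p.unpair.1.unpair.1 ∧
        iterRel R p.unpair.1.unpair.2 (Nat.pair p.unpair.1.unpair.1 (Nat.pair 0 i))
          (Nat.pair p.unpair.1.unpair.1 (Nat.pair p.unpair.1.unpair.2 p.unpair.2)))
      (((ihf.comp (TotIn.id.fst.fst.fst.pair TotIn.id.snd)).and
        (hR.iter.comp (TotIn.id.fst.fst.snd.pair
          ((TotIn.id.fst.fst.fst.pair ((TotIn.const 0).pair TotIn.id.snd)).pair
            (TotIn.id.fst.fst.fst.pair (TotIn.id.fst.fst.snd.pair TotIn.id.fst.snd)))))).of_iff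
        fun p => by simp)
    refine h1.of_iff fun p => ?_
    rw [key]
  | @rfind f _ ihf =>
    -- A step from `⟨a, m⟩` to `⟨a, m + 1⟩` certifies that `f` converges at `⟨a, m⟩` to a nonzero
    -- value, so that a search for a zero passes `m`.
    let R : ℕ → ℕ → Prop := fun s t => t = Nat.pair s.unpair.1 (s.unpair.2 + 1) ∧
      ∃ v, v ∈ f s ∧ v ≠ 0
    have nz : Sig1 A (fun p => p ≠ 0) := Sig1.of_primrecPred
      (Primrec.eq.comp Primrec.id (.const 0)).not
    have hR : Sig1 A (fun p => R p.unpair.1 p.unpair.2) := by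
      refine (eqs TotIn.id.snd (TotIn.id.fst.fst.pair (TotIn.comp₂ Primrec.nat_add
        TotIn.id.fst.snd (TotIn.const 1)))).and ?_
      have := Sig1.ex (R := fun p v => v ∈ f p.unpair.1 ∧ v ≠ 0)
        (((ihf.comp (TotIn.id.fst.fst.pair TotIn.id.snd)).and
          (nz.comp TotIn.id.snd)).of_iff fun p => by simp)
      exact this
    have key : ∀ a n y, iterRel R n (Nat.pair a 0) y ↔
        y = Nat.pair a n ∧ ∀ m < n, ∃ v, v ∈ f (Nat.pair a m) ∧ v ≠ 0 := by
      intro a n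
      induction n with
      | zero => intro y; simp [iterRel, eq_comm]
      | succ n ih =>
        intro y
        rw [iterRel_succ_right]
        simp only [ih, R]
        constructor
        · rintro ⟨_, ⟨rfl, h1⟩, h2, h3⟩
          simp only [Nat.unpair_pair] at h2
          refine ⟨h2, fun m hm => ?_⟩
          rcases Nat.lt_succ_iff_lt_or_eq.1 hm with h | rfl
          · exact h1 m h
          · exact h3
        · rintro ⟨rfl, h⟩
          exact ⟨_, ⟨rfl, fun m hm => h m (by omega)⟩, by simp, h n (by omega)⟩
    have h1 : Sig1 A (fun p => 0 ∈ f p ∧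
        iterRel R p.unpair.2 (Nat.pair p.unpair.1 0) p) :=
      ((ihf.comp (TotIn.id.pair (TotIn.const 0))).and
        (hR.iter.comp (TotIn.id.snd.pair ((TotIn.id.fst.pair (TotIn.const 0)).pair
          TotIn.id)))).of_iff fun p => by simp
    refine h1.of_iff fun p => ?_
    rw [key]
    refine Nat.mem_rfind.trans (and_congr ?_ ?_)
    · simp
    · simp only [Nat.pair_unpair, true_and]
      exact ⟨fun h m hm => by simpa using h hm, fun h m hm => by simpa using h m hm⟩

/-- A value and a witness for it are searched for together, as one number; the search halts because
`g` is total. -/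
theorem TotIn.of_graph {A : Set ℕ} {g : ℕ → ℕ}
    (hg : Sig1 A (fun p => g p.unpair.1 = p.unpair.2)) : TotIn A g := by
  obtain ⟨t, ht, h⟩ := hg
  have h' : ∀ m y, g m = y ↔ ∃ k, t (Nat.pair (Nat.pair m y) k) = 0 := fun m y => by
    simpa using h (Nat.pair m y)
  have ht' : TotIn A fun p => t (Nat.pair (Nat.pair p.unpair.1 p.unpair.2.unpair.1)
      p.unpair.2.unpair.2) := ht.comp ((TotIn.id.fst.pair TotIn.id.snd.fst).pair TotIn.id.snd.snd)
  have ex : ∀ m, ∃ z : ℕ, t (Nat.pair (Nat.pair m z.unpair.1) z.unpair.2) = 0 := fun m => by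
    obtain ⟨k, hk⟩ := (h' m (g m)).1 rfl
    exact ⟨Nat.pair (g m) k, by simpa using hk⟩
  classical
  have hs : TotIn A fun m => Nat.find (ex m) := recursiveIn_search ht'
    (fun m => by simpa using Nat.find_spec (ex m))
    (fun m k hk => by simpa using Nat.find_min (ex m) hk)
  exact hs.fst.of_eq fun m => ((h' m _).2 ⟨_, Nat.find_spec (ex m)⟩).symm

theorem TotIn.graph {A : Set ℕ} {g : ℕ → ℕ} (hg : TotIn A g) :
    Sig1 A (fun p => g p.unpair.1 = p.unpair.2) :=
  (Sig1.graph hg).of_iff fun p => by simp [eq_comm]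

/-- Post's theorem: enumerations of `A` and of its complement together enumerate the graph of the
characteristic function. -/
theorem turingLE_of_sig1 {A B : Set ℕ} (h1 : Sig1 B (· ∈ A)) (h0 : Sig1 B (· ∉ A)) :
    TuringLE A B := by
  rw [turingLE_iff]
  refine TotIn.of_graph (A := B) ?_
  have e : ∀ c, Sig1 B (fun p => p.unpair.2 = c) := fun c => Sig1.of_primrecPred
    (Primrec.eq.comp (Primrec.snd.comp Primrec.unpair) (.const c))
  refine (((h1.comp TotIn.id.fst).and (e 1)).or ((h0.comp TotIn.id.fst).and (e 0))).of_iff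
    fun p => ?_
  by_cases h : p.unpair.1 ∈ A <;> simp [h, eq_comm]

theorem sig1_self (A : Set ℕ) : Sig1 A (· ∈ A) := by
  have h : TotIn A (A.indicator fun _ => 1) := Nat.RecursiveIn.oracle _ rfl
  exact (Sig1.of_totIn (TotIn.comp₂ Primrec.nat_sub (TotIn.const 1) h)).of_iff fun x => by
    by_cases hx : x ∈ A <;> simp [hx]

theorem sig1_compl (A : Set ℕ) : Sig1 A (· ∉ A) := by
  have h : TotIn A (A.indicator fun _ => 1) := Nat.RecursiveIn.oracle _ rfl
  exact (Sig1.of_totIn h).of_iff fun x => by by_cases hx : x ∈ A <;> simp [hx]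

/-- A domain is a projection of a graph; conversely, the search for a `Σ₁` witness is a partial
function with the required domain. -/
theorem ceIn_iff {d : Degree} {B : Set ℕ} : CEIn d B ↔ ∃ A, deg A = d ∧ Sig1 A (· ∈ B) := by
  refine exists_congr fun A => and_congr_right fun _ => ⟨?_, ?_⟩
  · rintro ⟨f, hf, h⟩
    refine (Sig1.ex (R := fun x y => y ∈ f x) (Sig1.graph (RecursiveIn.iff_nat.1 hf))).of_iff
      fun x => (h x).trans Part.dom_iff_mem
  · rintro ⟨g, hg, h⟩
    refine ⟨_, RecursiveIn.iff_nat.2 (Nat.RecursiveIn.rfind hg), fun n => ?_⟩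
    refine (h n).trans ⟨?_, fun hd => ?_⟩
    · rintro ⟨k, hk⟩
      exact Nat.rfind_dom.2 ⟨k, by simp [hk], fun {m} _ => trivial⟩
    · obtain ⟨k, hk, _⟩ := Nat.rfind_dom.1 hd
      exact ⟨k, by simpa using hk⟩

end SubstructureLattice

namespace SubstructureLattice

/-! ### Predicates computably enumerable in a Turing ideal -/

/-- A type whose elements are identified with their codes, which form a c.e. set. -/
class Coded (X : Type*) where
  /-- the code of an element -/
  code : X → ℕ
  code_injective : Function.Injective code
  sig1_range : ∀ A, Sig1 A (· ∈ Set.range code)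

open Coded

instance : Coded ℕ where
  code := id
  code_injective := Function.injective_id
  sig1_range A := (Sig1.of_totIn (TotIn.const 0)).of_iff fun x => by simp

instance {X Y : Type*} [Coded X] [Coded Y] : Coded (X × Y) where
  code p := Nat.pair (code p.1) (code p.2)
  code_injective p q h := by
    obtain ⟨h1, h2⟩ := Nat.pair_eq_pair.1 h
    exact Prod.ext (code_injective h1) (code_injective h2)
  sig1_range A := by
    refine (((sig1_range (X := X) A).comp TotIn.id.fst).and
      ((sig1_range (X := Y) A).comp TotIn.id.snd)).of_iff fun n => ?_
    constructor
    · rintro ⟨p, rfl⟩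
      simp
    · rintro ⟨⟨x, hx⟩, y, hy⟩
      exact ⟨(x, y), by simp only [hx, hy, Nat.pair_unpair]⟩

@[simp] theorem code_nat (n : ℕ) : code n = n := rfl

@[simp] theorem code_prod {X Y : Type*} [Coded X] [Coded Y] (p : X × Y) :
    code p = Nat.pair (code p.1) (code p.2) := rfl

/-- The predicate `P` is c.e. in some degree of the ideal `I`. -/
def CEP (I : TuringIdeal) {X : Type*} [Coded X] (P : X → Prop) : Prop :=
  ∃ A, deg A ∈ I ∧ Sig1 A (fun n => ∃ x, code x = n ∧ P x)

/-- The function `f` is computable in some degree of the ideal `I`. -/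
@[fun_prop]
def Eff (I : TuringIdeal) {X Y : Type*} [Coded X] [Coded Y] (f : X → Y) : Prop :=
  CEP I (fun p : X × Y => f p.1 = p.2)

theorem exists_deg_mem (I : TuringIdeal) : ∃ A, deg A ∈ I := by
  obtain ⟨d, hd⟩ := I.nonempty
  induction d using Quotient.inductionOn with
  | _ A => exact ⟨A, hd⟩

section

variable {I : TuringIdeal} {X Y Z : Type*} [Coded X] [Coded Y] [Coded Z]

/-! ### Closure properties of predicates c.e. in an ideal. -/

namespace CEP

variable {P Q : X → Prop}

theorem of_iff (hP : CEP I P) (h : ∀ x, Q x ↔ P x) : CEP I Q :=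
  (funext fun x => propext (h x) : Q = P) ▸ hP

theorem mono {J : TuringIdeal} (h : (I : Set Degree) ⊆ J) (hP : CEP I P) : CEP J P := by
  obtain ⟨A, hA, h'⟩ := hP
  exact ⟨A, h hA, h'⟩

theorem of_sig1 (h : ∀ A, Sig1 A (fun n => ∃ x : X, code x = n ∧ P x)) : CEP I P := by
  obtain ⟨A, hA⟩ := exists_deg_mem I
  exact ⟨A, hA, h A⟩

theorem true : CEP I (fun _ : X => True) :=
  of_sig1 fun A => (sig1_range A).of_iff fun _ =>
    ⟨fun ⟨x, h, _⟩ => ⟨x, h⟩, fun ⟨x, h⟩ => ⟨x, h, trivial⟩⟩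

theorem false : CEP I (fun _ : X => False) :=
  of_sig1 fun A => (Sig1.of_totIn (TotIn.const 1)).of_iff fun n => by simp

/-- This is where the closure of the ideal under joins is needed: two oracles are merged into one.
-/
theorem exists_common {P : ℕ → Prop} {Q : ℕ → Prop} (hP : ∃ A, deg A ∈ I ∧ Sig1 A P)
    (hQ : ∃ A, deg A ∈ I ∧ Sig1 A Q) : ∃ A, deg A ∈ I ∧ Sig1 A P ∧ Sig1 A Q := by
  obtain ⟨A, hA, hP⟩ := hP
  obtain ⟨B, hB, hQ⟩ := hQ
  exact ⟨setJoin A B, Order.Ideal.sup_mem hA hB, hP.mono (left_le_setJoin A B),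
    hQ.mono (right_le_setJoin A B)⟩

theorem and (hP : CEP I P) (hQ : CEP I Q) : CEP I (fun x => P x ∧ Q x) := by
  obtain ⟨A, hA, hP, hQ⟩ := exists_common hP hQ
  refine ⟨A, hA, (hP.and hQ).of_iff fun n => ?_⟩
  constructor
  · rintro ⟨x, hx, h1, h2⟩
    exact ⟨⟨x, hx, h1⟩, x, hx, h2⟩
  · rintro ⟨⟨x, hx, h1⟩, y, hy, h2⟩
    obtain rfl := code_injective (hx.trans hy.symm)
    exact ⟨x, hx, h1, h2⟩

theorem or (hP : CEP I P) (hQ : CEP I Q) : CEP I (fun x => P x ∨ Q x) := by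
  obtain ⟨A, hA, hP, hQ⟩ := exists_common hP hQ
  refine ⟨A, hA, (hP.or hQ).of_iff fun n => ?_⟩
  simp only [and_or_left, exists_or]

theorem ex {R : X → Y → Prop} (hR : CEP I (fun p : X × Y => R p.1 p.2)) :
    CEP I (fun x => ∃ y, R x y) := by
  obtain ⟨A, hA, hR⟩ := hR
  refine ⟨A, hA, (Sig1.ex (R := fun m n => ∃ p : X × Y, code p = Nat.pair m n ∧ R p.1 p.2)
    (by simpa using hR)).of_iff fun n => ?_⟩
  constructor
  · rintro ⟨x, rfl, y, h⟩
    exact ⟨code y, (x, y), rfl, h⟩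
  · rintro ⟨m, p, hp, h⟩
    exact ⟨p.1, (Nat.pair_eq_pair.1 hp).1, p.2, h⟩

theorem fst {P : X → Prop} (hP : CEP I P) : CEP I (fun p : X × Y => P p.1) := by
  obtain ⟨A, hA, hP⟩ := hP
  refine ⟨A, hA, ((hP.comp TotIn.id.fst).and
    ((sig1_range (X := Y) A).comp TotIn.id.snd)).of_iff fun n => ?_⟩
  constructor
  · rintro ⟨p, rfl, h⟩
    exact ⟨⟨p.1, by simp, h⟩, by simp⟩
  · rintro ⟨⟨x, hx, h⟩, y, hy⟩
    exact ⟨(x, y), by simp [hx, hy], h⟩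

theorem swap {P : X × Y → Prop} (hP : CEP I P) : CEP I (fun p : Y × X => P (p.2, p.1)) := by
  obtain ⟨A, hA, hP⟩ := hP
  refine ⟨A, hA, (hP.comp (TotIn.id.snd.pair TotIn.id.fst)).of_iff fun n => ?_⟩
  constructor
  · rintro ⟨p, rfl, h⟩
    exact ⟨_, by simp, h⟩
  · rintro ⟨p, hp, h⟩
    obtain ⟨h1, h2⟩ := Nat.pair_eq_pair.1 hp
    exact ⟨(p.2, p.1), by simp [h1, h2], h⟩

theorem snd {P : Y → Prop} (hP : CEP I P) : CEP I (fun p : X × Y => P p.2) := hP.fst.swap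

theorem comp {P : Y → Prop} (hP : CEP I P) {f : X → Y} (hf : Eff I f) :
    CEP I (fun x => P (f x)) :=
  (ex (R := fun x y => f x = y ∧ P y) (CEP.and hf hP.snd)).of_iff fun x => by simp

theorem eq_prod : CEP I (fun p : X × X => p.1 = p.2) := of_sig1 fun A => by
  have e : Sig1 A (fun p => p.unpair.1 = p.unpair.2) := Sig1.of_primrecPred
    (Primrec.eq.comp (Primrec.fst.comp Primrec.unpair) (Primrec.snd.comp Primrec.unpair))
  refine (e.and ((sig1_range (X := X) A).comp TotIn.id.fst)).of_iff fun n => ?_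
  constructor
  · rintro ⟨p, rfl, h⟩
    simp [h]
  · rintro ⟨h, x, hx⟩
    exact ⟨(x, x), by simp only [code_prod, hx]; conv_rhs => rw [← Nat.pair_unpair n, ← h], rfl⟩

theorem ne_prod : CEP I (fun p : X × X => p.1 ≠ p.2) := of_sig1 fun A => by
  have e : Sig1 A (fun p => p.unpair.1 ≠ p.unpair.2) := Sig1.of_primrecPred
    (Primrec.eq.comp (Primrec.fst.comp Primrec.unpair) (Primrec.snd.comp Primrec.unpair)).not
  refine (e.and (((sig1_range (X := X) A).comp TotIn.id.fst).and
    ((sig1_range (X := X) A).comp TotIn.id.snd))).of_iff fun n => ?_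
  constructor
  · rintro ⟨p, rfl, h⟩
    simpa using fun h' => h (code_injective h')
  · rintro ⟨h, ⟨x, hx⟩, y, hy⟩
    exact ⟨(x, y), by simp [hx, hy], fun h' : x = y => h (by rw [← hx, ← hy, h'])⟩

end CEP

/-! ### Functions computable in an ideal. -/

namespace Eff

theorem of_eq {f g : X → Y} (hf : Eff I f) (h : ∀ x, f x = g x) : Eff I g :=
  (funext h : f = g) ▸ hf

theorem mono {J : TuringIdeal} (h : (I : Set Degree) ⊆ J) {f : X → Y} (hf : Eff I f) : Eff J f :=
  CEP.mono h hf

@[fun_prop]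
theorem id : Eff I (fun x : X => x) := CEP.eq_prod

theorem fst' : Eff I (fun p : X × Y => p.1) := by
  obtain ⟨A, hA⟩ := exists_deg_mem I
  have e : Sig1 A (fun p => p.unpair.1.unpair.1 = p.unpair.2) := Sig1.of_primrecPred
    (Primrec.eq.comp (Primrec.fst.comp (Primrec.unpair.comp (Primrec.fst.comp Primrec.unpair)))
      (Primrec.snd.comp Primrec.unpair))
  refine ⟨A, hA, (e.and ((sig1_range (X := X × Y) A).comp TotIn.id.fst)).of_iff fun n => ?_⟩
  constructor
  · rintro ⟨p, rfl, h⟩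
    exact ⟨by simp [h], p.1, by simp⟩
  · rintro ⟨h, p, hp⟩
    refine ⟨(p, p.1), ?_, rfl⟩
    conv_rhs => rw [← Nat.pair_unpair n, ← h, ← hp]
    simp

theorem snd' : Eff I (fun p : X × Y => p.2) := by
  obtain ⟨A, hA⟩ := exists_deg_mem I
  have e : Sig1 A (fun p => p.unpair.1.unpair.2 = p.unpair.2) := Sig1.of_primrecPred
    (Primrec.eq.comp (Primrec.snd.comp (Primrec.unpair.comp (Primrec.fst.comp Primrec.unpair)))
      (Primrec.snd.comp Primrec.unpair))
  refine ⟨A, hA, (e.and ((sig1_range (X := X × Y) A).comp TotIn.id.fst)).of_iff fun n => ?_⟩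
  constructor
  · rintro ⟨p, rfl, h⟩
    exact ⟨by simp [h], p.1, by simp⟩
  · rintro ⟨h, p, hp⟩
    refine ⟨(p, p.2), ?_, rfl⟩
    conv_rhs => rw [← Nat.pair_unpair n, ← h, ← hp]
    simp

@[fun_prop]
theorem comp {f : Y → Z} {g : X → Y} (hf : Eff I f) (hg : Eff I g) :
    Eff I (fun x => f (g x)) := by
  have h1 : CEP I (fun q : (X × Z) × Y => g q.1.1 = q.2) := by
    obtain ⟨A, hA, h⟩ := hg
    refine ⟨A, hA, ((h.comp (TotIn.id.fst.fst.pair TotIn.id.snd)).and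
      ((sig1_range (X := Z) A).comp TotIn.id.fst.snd)).of_iff fun n => ?_⟩
    constructor
    · rintro ⟨q, rfl, h⟩
      exact ⟨⟨(q.1.1, q.2), by simp, h⟩, q.1.2, by simp⟩
    · rintro ⟨⟨p, hp, h⟩, z, hz⟩
      obtain ⟨h1, h2⟩ := Nat.pair_eq_pair.1 hp
      exact ⟨((p.1, z), p.2), by simp [h1, h2, hz], h⟩
  have h2 : CEP I (fun q : (X × Z) × Y => f q.2 = q.1.2) := by
    obtain ⟨A, hA, h⟩ := hf
    refine ⟨A, hA, ((h.comp (TotIn.id.snd.pair TotIn.id.fst.snd)).and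
      ((sig1_range (X := X) A).comp TotIn.id.fst.fst)).of_iff fun n => ?_⟩
    constructor
    · rintro ⟨q, rfl, h⟩
      exact ⟨⟨(q.2, q.1.2), by simp, h⟩, q.1.1, by simp⟩
    · rintro ⟨⟨p, hp, h⟩, x, hx⟩
      obtain ⟨h1, h2⟩ := Nat.pair_eq_pair.1 hp
      exact ⟨((x, p.2), p.1), by simp [h1, h2, hx], h⟩
  exact (CEP.ex (R := fun (q : X × Z) y => g q.1 = y ∧ f y = q.2) (h1.and h2)).of_iff
    fun q => by simp

@[fun_prop]
theorem fst {f : Z → X × Y} (hf : Eff I f) : Eff I (fun z => (f z).1) := comp fst' hf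

@[fun_prop]
theorem snd {f : Z → X × Y} (hf : Eff I f) : Eff I (fun z => (f z).2) := comp snd' hf

@[fun_prop]
theorem const (c : Y) : Eff I (fun _ : X => c) := by
  obtain ⟨A, hA⟩ := exists_deg_mem I
  have e : Sig1 A (fun p => p.unpair.2 = code c) := Sig1.of_primrecPred
    (Primrec.eq.comp (Primrec.snd.comp Primrec.unpair) (.const _))
  refine ⟨A, hA, (e.and ((sig1_range (X := X) A).comp TotIn.id.fst)).of_iff fun n => ?_⟩
  constructor
  · rintro ⟨p, rfl, h⟩
    exact ⟨by simp [h], p.1, by simp⟩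
  · rintro ⟨h, x, hx⟩
    exact ⟨(x, c), by simp only [code_prod, hx, ← h, Nat.pair_unpair], rfl⟩

@[fun_prop]
theorem prodMk {f : Z → X} {g : Z → Y} (hf : Eff I f) (hg : Eff I g) :
    Eff I (fun z => (f z, g z)) := by
  -- The map `(z, x, y) ↦ (z, x)` has to be treated on the level of codes, because pairing is only
  -- being established here. Equality of codes is the vanishing of two opposite truncated
  -- differences.
  have h1 := CEP.comp (P := fun p : Z × X => f p.1 = p.2) hf
    (f := fun p : Z × X × Y => (p.1, p.2.1)) (by
      obtain ⟨A, hA⟩ := exists_deg_mem I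
      refine ⟨A, hA, ((sig1_range (X := (Z × X × Y) × (Z × X)) A).and
        ((Sig1.of_primrecPred (P := fun n => n = 0) (Primrec.eq.comp .id (.const 0))).comp
          (TotIn.comp₂ Primrec.nat_add
            (TotIn.comp₂ Primrec.nat_sub (TotIn.id.fst.fst.pair TotIn.id.fst.snd.fst)
              TotIn.id.snd)
            (TotIn.comp₂ Primrec.nat_sub TotIn.id.snd
              (TotIn.id.fst.fst.pair TotIn.id.fst.snd.fst))))).of_iff fun n => ?_⟩
      constructor
      · rintro ⟨p, rfl, h⟩
        exact ⟨⟨p, rfl⟩, by simp [← h]⟩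
      · rintro ⟨⟨p, rfl⟩, h⟩
        refine ⟨p, rfl, code_injective ?_⟩
        simp only [code_prod, Nat.unpair_pair] at h ⊢
        omega)
  have h2 := CEP.comp (P := fun p : Z × Y => g p.1 = p.2) hg
    (f := fun p : Z × X × Y => (p.1, p.2.2)) (by
      obtain ⟨A, hA⟩ := exists_deg_mem I
      refine ⟨A, hA, ((sig1_range (X := (Z × X × Y) × (Z × Y)) A).and
        ((Sig1.of_primrecPred (P := fun n => n = 0) (Primrec.eq.comp .id (.const 0))).comp
          (TotIn.comp₂ Primrec.nat_add
            (TotIn.comp₂ Primrec.nat_sub (TotIn.id.fst.fst.pair TotIn.id.fst.snd.snd)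
              TotIn.id.snd)
            (TotIn.comp₂ Primrec.nat_sub TotIn.id.snd
              (TotIn.id.fst.fst.pair TotIn.id.fst.snd.snd))))).of_iff fun n => ?_⟩
      constructor
      · rintro ⟨p, rfl, h⟩
        exact ⟨⟨p, rfl⟩, by simp [← h]⟩
      · rintro ⟨⟨p, rfl⟩, h⟩
        refine ⟨p, rfl, code_injective ?_⟩
        simp only [code_prod, Nat.unpair_pair] at h ⊢
        omega)
  exact (h1.and h2).of_iff fun p => by
    rw [Prod.ext_iff]

theorem code : Eff I (Coded.code : X → ℕ) := CEP.of_sig1 fun A => by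
  have e : Sig1 A (fun p => p.unpair.1 = p.unpair.2) := Sig1.of_primrecPred
    (Primrec.eq.comp (Primrec.fst.comp Primrec.unpair) (Primrec.snd.comp Primrec.unpair))
  refine (e.and ((sig1_range (X := X) A).comp TotIn.id.fst)).of_iff fun n => ?_
  constructor
  · rintro ⟨p, rfl, h⟩
    exact ⟨by simp [h], p.1, by simp⟩
  · rintro ⟨h, x, hx⟩
    exact ⟨(x, Coded.code x), by
      simp only [code_prod, code_nat, hx]; conv_rhs => rw [← Nat.pair_unpair n, ← h], rfl⟩

theorem of_totIn {f : ℕ → ℕ} (hf : ∀ A, TotIn A f) : Eff I f := CEP.of_sig1 fun A =>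
  (hf A).graph.of_iff fun n => by
    constructor
    · rintro ⟨p, rfl, h⟩
      simpa using h
    · intro h
      exact ⟨n.unpair, by simp, h⟩

theorem of_computable {f : ℕ → ℕ} (hf : Computable f) : Eff I f :=
  of_totIn fun _ => TotIn.of_computable hf

theorem of_computable₂ {f : ℕ → ℕ → ℕ} (hf : Computable₂ f) :
    Eff I (fun p : ℕ × ℕ => f p.1 p.2) := by
  have h : Computable fun n : ℕ => f n.unpair.1 n.unpair.2 :=
    hf.comp (Computable.fst.comp Primrec.unpair.to_comp)
      (Computable.snd.comp Primrec.unpair.to_comp)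
  exact ((of_computable h).comp (code (X := ℕ × ℕ))).of_eq fun p => by simp

theorem of_primrec₂ {f : ℕ → ℕ → ℕ} (hf : Primrec₂ f) :
    Eff I (fun p : ℕ × ℕ => f p.1 p.2) := of_computable₂ hf.to_comp

@[fun_prop]
theorem nat_add {f g : X → ℕ} (hf : Eff I f) (hg : Eff I g) : Eff I (fun x => f x + g x) :=
  (of_primrec₂ Primrec.nat_add).comp (hf.prodMk hg)

@[fun_prop]
theorem nat_mul {f g : X → ℕ} (hf : Eff I f) (hg : Eff I g) : Eff I (fun x => f x * g x) :=
  (of_primrec₂ Primrec.nat_mul).comp (hf.prodMk hg)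

@[fun_prop]
theorem nat_sub {f g : X → ℕ} (hf : Eff I f) (hg : Eff I g) : Eff I (fun x => f x - g x) :=
  (of_primrec₂ Primrec.nat_sub).comp (hf.prodMk hg)

@[fun_prop]
theorem nat_div {f g : X → ℕ} (hf : Eff I f) (hg : Eff I g) : Eff I (fun x => f x / g x) :=
  (of_primrec₂ Primrec.nat_div).comp (hf.prodMk hg)

@[fun_prop]
theorem nat_mod {f g : X → ℕ} (hf : Eff I f) (hg : Eff I g) : Eff I (fun x => f x % g x) :=
  (of_primrec₂ Primrec.nat_mod).comp (hf.prodMk hg)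

end Eff

/-! ### Iteration, reachability and bounded quantification. -/

namespace CEP

variable {P Q : X → Prop}

theorem eq {f g : X → Y} (hf : Eff I f) (hg : Eff I g) : CEP I (fun x => f x = g x) :=
  eq_prod.comp (hf.prodMk hg)

theorem ne {f g : X → Y} (hf : Eff I f) (hg : Eff I g) : CEP I (fun x => f x ≠ g x) :=
  ne_prod.comp (hf.prodMk hg)

theorem comp₂ {R : Y → Z → Prop} (hR : CEP I (fun p : Y × Z => R p.1 p.2)) {f : X → Y}
    {g : X → Z} (hf : Eff I f) (hg : Eff I g) : CEP I (fun x => R (f x) (g x)) :=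
  hR.comp (hf.prodMk hg)

theorem of_primrecPred {P : ℕ → Prop} (hP : PrimrecPred P) : CEP I P :=
  of_sig1 fun _ => (Sig1.of_primrecPred hP).of_iff fun n => by simp

theorem of_primrecRel {P : ℕ → ℕ → Prop} (hP : PrimrecRel P) :
    CEP I (fun p : ℕ × ℕ => P p.1 p.2) := by
  have h : PrimrecPred fun n : ℕ => P n.unpair.1 n.unpair.2 :=
    hP.comp (Primrec.fst.comp Primrec.unpair) (Primrec.snd.comp Primrec.unpair)
  exact ((of_primrecPred h).comp (Eff.code (X := ℕ × ℕ))).of_iff fun p => by simp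

/-- The relation between codes that is induced by `R` only leads to codes of elements, so paths
between codes are the paths in `X` and `Sig1.iter` applies. -/
theorem iter {R : X → X → Prop} (hR : CEP I (fun p : X × X => R p.1 p.2)) :
    CEP I (fun p : ℕ × X × X => iterRel R p.1 p.2.1 p.2.2) := by
  obtain ⟨A, hA, hR⟩ := hR
  let R' : ℕ → ℕ → Prop := fun m n => ∃ p : X × X, code p = Nat.pair m n ∧ R p.1 p.2
  have key : ∀ n x m, iterRel R' n (code x) m ↔ ∃ y : X, code y = m ∧ iterRel R n x y := by
    intro n
    induction n with
    | zero => intro x m; simp [iterRel]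
    | succ n ih =>
      intro x m
      constructor
      · rintro ⟨_, ⟨p, hp, h⟩, h'⟩
        obtain ⟨h1, rfl⟩ := Nat.pair_eq_pair.1 hp
        obtain ⟨y, hy, h''⟩ := (ih _ _).1 h'
        rw [code_injective h1] at h
        exact ⟨y, hy, _, h, h''⟩
      · rintro ⟨y, rfl, z, h, h'⟩
        exact ⟨code z, ⟨(x, z), rfl, h⟩, (ih _ _).2 ⟨y, rfl, h'⟩⟩
  refine ⟨A, hA, ((Sig1.iter (R := R') (hR.of_iff fun n => by simp only [R', Nat.pair_unpair])).and
    (sig1_range (X := ℕ × X × X) A)).of_iff fun k => ?_⟩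
  constructor
  · rintro ⟨p, rfl, h⟩
    refine ⟨?_, p, rfl⟩
    simp only [code_prod, code_nat, Nat.unpair_pair]
    exact (key _ _ _).2 ⟨_, rfl, h⟩
  · rintro ⟨h, p, rfl⟩
    simp only [code_prod, code_nat, Nat.unpair_pair] at h
    obtain ⟨y, hy, h⟩ := (key _ _ _).1 h
    rw [code_injective hy] at h
    exact ⟨p, rfl, h⟩

theorem reflTransGen {R : X → X → Prop} (hR : CEP I (fun p : X × X => R p.1 p.2)) :
    CEP I (fun p : X × X => Relation.ReflTransGen R p.1 p.2) :=
  (ex (R := fun (p : X × X) n => iterRel R n p.1 p.2)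
    (hR.iter.comp (f := fun q : (X × X) × ℕ => (q.2, q.1.1, q.1.2)) (by fun_prop))).of_iff
    fun p => reflTransGen_iff_iterRel

/-- The predicate of being reachable from `x₀` by the steps in `R` is c.e. -/
theorem reach {R : X → X → Prop} (hR : CEP I (fun p : X × X => R p.1 p.2)) (x₀ : X) :
    CEP I (fun x => Relation.ReflTransGen R x₀ x) :=
  hR.reflTransGen.comp₂ (R := Relation.ReflTransGen R) (Eff.const x₀) Eff.id

/-- The quantifier is a path of `f x` steps from `(x, 0)` to `(x, f x)`, in which the step leaving
`(x, k)` verifies `P x k`. -/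
theorem forall_lt {P : X → ℕ → Prop} (hP : CEP I (fun p : X × ℕ => P p.1 p.2)) {f : X → ℕ}
    (hf : Eff I f) : CEP I (fun x => ∀ k < f x, P x k) := by
  let R : X × ℕ → X × ℕ → Prop := fun s t => t = (s.1, s.2 + 1) ∧ P s.1 s.2
  have hR : CEP I (fun p : (X × ℕ) × (X × ℕ) => R p.1 p.2) :=
    (CEP.eq (by fun_prop) (by fun_prop)).and (hP.comp₂ (by fun_prop) (by fun_prop))
  have key : ∀ n x y, iterRel R n (x, 0) y ↔ y = (x, n) ∧ ∀ k < n, P x k := by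
    intro n
    induction n with
    | zero => intro x y; simp [iterRel, eq_comm]
    | succ n ih =>
      intro x y
      rw [iterRel_succ_right]
      simp only [ih, R]
      constructor
      · rintro ⟨_, ⟨rfl, h1⟩, h2, h3⟩
        refine ⟨h2, fun m hm => ?_⟩
        rcases Nat.lt_succ_iff_lt_or_eq.1 hm with h | rfl
        · exact h1 m h
        · exact h3
      · rintro ⟨rfl, h⟩
        exact ⟨_, ⟨rfl, fun m hm => h m (by omega)⟩, rfl, h n (by omega)⟩
  exact (hR.iter.comp (f := fun x => (f x, (x, 0), (x, f x))) (by fun_prop)).of_iff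
    fun x => by simp [key]

theorem of_finite (h : {x | P x}.Finite) : CEP I P := by
  have : ∀ s : Set X, s.Finite → CEP I (· ∈ s) := fun s hs => by
    induction s, hs using Set.Finite.induction_on with
    | empty => exact CEP.false.of_iff fun x => by simp
    | insert _ _ ih =>
      exact ((CEP.eq Eff.id (Eff.const _)).or ih).of_iff fun x => Set.mem_insert_iff
  exact this _ h

end CEP

theorem cep_of_deg_mem {A : Set ℕ} (hA : deg A ∈ I) : CEP I (· ∈ A) :=
  ⟨A, hA, (sig1_self A).of_iff fun n => by simp⟩

theorem cep_compl_of_deg_mem {A : Set ℕ} (hA : deg A ∈ I) : CEP I (· ∉ A) :=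
  ⟨A, hA, (sig1_compl A).of_iff fun n => by simp⟩

/-- Post's theorem inside the ideal. Closure under joins supplies one oracle for both enumerations,
and downward closure then gives the degree of `A`. -/
theorem deg_mem_of_cep {A : Set ℕ} (h1 : CEP I (· ∈ A)) (h0 : CEP I (· ∉ A)) : deg A ∈ I := by
  obtain ⟨B, hB, h1, h0⟩ := CEP.exists_common h1 h0
  refine I.lower (deg_le_deg.2 (turingLE_of_sig1 (B := B) ?_ ?_)) hB
  · simpa using h1
  · simpa using h0

theorem cep_iff_ceIn {P : X → Prop} :
    CEP I P ↔ ∃ d ∈ I, CEIn d (code '' {x | P x}) := by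
  have e : (fun n => ∃ x : X, code x = n ∧ P x) = (· ∈ code '' {x | P x}) := by
    ext n
    simp [and_comm]
  simp only [CEP, ceIn_iff, e]
  constructor
  · rintro ⟨A, hA, h⟩
    exact ⟨_, hA, A, rfl, h⟩
  · rintro ⟨_, hd, A, rfl, h⟩
    exact ⟨A, hd, h⟩

end

end SubstructureLattice

namespace SubstructureLattice

/-! ### Lattices of substructures and their automorphisms -/

/-- A complete lattice `S` of substructures of `X` in which every substructure generated by one
element is trivial or an atom, and in which being a substructure is a matter of being closed under
generation by two elements. -/
class GenLattice (S : Type*) (X : outParam Type*) [CompleteLattice S] [SetLike S X] where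
  /-- the substructure generated by one element -/
  gen : X → S
  gen_le_iff : ∀ {x : X} {W : S}, gen x ≤ W ↔ x ∈ W
  le_iff : ∀ {V W : S}, V ≤ W ↔ ∀ x ∈ V, x ∈ W
  gen_eq_of_le : ∀ {x y : X}, gen x ≤ gen y → gen x ≠ ⊥ → gen x = gen y
  exists_gen_eq_bot : ∃ x, gen x = ⊥
  exists_coe_eq : ∀ T : Set X, T.Nonempty →
    (∀ x ∈ T, ∀ y ∈ T, ∀ z ∈ (gen x ⊔ gen y : S), z ∈ T) → ∃ W : S, (W : Set X) = T

section

variable {S X : Type*} [CompleteLattice S] [SetLike S X] [GenLattice S X]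

open GenLattice

theorem mem_gen (S : Type*) [CompleteLattice S] [SetLike S X] [GenLattice S X] (x : X) :
    x ∈ (gen x : S) := gen_le_iff.1 le_rfl

theorem eq_of_forall_gen_le {V W : S} (h : ∀ x : X, gen x ≤ V ↔ gen x ≤ W) : V = W :=
  le_antisymm (le_iff.2 fun _ hx => gen_le_iff.1 ((h _).1 (gen_le_iff.2 hx)))
    (le_iff.2 fun _ hx => gen_le_iff.1 ((h _).2 (gen_le_iff.2 hx)))

theorem exists_gen_le {W : S} (hW : W ≠ ⊥) : ∃ x : X, gen x ≤ W ∧ (gen x : S) ≠ ⊥ := by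
  by_contra! h
  refine hW (eq_bot_iff.2 (le_iff.2 fun x hx => ?_))
  exact gen_le_iff.1 (h x (gen_le_iff.2 hx)).le

variable {P : S → Prop}

/-- If the image of `gen x` is not trivial, it contains a nontrivial `gen y`. The preimage of `gen
y` is nontrivial and below `gen x`, so it contains some nontrivial `gen z`; since `gen z = gen x` by
atomicity, this preimage is all of `gen x`. -/
theorem exists_gen_eq_apply (hP : ∀ x y : X, P (gen x ⊔ gen y)) (Φ : {W // P W} ≃o {W // P W})
    {x : X} (hx : P (gen x)) : ∃ y : X, (Φ ⟨gen x, hx⟩ : S) = gen y := by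
  have hP' : ∀ x : X, P (gen x) := fun x => by simpa using hP x x
  by_cases hW : (Φ ⟨gen x, hx⟩ : S) = ⊥
  · obtain ⟨y, hy⟩ := exists_gen_eq_bot (S := S) (X := X)
    exact ⟨y, hW.trans hy.symm⟩
  · obtain ⟨y, hy, hy0⟩ := exists_gen_le (X := X) hW
    obtain ⟨b, hb⟩ := exists_gen_eq_bot (S := S) (X := X)
    have h1 : Φ.symm ⟨gen y, hP' y⟩ ≤ ⟨gen x, hx⟩ := by
      rw [← Φ.symm_apply_apply ⟨gen x, hx⟩]
      exact Φ.symm.monotone hy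
    have h2 : (Φ.symm ⟨gen y, hP' y⟩ : S) ≠ ⊥ := fun h => by
      have h3 : Φ.symm ⟨gen y, hP' y⟩ ≤ Φ.symm ⟨gen b, hP' b⟩ := by
        show (Φ.symm ⟨gen y, hP' y⟩ : S) ≤ _
        rw [h]; exact bot_le
      have h4 : (gen y : S) ≤ gen b := Φ.symm.le_iff_le.1 h3
      exact hy0 (le_bot_iff.1 (hb ▸ h4))
    obtain ⟨z, hz, hz0⟩ := exists_gen_le (X := X) h2
    have h3 : (gen z : S) ≤ gen x := hz.trans h1
    have h4 := gen_eq_of_le h3 hz0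
    have h5 : (⟨gen x, hx⟩ : {W // P W}) ≤ Φ.symm ⟨gen y, hP' y⟩ := by
      show (gen x : S) ≤ _
      rw [← h4]; exact hz
    refine ⟨y, le_antisymm ?_ hy⟩
    have := Φ.monotone h5
    rwa [Φ.apply_symm_apply] at this

/-- The extension of `Φ` to an arbitrary `W` collects the images of the one-generated substructures
of `W`. This set is a substructure because closure only has to be tested on two elements and `Φ` is
defined on two-generated substructures; that is the purpose of `hP`. -/
theorem exists_extension (hP : ∀ x y : X, P (gen x ⊔ gen y)) (Φ : {W // P W} ≃o {W // P W})
    (W : S) : ∃ V : S, ∀ y : X, y ∈ V ↔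
      ∃ x ∈ W, ∀ h h', Φ ⟨gen x, h⟩ = ⟨gen y, h'⟩ := by
  have hP' : ∀ x : X, P (gen x) := fun x => by simpa using hP x x
  suffices H : ∃ V : S, (V : Set X) = {y : X | ∃ x ∈ W, ∀ h h', Φ ⟨gen x, h⟩ = ⟨gen y, h'⟩} by
    obtain ⟨V, hV⟩ := H
    exact ⟨V, fun y => by rw [← SetLike.mem_coe, hV]; rfl⟩
  refine exists_coe_eq _ ?_ ?_
  · obtain ⟨b, hb⟩ := exists_gen_eq_bot (S := S) (X := X)
    obtain ⟨y, hy⟩ := exists_gen_eq_apply hP Φ (hP' b)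
    exact ⟨y, b, gen_le_iff.1 (hb ▸ bot_le), fun _ _ => Subtype.ext hy⟩
  · rintro y₁ ⟨x₁, hx₁, h₁⟩ y₂ ⟨x₂, hx₂, h₂⟩ z hz
    obtain ⟨x, hx⟩ := exists_gen_eq_apply hP Φ.symm (hP' z)
    have hx' : Φ.symm ⟨gen z, hP' z⟩ = ⟨gen x, hP' x⟩ := Subtype.ext hx
    refine ⟨x, ?_, fun _ _ => by rw [← hx', Φ.apply_symm_apply]⟩
    have h3 : (⟨gen z, hP' z⟩ : {W // P W}) ≤ Φ ⟨gen x₁ ⊔ gen x₂, hP _ _⟩ := by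
      refine (gen_le_iff.2 hz : (gen z : S) ≤ _).trans (sup_le ?_ ?_)
      · have : (⟨gen x₁, hP' x₁⟩ : {W // P W}) ≤ ⟨gen x₁ ⊔ gen x₂, hP _ _⟩ :=
          (le_sup_left : (gen x₁ : S) ≤ _)
        have := Φ.monotone this
        rw [h₁ (hP' _) (hP' _)] at this
        exact this
      · have : (⟨gen x₂, hP' x₂⟩ : {W // P W}) ≤ ⟨gen x₁ ⊔ gen x₂, hP _ _⟩ :=
          (le_sup_right : (gen x₂ : S) ≤ _)
        have := Φ.monotone this
        rw [h₂ (hP' _) (hP' _)] at this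
        exact this
    have h4 := Φ.symm.monotone h3
    rw [Φ.symm_apply_apply, hx'] at h4
    have h5 : (gen x : S) ≤ gen x₁ ⊔ gen x₂ := h4
    exact gen_le_iff.1 (h5.trans (sup_le (gen_le_iff.2 hx₁) (gen_le_iff.2 hx₂)))

/-- An automorphism of a sufficiently large lattice of substructures extends to the lattice of all
substructures. -/
theorem exists_orderIso_extension (hP : ∀ x y : X, P (gen x ⊔ gen y))
    (Φ : {W // P W} ≃o {W // P W}) : ∃ Ψ : S ≃o S, ∀ W : {W // P W}, Ψ W = Φ W := by
  have hP' : ∀ x : X, P (gen x) := fun x => by simpa using hP x x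
  choose ext hext using fun (Φ : {W // P W} ≃o {W // P W}) => exists_extension (X := X) hP Φ
  -- Proved for every automorphism, so that it can be used for both `Φ` and `Φ.symm`.
  have inv : ∀ Φ W, ext Φ (ext Φ.symm W) = W := fun Φ W => by
    refine eq_of_forall_gen_le (X := X) fun y => ?_
    rw [gen_le_iff, gen_le_iff, hext]
    constructor
    · rintro ⟨x, hx, h⟩
      obtain ⟨z, hz, h'⟩ := (hext _ _ _).1 hx
      have h1 := h' (hP' _) (hP' _)
      rw [OrderIso.symm_apply_eq, h (hP' _) (hP' _)] at h1
      have h2 : (gen z : S) = gen y := congrArg Subtype.val h1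
      rw [← gen_le_iff, ← h2, gen_le_iff]
      exact hz
    · intro hy
      obtain ⟨x, hx⟩ := exists_gen_eq_apply hP Φ.symm (hP' y)
      refine ⟨x, (hext _ _ _).2 ⟨y, hy, fun _ _ => Subtype.ext hx⟩, fun h h' => ?_⟩
      rw [← Φ.apply_symm_apply ⟨gen y, h'⟩]
      exact congrArg Φ (Subtype.ext hx.symm)
  have mono : ∀ Φ, Monotone (ext Φ) := fun Φ V W hVW => le_iff.2 fun x hx => by
    obtain ⟨z, hz, h⟩ := (hext _ _ _).1 hx
    exact (hext _ _ _).2 ⟨z, le_iff.1 hVW z hz, h⟩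
  refine ⟨{ toFun := ext Φ
            invFun := ext Φ.symm
            left_inv := fun W => inv Φ.symm W
            right_inv := fun W => inv Φ W
            map_rel_iff' := ?_ }, fun W => ?_⟩
  · intro V W
    refine ⟨fun h => ?_, fun h => mono Φ h⟩
    have h1 : ext Φ.symm (ext Φ V) ≤ ext Φ.symm (ext Φ W) := mono Φ.symm h
    have h2 : ∀ U, ext Φ.symm (ext Φ U) = U := inv Φ.symm
    rwa [h2, h2] at h1
  · refine eq_of_forall_gen_le (X := X) fun y => ?_
    show gen y ≤ ext Φ W ↔ _
    rw [gen_le_iff, hext]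
    constructor
    · rintro ⟨x, hx, h⟩
      have h1 : (⟨gen x, hP' x⟩ : {W // P W}) ≤ W := (gen_le_iff.2 hx : gen x ≤ (W : S))
      have h2 := Φ.monotone h1
      rw [h (hP' _) (hP' _)] at h2
      exact h2
    · intro h
      obtain ⟨x, hx⟩ := exists_gen_eq_apply hP Φ.symm (hP' y)
      refine ⟨x, ?_, fun h h' => ?_⟩
      · have h1 : (⟨gen y, hP' y⟩ : {W // P W}) ≤ Φ W := h
        have h2 : ((Φ.symm ⟨gen y, hP' y⟩ : {W // P W}) : S) ≤ (W : S) := by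
          have := Φ.symm.monotone h1
          rwa [Φ.symm_apply_apply] at this
        rw [hx] at h2
        exact gen_le_iff.1 h2
      · rw [← Φ.apply_symm_apply ⟨gen y, h'⟩]
        exact congrArg Φ (Subtype.ext hx.symm)

theorem exists_gen_eq_orderIso (Ψ : S ≃o S) (x : X) : ∃ y : X, Ψ (gen x) = gen y := by
  -- The full lattice is the case of the property that always holds.
  let Φ : {W : S // True} ≃o {W : S // True} :=
    { toFun := fun W => ⟨Ψ W, trivial⟩
      invFun := fun W => ⟨Ψ.symm W, trivial⟩
      left_inv := fun _ => Subtype.ext (Ψ.symm_apply_apply _)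
      right_inv := fun _ => Subtype.ext (Ψ.apply_symm_apply _)
      map_rel_iff' := fun {V W} => Ψ.le_iff_le (x := (V : S)) (y := W) }
  exact exists_gen_eq_apply (P := fun _ => True) (fun _ _ => trivial) Φ (x := x) trivial

theorem mem_apply_iff (Ψ : S ≃o S) {W : S} {y : X} :
    y ∈ Ψ W ↔ ∃ x ∈ W, Ψ (gen x) = gen y := by
  constructor
  · intro h
    obtain ⟨x, hx⟩ := exists_gen_eq_orderIso Ψ.symm y
    refine ⟨x, ?_, by rw [← hx, Ψ.apply_symm_apply]⟩
    rw [← gen_le_iff (S := S), ← hx, OrderIso.symm_apply_le, gen_le_iff]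
    exact h
  · rintro ⟨x, hx, h⟩
    rw [← gen_le_iff (S := S), ← h]
    exact Ψ.monotone (gen_le_iff.2 hx)

theorem mem_apply_of_gen {Ψ : S ≃o S} {x y : X} (h : Ψ (gen x) = gen y) {W : S} :
    y ∈ Ψ W ↔ x ∈ W := by
  rw [← gen_le_iff (S := S), ← h, Ψ.le_iff_le, gen_le_iff]

/-- The automorphisms of the lattice of all substructures that preserve the property `P`. -/
def preserving (P : S → Prop) : Subgroup (S ≃o S) where
  carrier := {Ψ | ∀ W, P (Ψ W) ↔ P W}
  one_mem' := fun _ => Iff.rfl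
  mul_mem' := fun {_ Ψ} hΦ hΨ W => (hΦ (Ψ W)).trans (hΨ W)
  inv_mem' := fun {Φ} hΦ W => by
    have := hΦ (Φ.symm W)
    rw [Φ.apply_symm_apply] at this
    exact this.symm

/-- The restriction of an automorphism to the substructures with property `P`. -/
def restrict (P : S → Prop) : preserving P →* ({W // P W} ≃o {W // P W}) where
  toFun Ψ :=
    { toFun := fun W => ⟨Ψ.1 W, (Ψ.2 W).2 W.2⟩
      invFun := fun W => ⟨Ψ.1.symm W, (Ψ⁻¹.2 W).2 W.2⟩
      left_inv := fun _ => Subtype.ext (Ψ.1.symm_apply_apply _)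
      right_inv := fun _ => Subtype.ext (Ψ.1.apply_symm_apply _)
      map_rel_iff' := fun {V W} => Ψ.1.le_iff_le (x := (V : S)) (y := W) }
  map_one' := rfl
  map_mul' _ _ := rfl

/-- An automorphism is determined by its values at the one-generated substructures, all of which
have `P`; this gives injectivity. For surjectivity, the extension of `Φ` agrees with `Φ` where `P`
holds, and the bijectivity of `Φ` on that part makes the extension preserve `P` in both directions.
-/
theorem restrict_bijective (hP : ∀ x y : X, P (gen x ⊔ gen y)) :
    Function.Bijective (restrict P) := by
  have hP' : ∀ x : X, P (gen x) := fun x => by simpa using hP x x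
  constructor
  · rw [injective_iff_map_eq_one]
    rintro Ψ h
    have h' : ∀ x : X, Ψ.1 (gen x) = gen x := fun x =>
      congrArg Subtype.val (DFunLike.congr_fun h (⟨gen x, hP' x⟩ : {W // P W}))
    refine Subtype.ext (RelIso.ext fun W => ?_)
    refine eq_of_forall_gen_le (X := X) fun y => ?_
    rw [gen_le_iff, mem_apply_of_gen (h' y), gen_le_iff]
    rfl
  · intro Φ
    obtain ⟨Ψ, hΨ⟩ := exists_orderIso_extension (X := X) hP Φ
    refine ⟨⟨Ψ, fun W => ⟨fun h => ?_, fun h => ?_⟩⟩, RelIso.ext fun W => Subtype.ext (hΨ W)⟩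
    · have h1 := hΨ (Φ.symm ⟨Ψ W, h⟩)
      rw [Φ.apply_symm_apply] at h1
      rw [← Ψ.injective h1]
      exact (Φ.symm _).2
    · have := hΨ ⟨W, h⟩
      simp only at this
      rw [this]
      exact (Φ _).2

/-- The automorphisms of the lattice of the substructures with property `P` are the automorphisms
of the lattice of all substructures that preserve `P`. -/
noncomputable def restrictEquiv (hP : ∀ x y : X, P (gen x ⊔ gen y)) :
    preserving P ≃* ({W // P W} ≃o {W // P W}) :=
  MulEquiv.ofBijective (restrict P) (restrict_bijective hP)

end

/-! ### Embeddings of groups and coding of sets into groups -/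

theorem GroupEmbeds.trans {G H K : Type*} [Group G] [Group H] [Group K] (h₁ : GroupEmbeds G H)
    (h₂ : GroupEmbeds H K) : GroupEmbeds G K := by
  obtain ⟨f, hf⟩ := h₁
  obtain ⟨g, hg⟩ := h₂
  exact ⟨g.comp f, hg.comp hf⟩

theorem GroupEmbeds.of_mulEquiv {G H : Type*} [Group G] [Group H] (e : G ≃* H) :
    GroupEmbeds G H := ⟨e.toMonoidHom, e.injective⟩

/-- The commutator of `b` and a conjugate of `a` by a power of `s`. -/
def codeWord {G : Type*} [Group G] (s a b : G) (n : ℕ) : G :=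
  b * ((s ^ n)⁻¹ * a * s ^ n) * b⁻¹ * ((s ^ n)⁻¹ * a⁻¹ * s ^ n)

theorem map_codeWord {G H : Type*} [Group G] [Group H] (f : G →* H) (s a b : G) (n : ℕ) :
    codeWord (f s) (f a) (f b) n = f (codeWord s a b n) := by
  simp [codeWord]

/-- The group `G` has three elements that code membership in `A`. -/
def CodesSet (G : Type*) [Group G] (A : Set ℕ) : Prop :=
  ∃ s a b c : G, c ≠ 1 ∧ (∀ n ∈ A, codeWord s a b n = c) ∧
    ∀ n ∉ A, codeWord s a b n = 1

theorem CodesSet.of_embeds {G H : Type*} [Group G] [Group H] {A : Set ℕ} (h : CodesSet G A)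
    (hGH : GroupEmbeds G H) : CodesSet H A := by
  obtain ⟨s, a, b, c, hc, h1, h0⟩ := h
  obtain ⟨f, hf⟩ := hGH
  refine ⟨f s, f a, f b, f c, (map_ne_one_iff f hf).2 hc, fun n hn => ?_, fun n hn => ?_⟩
  · rw [map_codeWord, h1 n hn]
  · rw [map_codeWord, h0 n hn, map_one]

section

variable {X : Type*} [Coded X]

/-- In a group that is faithfully represented by relations that are c.e. in the ideal `J`, only
sets of degree in `J` are coded. -/
theorem CodesSet.deg_mem {H : Type*} [Group H] {J : TuringIdeal} {A : Set ℕ} (h : CodesSet H A)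
    (ρ : H → X → X → Prop) (mul : ∀ g h x z, ρ (g * h) x z ↔ ∃ y, ρ h x y ∧ ρ g y z)
    (refl : ∀ x, ρ 1 x x) (ce : ∀ g, CEP J (fun p : X × X => ρ g p.1 p.2))
    (faithful : ∀ g, g ≠ 1 → ∃ x y, ρ g x y ∧ ¬ ρ 1 x y ∧ ¬ ρ g x x) : deg A ∈ J := by
  obtain ⟨s, a, b, c, hc, h1, h0⟩ := h
  have pow : ∀ g : H, CEP J (fun p : ℕ × X × X => ρ (g ^ p.1) p.2.1 p.2.2) := fun g => by
    -- The factor `ρ 1` is needed for `n = 0`: the identity may be represented by a relation coarser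
    -- than equality, such as generating the same substructure.
    have key : ∀ n x z, ρ (g ^ n) x z ↔ ∃ y, ρ 1 x y ∧ iterRel (ρ g) n y z := by
      intro n
      induction n with
      | zero => intro x z; simp [iterRel]
      | succ n ih =>
        intro x z
        rw [pow_succ', mul]
        simp only [ih, iterRel_succ_right]
        constructor
        · rintro ⟨y, ⟨w, h1, h2⟩, h3⟩
          exact ⟨w, h1, y, h2, h3⟩
        · rintro ⟨w, h1, y, h2, h3⟩
          exact ⟨y, ⟨w, h1, h2⟩, h3⟩
    refine (CEP.ex (R := fun (p : ℕ × X × X) y => ρ 1 p.2.1 y ∧ iterRel (ρ g) p.1 y p.2.2)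
      (((ce 1).comp₂ (by fun_prop) (by fun_prop)).and ((ce g).iter.comp
        (f := fun q : (ℕ × X × X) × X => (q.1.1, q.2, q.1.2.2)) (by fun_prop)))).of_iff
      fun p => key _ _ _
  have hmul : ∀ u v : ℕ → H, CEP J (fun p : ℕ × X × X => ρ (u p.1) p.2.1 p.2.2) →
      CEP J (fun p : ℕ × X × X => ρ (v p.1) p.2.1 p.2.2) →
      CEP J (fun p : ℕ × X × X => ρ (u p.1 * v p.1) p.2.1 p.2.2) := fun u v hu hv => by
    refine (CEP.ex (R := fun (p : ℕ × X × X) y => ρ (v p.1) p.2.1 y ∧ ρ (u p.1) y p.2.2)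
      ((hv.comp (f := fun q : (ℕ × X × X) × X => (q.1.1, q.1.2.1, q.2)) (by fun_prop)).and
        (hu.comp (f := fun q : (ℕ × X × X) × X => (q.1.1, q.2, q.1.2.2)) (by fun_prop)))).of_iff
      fun p => mul _ _ _ _
  have hconst : ∀ g : H, CEP J (fun p : ℕ × X × X => ρ g p.2.1 p.2.2) := fun g =>
    (ce g).comp₂ (by fun_prop) (by fun_prop)
  have word : CEP J (fun p : ℕ × X × X => ρ (codeWord s a b p.1) p.2.1 p.2.2) := by
    have hu : ∀ g : H, CEP J (fun p : ℕ × X × X =>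
        ρ ((s ^ p.1)⁻¹ * g * s ^ p.1) p.2.1 p.2.2) := fun g => by
      simpa using hmul (fun n => s⁻¹ ^ n * g) (fun n => s ^ n)
        (hmul (fun n => s⁻¹ ^ n) (fun _ => g) (pow s⁻¹) (hconst g)) (pow s)
    exact hmul (fun n => b * ((s ^ n)⁻¹ * a * s ^ n) * b⁻¹)
      (fun n => (s ^ n)⁻¹ * a⁻¹ * s ^ n)
      (hmul (fun n => b * ((s ^ n)⁻¹ * a * s ^ n)) (fun _ => b⁻¹)
        (hmul (fun _ => b) (fun n => (s ^ n)⁻¹ * a * s ^ n) (hconst b) (hu a)) (hconst b⁻¹))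
      (hu a⁻¹)
  -- At `(x, y)` the relation holds for `c` and fails for `1`; at `(x, x)` it is the other way
  -- round. The two tests enumerate `A` and its complement.
  obtain ⟨x, y, hxy, hxy', hxx⟩ := faithful c hc
  have at_pt : ∀ y, CEP J (fun n : ℕ => ρ (codeWord s a b n) x y) := fun y =>
    word.comp (f := fun n : ℕ => (n, x, y)) (by fun_prop)
  refine deg_mem_of_cep ((at_pt y).of_iff fun n => ?_) ((at_pt x).of_iff fun n => ?_)
  · by_cases hn : n ∈ A
    · simp [hn, h1, hxy]
    · simp [hn, h0, hxy']
  · by_cases hn : n ∈ A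
    · simp [hn, h1, hxx]
    · simp [hn, h0, refl]

/-- The permutations of `X` that are computable in some degree of `I`. -/
def permIdeal (I : TuringIdeal) (X : Type*) [Coded X] : Subgroup (Equiv.Perm X) where
  carrier := {π | Eff I π}
  one_mem' := Eff.id
  mul_mem' := fun {π σ} (hπ : Eff I π) (hσ : Eff I σ) => hπ.comp hσ
  inv_mem' := fun {π} (hπ : Eff I π) => by
    refine (CEP.swap hπ).of_iff fun p => ?_
    rw [Equiv.Perm.inv_eq_iff_eq, eq_comm]

end

theorem permIdeal_embeds_nat (I : TuringIdeal) :
    GroupEmbeds (permIdeal I (ℕ × ℕ)) (permIdeal I ℕ) := by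
  let e : Equiv.Perm (ℕ × ℕ) ≃* Equiv.Perm ℕ := Nat.pairEquiv.permCongrHom
  refine ⟨((e.toMonoidHom.comp (permIdeal I (ℕ × ℕ)).subtype).codRestrict (permIdeal I ℕ)
    fun π => ?_), fun π σ h => ?_⟩
  · have hπ : Eff I (π : Equiv.Perm (ℕ × ℕ)) := π.2
    have h1 : Eff I (Nat.unpair : ℕ → ℕ × ℕ) :=
      ((Eff.of_computable (Computable.fst.comp Primrec.unpair.to_comp)).prodMk
        (Eff.of_computable (Computable.snd.comp Primrec.unpair.to_comp))).of_eq fun n => rfl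
    exact (Eff.code (X := ℕ × ℕ)).comp (hπ.comp h1)
  · exact Subtype.ext (e.injective (congrArg Subtype.val h))

/-- The fiberwise action of a family of permutations. -/
def fiberPerm : (ℕ → Equiv.Perm ℕ) →* Equiv.Perm (ℕ × ℕ) where
  toFun f :=
    { toFun := fun p => (p.1, f p.1 p.2)
      invFun := fun p => (p.1, (f p.1).symm p.2)
      left_inv := fun p => by simp
      right_inv := fun p => by simp }
  map_one' := rfl
  map_mul' _ _ := rfl

theorem fiberPerm_apply (f : ℕ → Equiv.Perm ℕ) (q : ℕ × ℕ) :
    fiberPerm f q = (q.1, f q.1 q.2) := rfl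

theorem fiberPerm_mem {I : TuringIdeal} {p : ℕ → Prop} [DecidablePred p] {τ : Equiv.Perm ℕ}
    (hτ : Eff I τ) (hp : CEP I p) (hp' : CEP I (fun n => ¬ p n)) :
    fiberPerm (fun m => if p m then τ else 1) ∈ permIdeal I (ℕ × ℕ) := by
  refine ((CEP.eq (f := fun q : (ℕ × ℕ) × (ℕ × ℕ) => q.2.1) (g := fun q => q.1.1)
    (by fun_prop) (by fun_prop)).and
    (((hp.comp (f := fun q : (ℕ × ℕ) × (ℕ × ℕ) => q.1.1) (by fun_prop)).and
      (CEP.eq (f := fun q : (ℕ × ℕ) × (ℕ × ℕ) => q.2.2) (g := fun q => τ q.1.2)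
        (by fun_prop) (by fun_prop))).or
    ((hp'.comp (f := fun q : (ℕ × ℕ) × (ℕ × ℕ) => q.1.1) (by fun_prop)).and
      (CEP.eq (f := fun q : (ℕ × ℕ) × (ℕ × ℕ) => q.2.2) (g := fun q => q.1.2)
        (by fun_prop) (by fun_prop))))).of_iff ?_
  rintro ⟨⟨m, r⟩, m', r'⟩
  by_cases h : p m <;> simp [fiberPerm_apply, h, eq_comm]

/-- A permutation of `ℕ` in which the even numbers are the iterated images of `0`. -/
def natShift : Equiv.Perm ℕ where
  -- The permutation is the single orbit `… ↦ 5 ↦ 3 ↦ 1 ↦ 0 ↦ 2 ↦ 4 ↦ …`.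
  toFun n := if n % 2 = 0 then n + 2 else if n = 1 then 0 else n - 2
  invFun n := if n % 2 = 1 then n + 2 else if n = 0 then 1 else n - 2
  left_inv n := by
    rcases Nat.mod_two_eq_zero_or_one n with h | h
    · simp [h]
    · rcases eq_or_ne n 1 with rfl | h1
      · rfl
      · have h2 : (n - 2) % 2 = 1 := by omega
        simp only [h, h1, h2, if_true, if_false, one_ne_zero]
        omega
  right_inv n := by
    rcases Nat.mod_two_eq_zero_or_one n with h | h
    · rcases eq_or_ne n 0 with rfl | h1
      · rfl
      · have h2 : (n - 2) % 2 = 0 := by omega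
        simp only [h, h1, h2, if_true, if_false, zero_ne_one]
        omega
    · have h2 : (n + 2) % 2 = 1 := by omega
      have h3 : n + 2 ≠ 1 := by omega
      have h4 : (if n % 2 = 1 then n + 2 else if n = 0 then 1 else n - 2) = n + 2 := if_pos h
      simp [h4, h2, h3]

theorem natShift_pow_zero (n : ℕ) : (natShift ^ n) 0 = 2 * n := by
  induction n with
  | zero => rfl
  | succ n ih =>
    rw [pow_succ', Equiv.Perm.mul_apply, ih]
    simp [natShift]
    omega

/-- All the permutations act on rows `{m} × ℕ`. The shift `s` moves row `0` to row `2 n` after `n`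
steps, `a` transposes `1` and `2` in row `2 n` exactly if `n ∈ A` and is trivial in odd rows, and
`b` transposes `0` and `1` in row `0` only. Conjugating `a` by the `n`-th power of `s` brings the
information in row `2 n` to row `0`, and the commutator with `b` erases all other rows. -/
theorem codesSet_permIdeal {I : TuringIdeal} {A : Set ℕ} (hA : deg A ∈ I) :
    CodesSet (permIdeal I (ℕ × ℕ)) A := by
  classical
  have sw : ∀ i j : ℕ, Eff I (Equiv.swap i j) := fun i j => Eff.of_computable
    (Primrec.ite (Primrec.eq.comp .id (.const i)) (.const j)
      (Primrec.ite (Primrec.eq.comp .id (.const j)) (.const i) .id)).to_comp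
  let p : ℕ → Prop := fun m => m % 2 = 0 ∧ m / 2 ∈ A
  have hp : CEP I p := (CEP.eq (by fun_prop) (by fun_prop)).and
    ((cep_of_deg_mem hA).comp (f := fun m => m / 2) (by fun_prop))
  have hp' : CEP I (fun m => ¬ p m) :=
    ((CEP.ne (f := fun m : ℕ => m % 2) (g := fun _ => 0) (by fun_prop) (by fun_prop)).or
      ((cep_compl_of_deg_mem hA).comp (f := fun m => m / 2) (by fun_prop))).of_iff
      fun m => not_and_or
  have hz : CEP I (fun m => m = 0) := CEP.eq (by fun_prop) (by fun_prop)
  have hz' : CEP I (fun m => ¬ m = 0) := CEP.ne (by fun_prop) (by fun_prop)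
  have hs' : Eff I natShift := Eff.of_computable (Primrec.ite
    (Primrec.eq.comp (Primrec.nat_mod.comp .id (.const 2)) (.const 0))
    (Primrec.nat_add.comp .id (.const 2)) (Primrec.ite (Primrec.eq.comp .id (.const 1))
      (.const 0) (Primrec.nat_sub.comp .id (.const 2)))).to_comp
  let s : Equiv.Perm (ℕ × ℕ) := natShift.prodCongr (Equiv.refl ℕ)
  have hs : s ∈ permIdeal I (ℕ × ℕ) := (hs'.comp Eff.fst').prodMk Eff.snd'
  let α : ℕ → Equiv.Perm ℕ := fun m => if p m then Equiv.swap 1 2 else 1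
  let β : ℕ → Equiv.Perm ℕ := fun m => if m = 0 then Equiv.swap 0 1 else 1
  -- The commutator of two overlapping transpositions is a 3-cycle, hence not trivial.
  let γ : ℕ → Equiv.Perm ℕ := fun m => if m = 0 then
    Equiv.swap 0 1 * Equiv.swap 1 2 * (Equiv.swap 0 1)⁻¹ * (Equiv.swap 1 2)⁻¹ else 1
  have hα : fiberPerm α ∈ permIdeal I (ℕ × ℕ) := fiberPerm_mem (sw 1 2) hp hp'
  have hβ : fiberPerm β ∈ permIdeal I (ℕ × ℕ) := fiberPerm_mem (sw 0 1) hz hz'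
  have hγ : fiberPerm γ ∈ permIdeal I (ℕ × ℕ) :=
    fiberPerm_mem (mul_mem (mul_mem (mul_mem (S := Subgroup (Equiv.Perm ℕ)) (s := permIdeal I ℕ)
      (sw 0 1) (sw 1 2))
      (inv_mem (sw 0 1))) (inv_mem (sw 1 2))) hz hz'
  have hpow : ∀ n q, (s ^ n) q = ((natShift ^ n) q.1, q.2) := by
    intro n
    induction n with
    | zero => intro q; rfl
    | succ n ih =>
      intro q
      rw [pow_succ', pow_succ', Equiv.Perm.mul_apply, ih]
      rfl
  have hconj : ∀ n (f : ℕ → Equiv.Perm ℕ), (s ^ n)⁻¹ * fiberPerm f * s ^ n =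
      fiberPerm (fun m => f ((natShift ^ n) m)) := by
    intro n f
    rw [mul_assoc, inv_mul_eq_iff_eq_mul]
    ext q : 1
    rw [Equiv.Perm.mul_apply, Equiv.Perm.mul_apply, hpow, hpow]
    rfl
  have hword : ∀ n, codeWord s (fiberPerm α) (fiberPerm β) n = fiberPerm (fun m =>
      β m * α ((natShift ^ n) m) * (β m)⁻¹ * (α ((natShift ^ n) m))⁻¹) := by
    intro n
    rw [codeWord, hconj, ← map_inv, ← map_inv, hconj, ← map_mul, ← map_mul, ← map_mul]
    rfl
  have hp0 : ∀ n, p ((natShift ^ n) 0) ↔ n ∈ A := fun n => by simp [p, natShift_pow_zero]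
  refine ⟨⟨s, hs⟩, ⟨_, hα⟩, ⟨_, hβ⟩, ⟨_, hγ⟩, ?_, fun n hn => Subtype.ext ?_,
    fun n hn => Subtype.ext ?_⟩
  · intro h
    have h1 : fiberPerm γ (0, 0) = (0, 0) := congrArg (fun g : permIdeal I (ℕ × ℕ) =>
      g.1 (0, 0)) h
    simp [fiberPerm_apply, γ, Equiv.swap_apply_def] at h1
  · refine (hword n).trans (congrArg fiberPerm (funext fun m => ?_))
    rcases eq_or_ne m 0 with rfl | hm
    · simp [α, β, γ, (hp0 n).2 hn]
    · simp [β, γ, hm]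
  · refine (hword n).trans ((congrArg fiberPerm (funext fun m => ?_)).trans (map_one fiberPerm))
    rcases eq_or_ne m 0 with rfl | hm
    · simp [α, β, (hp0 n).not.2 hn]
    · simp [β, hm]

end SubstructureLattice

namespace SubstructureLattice

/-! ### Automorphisms of lattices of c.e. substructures -/

open GenLattice

section

variable {S X : Type*} [CompleteLattice S] [SetLike S X] [GenLattice S X] [Coded X]
  {I J : TuringIdeal}

/-- The automorphisms of the lattice of all substructures that induce automorphisms of the lattice
of those substructures that are c.e. in some degree of `I`. -/
def ceAut (S : Type*) {X : Type*} [CompleteLattice S] [SetLike S X] [GenLattice S X] [Coded X]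
    (I : TuringIdeal) : Subgroup (S ≃o S) := preserving fun W => CEP I (· ∈ W)

/-- Given the relation `Ψ (gen x) = gen y`, the elements of `W` and those of `Ψ W` can be enumerated
from each other. -/
theorem mem_ceAut_of_cep {Ψ : S ≃o S} (h : CEP I (fun p : X × X => Ψ (gen p.1) = gen p.2)) :
    Ψ ∈ ceAut S I := fun W => by
  constructor
  · intro hW
    refine (CEP.ex (R := fun x y => Ψ (gen x) = gen y ∧ y ∈ Ψ W) (h.and hW.snd)).of_iff
      fun x => ⟨fun hx => ?_, ?_⟩
    · obtain ⟨y, hy⟩ := exists_gen_eq_orderIso Ψ x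
      exact ⟨y, hy, (mem_apply_of_gen hy).2 hx⟩
    · rintro ⟨y, hy, hyW⟩
      exact (mem_apply_of_gen hy).1 hyW
  · intro hW
    refine (CEP.ex (R := fun y x => x ∈ W ∧ Ψ (gen x) = gen y) (hW.snd.and h.swap)).of_iff
      fun x => mem_apply_iff Ψ

theorem cep_mem_apply {Ψ : S ≃o S} (hΨ : Ψ ∈ ceAut S I) {W : S} (hW : CEP I (· ∈ W)) :
    CEP I (· ∈ Ψ W) := (hΨ W).2 hW

/-- The representation to which `CodesSet.deg_mem` is applied is the action on one-generated
substructures; it is faithful because these determine an automorphism. -/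
theorem CodesSet.deg_mem_ceAut
    (track : ∀ Ψ ∈ ceAut S J, CEP J (fun p : X × X => Ψ (gen p.1) = gen p.2)) {A : Set ℕ}
    (h : CodesSet (ceAut S J) A) : deg A ∈ J := by
  refine h.deg_mem (X := X) (fun Ψ x y => Ψ.1 (gen x) = gen y) (fun Ψ Φ x z => ?_) (fun _ => rfl)
    (fun Ψ => track _ Ψ.2) fun Ψ hΨ => ?_
  · constructor
    · intro h
      obtain ⟨y, hy⟩ := exists_gen_eq_orderIso Φ.1 x
      refine ⟨y, hy, ?_⟩
      rw [← hy]
      exact h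
    · rintro ⟨y, h1, h2⟩
      rw [← h2, ← h1]
      rfl
  · obtain ⟨x, hx⟩ : ∃ x : X, Ψ.1 (gen x) ≠ gen x := by
      by_contra! h'
      refine hΨ (Subtype.ext (RelIso.ext fun W => eq_of_forall_gen_le (X := X) fun y => ?_))
      rw [gen_le_iff, mem_apply_of_gen (h' y), gen_le_iff]
      rfl
    obtain ⟨y, hy⟩ := exists_gen_eq_orderIso Ψ.1 x
    exact ⟨x, y, hy, fun h' => hx (hy.trans (Eq.symm h')), hx⟩

/-- A set of degree in `I` is coded in the permutation group, hence in `G I`, hence in `G J`, where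
only degrees of `J` can be coded. -/
theorem le_of_codesSet {G : TuringIdeal → Type*} [∀ I, Group (G I)]
    (perm : ∀ I, GroupEmbeds (permIdeal I ℕ) (G I))
    (deg_mem : ∀ (J : TuringIdeal) (A : Set ℕ), CodesSet (G J) A → deg A ∈ J)
    (h : GroupEmbeds (G I) (G J)) : (I : Set Degree) ⊆ J := by
  intro d hd
  induction d using Quotient.inductionOn with
  | _ A => exact deg_mem J A ((codesSet_permIdeal (A := A) hd).of_embeds
      (((permIdeal_embeds_nat I).trans (perm I)).trans h))

/-- For the direction from right to left, preserving "c.e. in `I`" does not visibly imply preserving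
"c.e. in `J`". It does through `track`: the enumeration of the values at generators in `I` is also
one in `J`, so `ceAut S I` is a subgroup of `ceAut S J`. -/
theorem groupEmbeds_ceAut_iff
    (track : ∀ I, ∀ Ψ ∈ ceAut S I, CEP I (fun p : X × X => Ψ (gen p.1) = gen p.2))
    (perm : ∀ I, GroupEmbeds (permIdeal I ℕ) (ceAut S I)) :
    GroupEmbeds (ceAut S I) (ceAut S J) ↔ (I : Set Degree) ⊆ J := by
  refine ⟨le_of_codesSet perm fun J A h => h.deg_mem_ceAut (track J), fun h => ?_⟩
  exact ⟨Subgroup.inclusion fun Ψ hΨ => mem_ceAut_of_cep ((track I Ψ hΨ).mono h),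
    Subgroup.inclusion_injective _⟩

/-- Embeddability of the automorphism groups of the lattices of c.e. substructures. -/
theorem groupEmbeds_aut_iff {P : TuringIdeal → S → Prop} (hP : ∀ I W, P I W ↔ CEP I (· ∈ W))
    (two : ∀ I, ∀ x y : X, CEP I (· ∈ (gen x ⊔ gen y : S)))
    (track : ∀ I, ∀ Ψ ∈ ceAut S I, CEP I (fun p : X × X => Ψ (gen p.1) = gen p.2))
    (perm : ∀ I, GroupEmbeds (permIdeal I ℕ) (ceAut S I)) :
    GroupEmbeds ({W // P I W} ≃o {W // P I W}) ({W // P J W} ≃o {W // P J W}) ↔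
      (I : Set Degree) ⊆ J := by
  obtain rfl : P = fun I W => CEP I (· ∈ W) := funext fun I => funext fun W => propext (hP I W)
  rw [← groupEmbeds_ceAut_iff (I := I) (J := J) track perm]
  have e := fun I => restrictEquiv (P := fun W : S => CEP I (· ∈ W)) (two I)
  exact ⟨fun h => ((GroupEmbeds.of_mulEquiv (e I)).trans h).trans
      (GroupEmbeds.of_mulEquiv (e J).symm),
    fun h => ((GroupEmbeds.of_mulEquiv (e I).symm).trans h).trans
      (GroupEmbeds.of_mulEquiv (e J))⟩

end

end SubstructureLattice

namespace SubstructureLattice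

/-! ### Computable fields and finitely nonzero sequences -/

open GenLattice Coded

/-- Applied to the principal ideal of `deg A`, this makes the calculus of `CEP` available for
proving that a set of codes is c.e. relative to every oracle, as the class `Coded` demands. -/
theorem sig1_of_cep {P : ℕ → Prop} (h : ∀ I, CEP I P) (A : Set ℕ) : Sig1 A P := by
  obtain ⟨B, hB, hP⟩ := h (Order.Ideal.principal (deg A))
  exact (hP.of_iff fun n => by simp).mono (deg_le_deg.1 (Order.Ideal.mem_principal.1 hB))

theorem Eff.of_code {I : TuringIdeal} {X Y : Type*} [Coded X] [Coded Y] {f : X → Y}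
    (h : Eff I (fun x => Coded.code (f x))) : Eff I f :=
  (CEP.eq (f := fun p : X × Y => Coded.code (f p.1)) (g := fun p => Coded.code p.2)
    (h.comp Eff.fst') (Eff.code.comp Eff.snd')).of_iff fun _ => code_injective.eq_iff.symm

theorem sig1_of_computablePred {P : ℕ → Prop} (h : ComputablePred P) (A : Set ℕ) : Sig1 A P := by
  obtain ⟨_, h⟩ := h
  exact (Sig1.of_totIn (TotIn.of_computable
    (Computable.cond h (Computable.const 0) (Computable.const 1)))).of_iff fun n => by
      by_cases hn : P n <;> simp [hn]

/-- A field with coded elements in which addition and multiplication are effective. -/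
class EffField (F : Type*) [Field F] extends Coded F where
  eff_add : ∀ I : TuringIdeal, Eff I (fun p : F × F => p.1 + p.2)
  eff_mul : ∀ I : TuringIdeal, Eff I (fun p : F × F => p.1 * p.2)

/-- The effective field given by a computable presentation. -/
@[reducible]
def ComputableField.effField {F : Type*} [Field F] (C : ComputableField F) : EffField F :=
  letI : Coded F := ⟨C.code, C.code_injective, sig1_of_computablePred C.computable_range⟩
  { code := C.code
    code_injective := C.code_injective
    sig1_range := sig1_of_computablePred C.computable_range
    eff_add := fun I => by
      obtain ⟨f, hf, h⟩ := C.computable_add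
      refine Eff.of_code (((Eff.of_computable₂ hf).comp (g := fun p : F × F =>
        (Coded.code p.1, Coded.code p.2)) ?_).of_eq fun p => h _ _)
      exact (Eff.code.comp Eff.fst').prodMk (Eff.code.comp Eff.snd')
    eff_mul := fun I => by
      obtain ⟨f, hf, h⟩ := C.computable_mul
      refine Eff.of_code (((Eff.of_computable₂ hf).comp (g := fun p : F × F =>
        (Coded.code p.1, Coded.code p.2)) ?_).of_eq fun p => h _ _)
      exact (Eff.code.comp Eff.fst').prodMk (Eff.code.comp Eff.snd') }

section

variable {F : Type*} [Field F]

/-- The length of the shortest initial segment of `ℕ` outside of which `v` vanishes. -/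
def vecLen (v : ℕ →₀ F) : ℕ := v.support.sup fun i => i + 1

theorem lt_vecLen {v : ℕ →₀ F} {k : ℕ} (h : v k ≠ 0) : k < vecLen v :=
  Finset.le_sup (f := fun i => i + 1) (Finsupp.mem_support_iff.2 h)

theorem apply_eq_zero {v : ℕ →₀ F} {k : ℕ} (h : vecLen v ≤ k) : v k = 0 := by
  by_contra h'
  exact absurd (lt_vecLen h') (not_lt.2 h)

theorem apply_vecLen_pred {v : ℕ →₀ F} (h : vecLen v ≠ 0) : v (vecLen v - 1) ≠ 0 := by
  have hne : v.support.Nonempty := by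
    rw [Finset.nonempty_iff_ne_empty]
    intro h0
    simp [vecLen, h0] at h
  obtain ⟨i, hi, h'⟩ := Finset.exists_mem_eq_sup v.support hne fun i => i + 1
  have h2 : vecLen v = i + 1 := h'
  rw [h2]
  exact Finsupp.mem_support_iff.1 hi

end

section

variable {F : Type*} [Field F] [EffField F]

/-- The list of the codes of the entries of a finitely nonzero sequence. -/
def vecList (v : ℕ →₀ F) : List ℕ := (List.range (vecLen v)).map fun i => code (v i)

theorem length_vecList (v : ℕ →₀ F) : (vecList v).length = vecLen v := by simp [vecList]

/-- The default value `code 0` is the correct entry beyond the end of the list, where `v` vanishes.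
-/
theorem getD_vecList (v : ℕ →₀ F) (k : ℕ) : (vecList v).getD k (code (0 : F)) = code (v k) := by
  rcases lt_or_ge k (vecLen v) with h | h
  · simp [vecList, List.getD_eq_getElem?_getD, h]
  · rw [List.getD_eq_default _ _ (by rwa [length_vecList]), apply_eq_zero h]

theorem vecList_injective : Function.Injective (vecList (F := F)) := fun v w h =>
  Finsupp.ext fun k => code_injective (by rw [← getD_vecList, h, getD_vecList])

theorem mem_range_vecList (l : List ℕ) : l ∈ Set.range (vecList (F := F)) ↔
    (∀ k < l.length, l.getD k (code (0 : F)) ∈ Set.range (code (X := F))) ∧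
      (l.length = 0 ∨ l.getD (l.length - 1) (code (0 : F)) ≠ code (0 : F)) := by
  constructor
  · rintro ⟨v, rfl⟩
    refine ⟨fun k _ => ⟨v k, (getD_vecList v k).symm⟩, ?_⟩
    rw [length_vecList, getD_vecList, code_injective.ne_iff]
    by_cases h : vecLen v = 0
    · exact Or.inl h
    · exact Or.inr (apply_vecLen_pred h)
  · rintro ⟨h1, h2⟩
    have hx : ∀ k, ∃ x : F, code x = l.getD k (code (0 : F)) := fun k => by
      rcases lt_or_ge k l.length with h | h
      · exact h1 k h
      · exact ⟨0, (List.getD_eq_default _ _ h).symm⟩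
    choose x hx using hx
    have hx0 : ∀ k, x k ≠ 0 → k ∈ Finset.range l.length := fun k hk => by
      rw [Finset.mem_range]
      by_contra h
      refine hk (code_injective ?_)
      rw [hx, List.getD_eq_default _ _ (not_lt.1 h)]
    let v : ℕ →₀ F := Finsupp.onFinset (Finset.range l.length) x hx0
    have hlen : vecLen v = l.length := by
      refine le_antisymm (Finset.sup_le fun i hi => ?_) ?_
      · exact Finset.mem_range.1 (hx0 i (Finsupp.mem_support_iff.1 hi))
      · rcases h2 with h2 | h2
        · omega
        · have h3 : v (l.length - 1) ≠ 0 := fun h => h2 (by rw [← hx]; exact congrArg code h)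
          have := lt_vecLen h3
          omega
    refine ⟨v, List.ext_getElem (by rw [length_vecList, hlen]) fun k hk hk' => ?_⟩
    have h3 := getD_vecList v k
    rw [List.getD_eq_getElem _ _ hk] at h3
    rw [h3]
    exact (hx k).trans (List.getD_eq_getElem _ _ hk')

theorem primrec_length_ofNat : Primrec fun n : ℕ => (Denumerable.ofNat (List ℕ) n).length :=
  Primrec.list_length.comp (Primrec.ofNat _)

theorem primrec₂_getD_ofNat (d : ℕ) :
    Primrec₂ fun n k : ℕ => (Denumerable.ofNat (List ℕ) n).getD k d :=
  (Primrec.list_getD d).comp₂ ((Primrec.ofNat _).comp .fst) Primrec.snd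

instance : Coded (ℕ →₀ F) where
  code v := Encodable.encode (vecList v)
  code_injective := Encodable.encode_injective.comp vecList_injective
  sig1_range := sig1_of_cep fun I => by
    have hl : Eff I fun n : ℕ => (Denumerable.ofNat (List ℕ) n).length :=
      Eff.of_computable primrec_length_ofNat.to_comp
    have hg : Eff I fun p : ℕ × ℕ => (Denumerable.ofNat (List ℕ) p.1).getD p.2 (code (0 : F)) :=
      Eff.of_primrec₂ (primrec₂_getD_ofNat _)
    have hr : CEP I (fun n => n ∈ Set.range (code (X := F))) :=
      CEP.of_sig1 fun A => (sig1_range (X := F) A).of_iff fun n => by simp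
    refine ((CEP.forall_lt (P := fun n k => (Denumerable.ofNat (List ℕ) n).getD k (code (0 : F)) ∈
      Set.range (code (X := F))) (hr.comp hg) hl).and ((CEP.eq hl (Eff.const 0)).or
      (CEP.ne (hg.comp (Eff.id.prodMk (hl.nat_sub (Eff.const 1))))
        (Eff.const (code (0 : F)))))).of_iff fun n => ?_
    rw [← mem_range_vecList]
    constructor
    · rintro ⟨v, rfl⟩
      exact ⟨v, by simp⟩
    · rintro ⟨v, h⟩
      exact ⟨v, by simp only [h, Denumerable.encode_ofNat]⟩

theorem code_vec (v : ℕ →₀ F) : code v = Encodable.encode (vecList v) := rfl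

variable {I : TuringIdeal} {X : Type*} [Coded X]

namespace Eff

@[fun_prop]
theorem field_add {f g : X → F} (hf : Eff I f) (hg : Eff I g) : Eff I (fun x => f x + g x) :=
  (EffField.eff_add I).comp (hf.prodMk hg)

@[fun_prop]
theorem field_mul {f g : X → F} (hf : Eff I f) (hg : Eff I g) : Eff I (fun x => f x * g x) :=
  (EffField.eff_mul I).comp (hf.prodMk hg)

@[fun_prop]
theorem vec_len {f : X → ℕ →₀ F} (hf : Eff I f) : Eff I (fun x => vecLen (f x)) := by
  refine Eff.comp (f := fun v : ℕ →₀ F => vecLen v) ?_ hf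
  refine ((Eff.of_computable primrec_length_ofNat.to_comp).comp Eff.code).of_eq fun v => ?_
  rw [code_vec, Denumerable.ofNat_encode, length_vecList]

@[fun_prop]
theorem vec_apply {f : X → ℕ →₀ F} {g : X → ℕ} (hf : Eff I f) (hg : Eff I g) :
    Eff I (fun x => f x (g x)) := by
  refine Eff.comp (f := fun p : (ℕ →₀ F) × ℕ => p.1 p.2) ?_ (hf.prodMk hg)
  refine Eff.of_code (((Eff.of_primrec₂ (primrec₂_getD_ofNat (Coded.code (0 : F)))).comp
    (g := fun p : (ℕ →₀ F) × ℕ => (Coded.code p.1, p.2))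
    ((Eff.code.comp Eff.fst').prodMk Eff.snd')).of_eq fun p => ?_)
  rw [code_vec, Denumerable.ofNat_encode, getD_vecList]

/-- A function to the finitely nonzero sequences is effective if its coordinates and a bound on
its length are. -/
theorem vec_of_apply {f : X → ℕ →₀ F} (h : Eff I (fun p : X × ℕ => f p.1 p.2)) {b : X → ℕ}
    (hb : Eff I b) (hb' : ∀ x k, b x ≤ k → f x k = 0) : Eff I f := by
  -- Beyond `b x` and the length of the candidate both sequences vanish, so finitely many
  -- comparisons decide equality.
  refine (CEP.forall_lt (P := fun (p : X × (ℕ →₀ F)) k => f p.1 k = p.2 k)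
    (CEP.eq (h.comp (g := fun q : (X × (ℕ →₀ F)) × ℕ => (q.1.1, q.2)) (by fun_prop))
      (by fun_prop)) (f := fun p => b p.1 + vecLen p.2) (by fun_prop)).of_iff fun p => ?_
  refine ⟨fun h k _ => by rw [h], fun h => Finsupp.ext fun k => ?_⟩
  rcases lt_or_ge k (b p.1 + vecLen p.2) with hk | hk
  · exact h k hk
  · rw [hb' _ _ (by omega), apply_eq_zero (by omega)]

@[fun_prop]
theorem vec_add {f g : X → ℕ →₀ F} (hf : Eff I f) (hg : Eff I g) : Eff I (fun x => f x + g x) := by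
  refine vec_of_apply (b := fun x => vecLen (f x) + vecLen (g x)) ?_ (by fun_prop) fun x k hk => ?_
  · simp only [Finsupp.add_apply]
    fun_prop
  · rw [Finsupp.add_apply, apply_eq_zero (by omega), apply_eq_zero (by omega), add_zero]

@[fun_prop]
theorem vec_smul {f : X → F} {g : X → ℕ →₀ F} (hf : Eff I f) (hg : Eff I g) :
    Eff I (fun x => f x • g x) := by
  refine vec_of_apply (b := fun x => vecLen (g x)) ?_ (by fun_prop) fun x k hk => ?_
  · simp only [Finsupp.smul_apply, smul_eq_mul]
    fun_prop
  · rw [Finsupp.smul_apply, apply_eq_zero hk, smul_zero]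

@[fun_prop]
theorem vec_single {f : X → ℕ} (hf : Eff I f) : Eff I (fun x => Finsupp.single (f x) (1 : F)) := by
  refine vec_of_apply (b := fun x => f x + 1) ?_ (by fun_prop) fun x k hk => ?_
  · refine (((CEP.eq (f := fun q : (X × ℕ) × F => f q.1.1) (g := fun q => q.1.2) (by fun_prop)
      (by fun_prop)).and (CEP.eq (f := fun q : (X × ℕ) × F => q.2) (g := fun _ => 1)
      (by fun_prop) (by fun_prop))).or
      ((CEP.ne (f := fun q : (X × ℕ) × F => f q.1.1) (g := fun q => q.1.2) (by fun_prop)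
      (by fun_prop)).and (CEP.eq (f := fun q : (X × ℕ) × F => q.2) (g := fun _ => 0)
      (by fun_prop) (by fun_prop)))).of_iff fun q => ?_
    by_cases h : f q.1.1 = q.1.2 <;> simp [h, eq_comm]
  · rw [Finsupp.single_apply, if_neg (by omega)]

end Eff

/-- The span is what can be reached from `0` by adding multiples of generators one at a time. -/
theorem cep_mem_span {G : (ℕ →₀ F) → Prop} (hG : CEP I G) :
    CEP I (· ∈ Submodule.span F {v | G v}) := by
  let R : (ℕ →₀ F) → (ℕ →₀ F) → Prop := fun x y => ∃ q : F × (ℕ →₀ F), G q.2 ∧ y = x + q.1 • q.2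
  have hR : CEP I (fun p : (ℕ →₀ F) × (ℕ →₀ F) => R p.1 p.2) :=
    CEP.ex (R := fun (p : (ℕ →₀ F) × (ℕ →₀ F)) (q : F × (ℕ →₀ F)) => G q.2 ∧ p.2 = p.1 + q.1 • q.2)
      ((hG.comp (by fun_prop)).and (CEP.eq (by fun_prop) (by fun_prop)))
  have shift : ∀ x y, Relation.ReflTransGen R 0 y → Relation.ReflTransGen R x (x + y) := by
    intro x y h
    induction h with
    | refl => simpa using Relation.ReflTransGen.refl
    | tail _ h ih =>
      obtain ⟨q, hq, rfl⟩ := h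
      exact ih.tail ⟨q, hq, by rw [add_assoc]⟩
  refine (hR.reach 0).of_iff fun v => ⟨fun h => ?_, fun h => ?_⟩
  · induction h using Submodule.span_induction with
    | mem v hv => exact .single ⟨(1, v), hv, by simp⟩
    | zero => exact .refl
    | add x y _ _ hx hy => exact hx.trans (shift x y hy)
    | smul c x _ hx =>
      clear * - hx
      induction hx with
      | refl => simpa using Relation.ReflTransGen.refl
      | tail _ h ih =>
        obtain ⟨q, hq, rfl⟩ := h
        exact ih.tail ⟨(c * q.1, q.2), hq, by rw [smul_add, mul_smul]⟩
  · induction h with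
    | refl => exact zero_mem _
    | tail _ h ih =>
      obtain ⟨q, hq, rfl⟩ := h
      exact add_mem ih (Submodule.smul_mem _ _ (Submodule.subset_span hq))

end

/-! ### The lattice of subspaces -/

instance {F V : Type*} [Field F] [AddCommGroup V] [Module F V] : GenLattice (Submodule F V) V where
  gen x := Submodule.span F {x}
  gen_le_iff := Submodule.span_singleton_le_iff_mem _ _
  le_iff := SetLike.le_def
  gen_eq_of_le := by
    intro x y h h0
    obtain ⟨c, rfl⟩ := Submodule.mem_span_singleton.1
      ((Submodule.span_singleton_le_iff_mem _ _).1 h)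
    refine le_antisymm h ?_
    have hc : c ≠ 0 := by
      rintro rfl
      simp at h0
    rw [Submodule.span_singleton_le_iff_mem, Submodule.mem_span_singleton]
    exact ⟨c⁻¹, by rw [smul_smul, inv_mul_cancel₀ hc, one_smul]⟩
  exists_gen_eq_bot := ⟨0, by simp⟩
  exists_coe_eq := by
    intro T hT h
    refine ⟨{ carrier := T, add_mem' := fun {x y} hx hy => h x hx y hy _ ?_,
              zero_mem' := ?_, smul_mem' := fun c x hx => h x hx x hx _ ?_ }, rfl⟩
    · exact add_mem (Submodule.mem_sup_left (Submodule.mem_span_singleton_self x))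
        (Submodule.mem_sup_right (Submodule.mem_span_singleton_self y))
    · obtain ⟨x, hx⟩ := hT
      exact h x hx x hx 0 (zero_mem _)
    · exact Submodule.smul_mem _ _ (Submodule.mem_sup_left (Submodule.mem_span_singleton_self x))

theorem gen_eq_span {F V : Type*} [Field F] [AddCommGroup V] [Module F V] (x : V) :
    (gen x : Submodule F V) = Submodule.span F {x} := rfl

end SubstructureLattice

namespace SubstructureLattice

/-! ### Effectiveness of automorphisms of lattices of subspaces -/

open GenLattice

section

variable {F V : Type*} [Field F] [AddCommGroup V] [Module F V]

/-- A subspace `Γ` that meets `K` trivially and contains `x + k` transports the values of an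
automorphism of the lattice of subspaces from `x` to `k ∈ K`. -/
theorem span_singleton_transport (Φ : Submodule F V ≃o Submodule F V) {Γ K : Submodule F V}
    (hΓK : Γ ⊓ K = ⊥) {x k u : V} (hk : k ∈ K) (hxk : x + k ∈ Γ) (hx : x ∈ K → x = 0)
    (hu : Φ (Submodule.span F {x}) = Submodule.span F {u}) {y : V} (hy : y ∈ Φ K)
    (huy : u + y ∈ Φ Γ) : Φ (Submodule.span F {k}) = Submodule.span F {y} := by
  -- The line of `x + k` is cut out by `Γ`: an element `c • x + k'` of `Γ` with `k' ∈ K` differs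
  -- from `c • (x + k)` by an element of `Γ ⊓ K`.
  have e1 : (Submodule.span F {x} ⊔ K) ⊓ Γ ≤ Submodule.span F {x + k} := by
    rintro w ⟨hw, hw'⟩
    obtain ⟨a, ha, k', hk', rfl⟩ := Submodule.mem_sup.1 hw
    obtain ⟨c, rfl⟩ := Submodule.mem_span_singleton.1 ha
    have h1 : k' - c • k ∈ Γ ⊓ K := by
      refine ⟨?_, sub_mem hk' (K.smul_mem c hk)⟩
      have := sub_mem hw' (Γ.smul_mem c hxk)
      rwa [smul_add, add_sub_add_left_eq_sub] at this
    rw [hΓK, Submodule.mem_bot, sub_eq_zero] at h1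
    rw [h1, ← smul_add]
    exact Submodule.smul_mem _ _ (Submodule.mem_span_singleton_self _)
  -- The line of `k` is in turn recovered from those of `x` and `x + k` by intersecting with `K`.
  -- Applying `Φ` to `e1` and `e2` locates `u + y` and then `y`.
  have e2 : (Submodule.span F {x} ⊔ Submodule.span F {x + k}) ⊓ K ≤ Submodule.span F {k} := by
    rintro w ⟨hw, hw'⟩
    obtain ⟨a, ha, b, hb, rfl⟩ := Submodule.mem_sup.1 hw
    obtain ⟨c, rfl⟩ := Submodule.mem_span_singleton.1 ha
    obtain ⟨d, rfl⟩ := Submodule.mem_span_singleton.1 hb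
    have h1 : (c + d) • x ∈ K := by
      have := sub_mem hw' (K.smul_mem d hk)
      rwa [smul_add, ← add_assoc, add_sub_cancel_right, ← add_smul] at this
    have h2 : (c + d) • x = 0 := by
      by_cases h : c + d = 0
      · rw [h, zero_smul]
      · rw [hx ((Submodule.smul_mem_iff _ h).1 h1), smul_zero]
    rw [smul_add, ← add_assoc, ← add_smul, h2, zero_add]
    exact Submodule.smul_mem _ _ (Submodule.mem_span_singleton_self _)
  have h1 : u + y ∈ Φ (Submodule.span F {x + k}) := by
    refine Φ.monotone e1 ?_
    rw [map_inf, map_sup, hu]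
    exact ⟨add_mem (Submodule.mem_sup_left (Submodule.mem_span_singleton_self u))
      (Submodule.mem_sup_right hy), huy⟩
  have h2 : y ∈ Φ (Submodule.span F {k}) := by
    refine Φ.monotone e2 ?_
    rw [map_inf, map_sup, hu]
    refine ⟨?_, hy⟩
    have := sub_mem (Submodule.mem_sup_right h1)
      (Submodule.mem_sup_left (T := Φ (Submodule.span F {x + k}))
        (Submodule.mem_span_singleton_self u))
    rwa [add_sub_cancel_left] at this
  -- If `y = 0`, then `u` lies in `Φ Γ`, so `x ∈ Γ`, and `k` lies in `Γ ⊓ K`, that is, `k = 0`.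
  by_cases hy0 : y = 0
  · subst hy0
    rw [add_zero] at huy
    have h3 : x ∈ Γ := by
      rw [← Submodule.span_singleton_le_iff_mem, ← Φ.le_iff_le, hu,
        Submodule.span_singleton_le_iff_mem]
      exact huy
    have h4 : k ∈ Γ ⊓ K := ⟨by simpa using sub_mem hxk h3, hk⟩
    rw [hΓK, Submodule.mem_bot] at h4
    rw [h4, Submodule.span_zero_singleton, map_bot]
  · obtain ⟨z, hz⟩ := exists_gen_eq_orderIso Φ k
    rw [gen_eq_span, gen_eq_span] at hz
    rw [hz] at h2 ⊢
    exact (gen_eq_of_le (S := Submodule F V)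
      ((Submodule.span_singleton_le_iff_mem _ _).2 h2) (by simpa [gen_eq_span] using hy0)).symm

/-- The image of the line of `x + k` is spanned by a combination of `u` and a generator of the image
of the line of `k`. The coefficient of `u` is nonzero and can be scaled to `1`. -/
theorem exists_span_singleton_transport (Φ : Submodule F V ≃o Submodule F V)
    {Γ K : Submodule F V} (hΓK : Γ ⊓ K = ⊥) {x k u : V} (hk : k ∈ K) (hxk : x + k ∈ Γ)
    (hx : x ∈ K → x = 0) (hu : Φ (Submodule.span F {x}) = Submodule.span F {u}) :
    ∃ y ∈ Φ K, u + y ∈ Φ Γ := by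
  by_cases hx0 : x = 0
  · refine ⟨0, zero_mem _, ?_⟩
    rw [hx0, Submodule.span_zero_singleton, map_bot, eq_comm, Submodule.span_singleton_eq_bot] at hu
    rw [hu, add_zero]
    exact zero_mem _
  obtain ⟨y, hy⟩ := exists_gen_eq_orderIso Φ k
  obtain ⟨w, hw⟩ := exists_gen_eq_orderIso Φ (x + k)
  rw [gen_eq_span, gen_eq_span] at hy hw
  have hyK : y ∈ Φ K := by
    rw [← Submodule.span_singleton_le_iff_mem, ← hy]
    exact Φ.monotone ((Submodule.span_singleton_le_iff_mem _ _).2 hk)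
  have hwΓ : w ∈ Φ Γ := by
    rw [← Submodule.span_singleton_le_iff_mem, ← hw]
    exact Φ.monotone ((Submodule.span_singleton_le_iff_mem _ _).2 hxk)
  have h1 : w ∈ Submodule.span F {u} ⊔ Submodule.span F {y} := by
    rw [← hu, ← hy, ← map_sup, ← Submodule.span_singleton_le_iff_mem, ← hw]
    refine Φ.monotone ((Submodule.span_singleton_le_iff_mem _ _).2 ?_)
    exact add_mem (Submodule.mem_sup_left (Submodule.mem_span_singleton_self x))
      (Submodule.mem_sup_right (Submodule.mem_span_singleton_self k))
  obtain ⟨a, ha, b, hb, rfl⟩ := Submodule.mem_sup.1 h1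
  obtain ⟨c, rfl⟩ := Submodule.mem_span_singleton.1 ha
  obtain ⟨d, rfl⟩ := Submodule.mem_span_singleton.1 hb
  -- Otherwise the image of the line of `x + k` lies in `Φ (Γ ⊓ K)`, so that `x = -k ∈ K`, against
  -- `x ≠ 0`.
  have hc : c ≠ 0 := by
    rintro rfl
    rw [zero_smul, zero_add] at hwΓ hw
    have h2 : d • y ∈ Φ (Γ ⊓ K) := by
      rw [map_inf]
      exact ⟨hwΓ, (Φ K).smul_mem d hyK⟩
    rw [hΓK, map_bot, Submodule.mem_bot] at h2
    rw [h2, Submodule.span_zero_singleton, map_eq_bot_iff, Submodule.span_singleton_eq_bot] at hw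
    exact hx0 (hx (by rw [eq_neg_of_add_eq_zero_left hw]; exact neg_mem hk))
  refine ⟨(c⁻¹ * d) • y, (Φ K).smul_mem _ hyK, ?_⟩
  have := (Φ Γ).smul_mem c⁻¹ hwΓ
  rwa [smul_add, smul_smul, smul_smul, inv_mul_cancel₀ hc, one_smul] at this

end

section

variable {F : Type*} [Field F]

/-- The space of the sequences that vanish at the indices congruent to `r` modulo `3`. -/
noncomputable def vanishing (F : Type*) [Field F] (r : ℕ) : Submodule F (ℕ →₀ F) where
  carrier := {v | ∀ k, k % 3 = r → v k = 0}
  add_mem' hv hw k hk := by rw [Finsupp.add_apply, hv k hk, hw k hk, add_zero]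
  zero_mem' _ _ := rfl
  smul_mem' c v hv k hk := by rw [Finsupp.smul_apply, hv k hk, smul_zero]

theorem mem_vanishing {r : ℕ} {v : ℕ →₀ F} : v ∈ vanishing F r ↔ ∀ k, k % 3 = r → v k = 0 :=
  Iff.rfl

/-- The space spanned by the sums of `Finsupp.single j 1` and `v` for which `D j v`. -/
noncomputable def sumSpan (D : ℕ → (ℕ →₀ F) → Prop) : Submodule F (ℕ →₀ F) :=
  Submodule.span F {w | ∃ p : ℕ × (ℕ →₀ F), D p.1 p.2 ∧ w = Finsupp.single p.1 1 + p.2}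

/-- The linear map `L` sending the `j`-th unit vector to its sum with `v` when `D j v`, and the
other unit vectors to `0`, kills `vanishing F r` and fixes every generator of `sumSpan D`. A common
element is thus both fixed and killed. -/
theorem sumSpan_inf_vanishing {r : ℕ} {D : ℕ → (ℕ →₀ F) → Prop}
    (hD : ∀ j v, D j v → j % 3 = r ∧ v ∈ vanishing F r)
    (hD' : ∀ j v w, D j v → D j w → v = w) : sumSpan D ⊓ vanishing F r = ⊥ := by
  classical
  let d : ℕ → (ℕ →₀ F) := fun j => if h : ∃ v, D j v then Finsupp.single j 1 + h.choose else 0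
  let L := Finsupp.linearCombination F d
  have h0 : ∀ w ∈ vanishing F r, L w = 0 := fun w hw => by
    refine (Finsupp.linearCombination_apply F w).trans (Finset.sum_eq_zero fun j _ => ?_)
    by_cases h : ∃ v, D j v
    · obtain ⟨v, hv⟩ := h
      show w j • d j = 0
      rw [hw j (hD j v hv).1, zero_smul]
    · simp [d, h]
  have h1 : ∀ w ∈ sumSpan D, L w = w := fun w hw => by
    refine LinearMap.eqOn_span (f := L) (g := LinearMap.id) ?_ hw
    rintro _ ⟨⟨j, v⟩, hv, rfl⟩
    have h : ∃ v, D j v := ⟨v, hv⟩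
    have h2 : h.choose = v := hD' j _ _ h.choose_spec hv
    have h3 : d j = Finsupp.single j 1 + v := by simp only [d, dif_pos h, h2]
    show L (Finsupp.single j 1 + v) = Finsupp.single j 1 + v
    rw [map_add, h0 v (hD j v hv).2, add_zero, Finsupp.linearCombination_single, one_smul, h3]
  rw [eq_bot_iff]
  rintro w ⟨hw, hw'⟩
  rw [Submodule.mem_bot, ← h1 w hw, h0 w hw']

theorem single_mem_vanishing {j r : ℕ} (h : j % 3 ≠ r) :
    Finsupp.single j (1 : F) ∈ vanishing F r := fun k hk => by
  rw [Finsupp.single_apply, if_neg]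
  rintro rfl
  exact h hk

variable [EffField F] {I : TuringIdeal}

theorem cep_mem_vanishing (r : ℕ) : CEP I (· ∈ vanishing F r) := by
  refine (CEP.forall_lt (P := fun (v : ℕ →₀ F) k => k % 3 ≠ r ∨ v k = 0)
    ((CEP.ne (by fun_prop) (by fun_prop)).or (CEP.eq (by fun_prop) (by fun_prop)))
    (f := vecLen) (by fun_prop)).of_iff fun v => ?_
  rw [mem_vanishing]
  refine ⟨fun h k _ => (em (k % 3 = r)).symm.imp id (h k), fun h k hk => ?_⟩
  rcases lt_or_ge k (vecLen v) with h1 | h1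
  · exact (h k h1).resolve_left (not_not.2 hk)
  · exact apply_eq_zero h1

theorem cep_mem_sumSpan {D : ℕ → (ℕ →₀ F) → Prop}
    (hD : CEP I (fun p : ℕ × (ℕ →₀ F) => D p.1 p.2)) : CEP I (· ∈ sumSpan D) :=
  cep_mem_span (CEP.ex (R := fun (w : ℕ →₀ F) (p : ℕ × (ℕ →₀ F)) =>
    D p.1 p.2 ∧ w = Finsupp.single p.1 1 + p.2) (hD.snd.and (CEP.eq (by fun_prop) (by fun_prop))))

/-- An automorphism of the lattice of subspaces that preserves being c.e. can be followed
effectively along `D`. -/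
theorem exists_transport {Φ : Submodule F (ℕ →₀ F) ≃o Submodule F (ℕ →₀ F)}
    (hΦ : Φ ∈ ceAut (Submodule F (ℕ →₀ F)) I) {r : ℕ} {D : ℕ → (ℕ →₀ F) → Prop}
    (hDI : CEP I (fun p : ℕ × (ℕ →₀ F) => D p.1 p.2))
    (hD : ∀ j v, D j v → j % 3 = r ∧ v ∈ vanishing F r)
    (hD' : ∀ j v w, D j v → D j w → v = w) :
    ∃ T : (ℕ →₀ F) → (ℕ →₀ F) → Prop,
      CEP I (fun p : (ℕ →₀ F) × (ℕ →₀ F) => T p.1 p.2) ∧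
      ∀ j v u, D j v → Φ (gen (Finsupp.single j 1)) = gen u →
        (∀ y, T u y → Φ (gen v) = gen y) ∧ ∃ y, T u y := by
  have hx : ∀ j v, D j v → Finsupp.single j (1 : F) ∈ vanishing F r →
      Finsupp.single j (1 : F) = 0 := fun j v h h' => by
    have := h' j (hD j v h).1
    simp at this
  have hm : ∀ j v, D j v → Finsupp.single j (1 : F) + v ∈ sumSpan D := fun j v h =>
    Submodule.subset_span ⟨(j, v), h, rfl⟩
  -- Here `K = vanishing F r` and `Γ = sumSpan D` are c.e. in `I`, hence so are their images, as `Φ`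
  -- preserves this.
  refine ⟨fun u y => y ∈ Φ (vanishing F r) ∧ u + y ∈ Φ (sumSpan D),
    ((cep_mem_apply hΦ (cep_mem_vanishing r)).comp (by fun_prop)).and
      ((cep_mem_apply hΦ (cep_mem_sumSpan hDI)).comp (by fun_prop)), fun j v u h hu => ⟨?_, ?_⟩⟩
  · rintro y ⟨h1, h2⟩
    exact span_singleton_transport Φ (sumSpan_inf_vanishing hD hD') (hD j v h).2 (hm j v h)
      (hx j v h) hu h1 h2
  · exact exists_span_singleton_transport Φ (sumSpan_inf_vanishing hD hD') (hD j v h).2 (hm j v h)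
      (hx j v h) hu

/-- The case of `exists_transport` that leads from one unit vector to the next; the index `j + 1` is
not congruent to `r`, so the target lies in `vanishing F r`. -/
theorem exists_step {Φ : Submodule F (ℕ →₀ F) ≃o Submodule F (ℕ →₀ F)}
    (hΦ : Φ ∈ ceAut (Submodule F (ℕ →₀ F)) I) (r : ℕ) :
    ∃ T : (ℕ →₀ F) → (ℕ →₀ F) → Prop,
      CEP I (fun p : (ℕ →₀ F) × (ℕ →₀ F) => T p.1 p.2) ∧
      ∀ j u, j % 3 = r → Φ (gen (Finsupp.single j 1)) = gen u →
        (∀ y, T u y → Φ (gen (Finsupp.single (j + 1) 1)) = gen y) ∧ ∃ y, T u y := by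
  obtain ⟨T, hT, hT'⟩ := exists_transport hΦ (r := r)
    (D := fun j v => j % 3 = r ∧ v = Finsupp.single (j + 1) (1 : F))
    ((CEP.eq (by fun_prop) (by fun_prop)).and (CEP.eq (by fun_prop) (by fun_prop)))
    (fun j v h => ⟨h.1, h.2 ▸ single_mem_vanishing (by omega)⟩)
    (fun j v w h h' => h.2.trans h'.2.symm)
  exact ⟨T, hT, fun j u h hu => hT' j _ u ⟨h, rfl⟩ hu⟩

/-- The values of an automorphism at the lines spanned by the unit vectors can be enumerated. -/
theorem exists_cep_gen_single {Φ : Submodule F (ℕ →₀ F) ≃o Submodule F (ℕ →₀ F)}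
    (hΦ : Φ ∈ ceAut (Submodule F (ℕ →₀ F)) I) : ∃ T : ℕ → (ℕ →₀ F) → Prop,
      CEP I (fun p : ℕ × (ℕ →₀ F) => T p.1 p.2) ∧
      (∀ j u, T j u → Φ (gen (Finsupp.single j 1)) = gen u) ∧ ∀ j, ∃ u, T j u := by
  choose T hT hT' using fun r => exists_step hΦ r
  let R : ℕ × (ℕ →₀ F) → ℕ × (ℕ →₀ F) → Prop := fun p q => q.1 = p.1 + 1 ∧
    ((p.1 % 3 = 0 ∧ T 0 p.2 q.2) ∨ (p.1 % 3 = 1 ∧ T 1 p.2 q.2) ∨ (p.1 % 3 = 2 ∧ T 2 p.2 q.2))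
  have hR : CEP I (fun s : (ℕ × (ℕ →₀ F)) × (ℕ × (ℕ →₀ F)) => R s.1 s.2) := by
    have h1 : ∀ r, CEP I (fun s : (ℕ × (ℕ →₀ F)) × (ℕ × (ℕ →₀ F)) =>
        s.1.1 % 3 = r ∧ T r s.1.2 s.2.2) := fun r =>
      (CEP.eq (by fun_prop) (by fun_prop)).and ((hT r).comp₂ (by fun_prop) (by fun_prop))
    exact (CEP.eq (by fun_prop) (by fun_prop)).and ((h1 0).or ((h1 1).or (h1 2)))
  have hR' : ∀ p q, R p q ↔ q.1 = p.1 + 1 ∧ T (p.1 % 3) p.2 q.2 := fun p q => by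
    have : p.1 % 3 < 3 := Nat.mod_lt _ (by norm_num)
    refine and_congr_right fun _ => ?_
    generalize p.1 % 3 = r at this
    interval_cases r <;> simp
  -- A value at the first unit vector is finite information that is simply given; all others are
  -- then found by search.
  obtain ⟨u₀, hu₀⟩ := exists_gen_eq_orderIso Φ (Finsupp.single 0 (1 : F))
  have sound : ∀ p, Relation.ReflTransGen R (0, u₀) p →
      Φ (gen (Finsupp.single p.1 1)) = gen p.2 := fun p h => by
    induction h with
    | refl => exact hu₀
    | tail _ h ih =>
      obtain ⟨h1, h2⟩ := (hR' _ _).1 h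
      rw [h1]
      exact (hT' _ _ _ rfl ih).1 _ h2
  have complete : ∀ j, ∃ u, Relation.ReflTransGen R (0, u₀) (j, u) := fun j => by
    induction j with
    | zero => exact ⟨u₀, .refl⟩
    | succ j ih =>
      obtain ⟨u, hu⟩ := ih
      have h1 : Φ (gen (Finsupp.single j 1)) = gen u := sound (j, u) hu
      obtain ⟨y, hy⟩ := (hT' (j % 3) j u rfl h1).2
      have h2 : R (j, u) (j + 1, y) := (hR' (j, u) (j + 1, y)).2 ⟨rfl, hy⟩
      exact ⟨y, hu.tail h2⟩
  exact ⟨fun j u => Relation.ReflTransGen R (0, u₀) (j, u),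
    (hR.reach (0, u₀)).of_iff fun p => Iff.rfl, fun j u h => sound (j, u) h, complete⟩

/-- The values of an automorphism at the lines in `vanishing F r` can be enumerated. -/
theorem exists_cep_gen_vanishing {Φ : Submodule F (ℕ →₀ F) ≃o Submodule F (ℕ →₀ F)}
    (hΦ : Φ ∈ ceAut (Submodule F (ℕ →₀ F)) I) {r : ℕ} (hr : r < 3) :
    ∃ T : (ℕ →₀ F) → (ℕ →₀ F) → Prop,
      CEP I (fun p : (ℕ →₀ F) × (ℕ →₀ F) => T p.1 p.2) ∧
      (∀ v y, T v y → Φ (gen v) = gen y) ∧ ∀ v ∈ vanishing F r, ∃ y, T v y := by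
  obtain ⟨E, hE, hE', hE''⟩ := exists_cep_gen_single hΦ
  -- Each `v` is attached to a unit vector whose index is congruent to `r` and determines `v`
  -- through its code.
  let D : ℕ → (ℕ →₀ F) → Prop := fun j v => v ∈ vanishing F r ∧ j = 3 * Coded.code v + r
  have hDI : CEP I (fun p : ℕ × (ℕ →₀ F) => D p.1 p.2) :=
    (cep_mem_vanishing r).snd.and (CEP.eq (by fun_prop)
      (((Eff.const 3).nat_mul (Eff.code.comp Eff.snd')).nat_add (Eff.const r)))
  obtain ⟨T, hT, hT'⟩ := exists_transport hΦ (r := r) hDI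
    (fun j v h => ⟨by rw [h.2]; omega, h.1⟩)
    (fun j v w h h' => Coded.code_injective (by have := h.2; have := h'.2; omega))
  refine ⟨fun v y => ∃ p : ℕ × (ℕ →₀ F), D p.1 v ∧ E p.1 p.2 ∧ T p.2 y,
    CEP.ex (R := fun (s : (ℕ →₀ F) × (ℕ →₀ F)) (p : ℕ × (ℕ →₀ F)) =>
      D p.1 s.1 ∧ E p.1 p.2 ∧ T p.2 s.2)
      ((hDI.comp₂ (by fun_prop) (by fun_prop)).and ((hE.comp₂ (by fun_prop) (by fun_prop)).and
        (hT.comp₂ (by fun_prop) (by fun_prop)))), ?_, fun v hv => ?_⟩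
  · rintro v y ⟨⟨j, u⟩, h1, h2, h3⟩
    exact (hT' j v u h1 (hE' _ _ h2)).1 y h3
  · obtain ⟨u, hu⟩ := hE'' (3 * Coded.code v + r)
    obtain ⟨y, hy⟩ := (hT' _ v u ⟨hv, rfl⟩ (hE' _ _ hu)).2
    exact ⟨y, (_, u), ⟨hv, rfl⟩, hu, hy⟩

end

end SubstructureLattice

/-! ### Values at arbitrary lines by decomposition modulo 3. -/

namespace SubstructureLattice

open GenLattice

section

variable {F : Type*} [Field F]

/-- In an equation `s(a + b) + tc = s'a + t'(b + c)`, the projection `π` to the `b`-part gives `s =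
t'` and the projection `σ` to the `c`-part gives `tc = t'c`. Only `b` has to be nonzero. -/
theorem mem_span_add_add_iff {V : Type*} [AddCommGroup V] [Module F V] {π : V →ₗ[F] V}
    {a b c : V} (ha : π a = 0) (hb : π b = b) (hc : π c = 0) (hb0 : b ≠ 0) {σ : V →ₗ[F] V}
    (ha' : σ a = 0) (hb' : σ b = 0) (hc' : σ c = c) :
    (Submodule.span F {a + b} ⊔ Submodule.span F {c}) ⊓
      (Submodule.span F {a} ⊔ Submodule.span F {b + c}) = Submodule.span F {a + b + c} := by
  apply le_antisymm
  · rintro w ⟨hw, hw'⟩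
    obtain ⟨_, hs, _, ht, rfl⟩ := Submodule.mem_sup.1 hw
    obtain ⟨_, hs', _, ht', h⟩ := Submodule.mem_sup.1 hw'
    obtain ⟨s, rfl⟩ := Submodule.mem_span_singleton.1 hs
    obtain ⟨t, rfl⟩ := Submodule.mem_span_singleton.1 ht
    obtain ⟨s', rfl⟩ := Submodule.mem_span_singleton.1 hs'
    obtain ⟨t', rfl⟩ := Submodule.mem_span_singleton.1 ht'
    have h1 := congrArg π h
    have h2 := congrArg σ h
    simp only [map_add, map_smul, ha, hb, hc, ha', hb', hc', smul_zero, zero_add, add_zero] at h1 h2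
    have h3 : t' = s := smul_left_injective F hb0 h1
    rw [← h2, h3, ← smul_add]
    exact Submodule.smul_mem _ _ (Submodule.mem_span_singleton_self _)
  · rw [Submodule.span_singleton_le_iff_mem]
    refine ⟨add_mem (Submodule.mem_sup_left (Submodule.mem_span_singleton_self _))
      (Submodule.mem_sup_right (Submodule.mem_span_singleton_self _)), ?_⟩
    rw [add_assoc]
    exact add_mem (Submodule.mem_sup_left (Submodule.mem_span_singleton_self _))
      (Submodule.mem_sup_right (Submodule.mem_span_singleton_self _))

/-- The part of a sequence at the indices congruent to `r` modulo `3`. -/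
noncomputable def part (F : Type*) [Field F] (r : ℕ) : (ℕ →₀ F) →ₗ[F] ℕ →₀ F :=
  (Submodule.subtype _).comp (Finsupp.restrictDom F F {k | k % 3 = r})

theorem part_apply (r : ℕ) (v : ℕ →₀ F) (k : ℕ) :
    part F r v k = if k % 3 = r then v k else 0 := by
  classical
  simp [part, Finsupp.restrictDom_apply, Finsupp.filter_apply]

theorem part_part_self (r : ℕ) (v : ℕ →₀ F) : part F r (part F r v) = part F r v := by
  ext k
  simp only [part_apply]
  split_ifs <;> rfl

theorem part_part_of_ne {r s : ℕ} (h : r ≠ s) (v : ℕ →₀ F) : part F r (part F s v) = 0 := by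
  ext k
  simp only [part_apply, Finsupp.zero_apply]
  split_ifs <;> first | rfl | omega

theorem part_mem_vanishing {r s : ℕ} (h : r ≠ s) (v : ℕ →₀ F) : part F r v ∈ vanishing F s :=
  fun k hk => by rw [part_apply, if_neg (by omega)]

theorem part_add_part_add_part (v : ℕ →₀ F) : part F 0 v + part F 1 v + part F 2 v = v := by
  ext k
  have : k % 3 < 3 := Nat.mod_lt _ (by norm_num)
  simp only [Finsupp.add_apply, part_apply]
  generalize k % 3 = r at this
  interval_cases r <;> simp

theorem part_eq_zero_iff {r : ℕ} {v : ℕ →₀ F} : part F r v = 0 ↔ v ∈ vanishing F r := by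
  constructor
  · intro h k hk
    have := DFunLike.congr_fun h k
    rwa [part_apply, if_pos hk] at this
  · intro h
    ext k
    rw [part_apply]
    split_ifs with hk
    · exact h k hk
    · rfl

variable [EffField F] {I : TuringIdeal}

theorem eff_part (r : ℕ) : Eff I (part F r) := by
  refine Eff.vec_of_apply (b := vecLen) ?_ (by fun_prop) fun v k hk => ?_
  · refine (((CEP.eq (f := fun q : ((ℕ →₀ F) × ℕ) × F => q.1.2 % 3) (g := fun _ => r)
      (by fun_prop) (by fun_prop)).and (CEP.eq (f := fun q : ((ℕ →₀ F) × ℕ) × F => q.1.1 q.1.2)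
      (g := fun q => q.2) (by fun_prop) (by fun_prop))).or
      ((CEP.ne (f := fun q : ((ℕ →₀ F) × ℕ) × F => q.1.2 % 3) (g := fun _ => r)
      (by fun_prop) (by fun_prop)).and (CEP.eq (f := fun q : ((ℕ →₀ F) × ℕ) × F => 0)
      (g := fun q => q.2) (by fun_prop) (by fun_prop)))).of_iff fun q => ?_
    simp only [part_apply]
    by_cases h : q.1.2 % 3 = r <;> simp [h]
  · rw [part_apply, apply_eq_zero hk, ite_self]

/-- The elements of the images of lines can be enumerated. -/
theorem cep_mem_apply_gen {Φ : Submodule F (ℕ →₀ F) ≃o Submodule F (ℕ →₀ F)}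
    (hΦ : Φ ∈ ceAut (Submodule F (ℕ →₀ F)) I) :
    CEP I (fun p : (ℕ →₀ F) × (ℕ →₀ F) => p.2 ∈ Φ (gen p.1)) := by
  choose! T hT hT' hT'' using fun r (hr : r < 3) => exists_cep_gen_vanishing hΦ hr
  have lines : ∀ r < 3, CEP I (fun p : (ℕ →₀ F) × (ℕ →₀ F) =>
      p.1 ∈ vanishing F r ∧ p.2 ∈ Φ (gen p.1)) := fun r hr => by
    refine ((cep_mem_vanishing r).fst.and (CEP.ex
      (R := fun (p : (ℕ →₀ F) × (ℕ →₀ F)) (q : F × (ℕ →₀ F)) => T r p.1 q.2 ∧ q.1 • q.2 = p.2)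
      (((hT r hr).comp₂ (by fun_prop) (by fun_prop)).and
        (CEP.eq (by fun_prop) (by fun_prop))))).of_iff fun p => ?_
    refine and_congr_right fun h => ⟨fun h' => ?_, ?_⟩
    · obtain ⟨y, hy⟩ := hT'' r hr p.1 h
      rw [hT' r hr _ _ hy] at h'
      obtain ⟨c, hc⟩ := Submodule.mem_span_singleton.1 h'
      exact ⟨(c, y), hy, hc⟩
    · rintro ⟨⟨c, y⟩, hy, hc⟩
      rw [hT' r hr _ _ hy, ← hc]
      exact Submodule.smul_mem _ _ (Submodule.mem_span_singleton_self y)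
  have e0 := eff_part (F := F) (I := I) 0
  have e1 := eff_part (F := F) (I := I) 1
  have e2 := eff_part (F := F) (I := I) 2
  -- With `a`, `b`, `c` the three parts of `p.1`, each of `a + b`, `c`, `a`, `b + c` vanishes on
  -- some residue class, so its line is covered by `lines`. The quadruple `q` records two
  -- decompositions of `p.2`, one for each of the planes meeting in the line of `p.1`.
  let N : (ℕ →₀ F) × (ℕ →₀ F) → ((ℕ →₀ F) × (ℕ →₀ F)) × ((ℕ →₀ F) × (ℕ →₀ F)) → Prop :=
    fun p q => (part F 0 p.1 + part F 1 p.1 ∈ vanishing F 2 ∧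
        q.1.1 ∈ Φ (gen (part F 0 p.1 + part F 1 p.1))) ∧
      (part F 2 p.1 ∈ vanishing F 0 ∧ q.1.2 ∈ Φ (gen (part F 2 p.1))) ∧
      (part F 0 p.1 ∈ vanishing F 1 ∧ q.2.1 ∈ Φ (gen (part F 0 p.1))) ∧
      (part F 1 p.1 + part F 2 p.1 ∈ vanishing F 0 ∧
        q.2.2 ∈ Φ (gen (part F 1 p.1 + part F 2 p.1))) ∧
      q.1.1 + q.1.2 = p.2 ∧ q.2.1 + q.2.2 = p.2
  have hN : CEP I (fun s : ((ℕ →₀ F) × (ℕ →₀ F)) × (((ℕ →₀ F) × (ℕ →₀ F)) ×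
      ((ℕ →₀ F) × (ℕ →₀ F))) => N s.1 s.2) :=
    ((lines 2 (by norm_num)).comp (f := fun s : ((ℕ →₀ F) × (ℕ →₀ F)) × (((ℕ →₀ F) × (ℕ →₀ F)) ×
      ((ℕ →₀ F) × (ℕ →₀ F))) => (part F 0 s.1.1 + part F 1 s.1.1, s.2.1.1)) (by fun_prop)).and
    (((lines 0 (by norm_num)).comp (f := fun s : ((ℕ →₀ F) × (ℕ →₀ F)) × (((ℕ →₀ F) × (ℕ →₀ F)) ×
      ((ℕ →₀ F) × (ℕ →₀ F))) => (part F 2 s.1.1, s.2.1.2)) (by fun_prop)).and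
    (((lines 1 (by norm_num)).comp (f := fun s : ((ℕ →₀ F) × (ℕ →₀ F)) × (((ℕ →₀ F) × (ℕ →₀ F)) ×
      ((ℕ →₀ F) × (ℕ →₀ F))) => (part F 0 s.1.1, s.2.2.1)) (by fun_prop)).and
    (((lines 0 (by norm_num)).comp (f := fun s : ((ℕ →₀ F) × (ℕ →₀ F)) × (((ℕ →₀ F) × (ℕ →₀ F)) ×
      ((ℕ →₀ F) × (ℕ →₀ F))) => (part F 1 s.1.1 + part F 2 s.1.1, s.2.2.2)) (by fun_prop)).and
    ((CEP.eq (by fun_prop) (by fun_prop)).and (CEP.eq (by fun_prop) (by fun_prop))))))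
  refine ((lines 1 (by norm_num)).or ((CEP.ne (f := fun p : (ℕ →₀ F) × (ℕ →₀ F) => part F 1 p.1)
    (g := fun _ => 0) (by fun_prop) (by fun_prop)).and (CEP.ex hN))).of_iff fun p => ?_
  -- If the middle part is zero, the vector already lies in a space covered by `lines`.
  by_cases h : p.1 ∈ vanishing F 1
  · simp [h, part_eq_zero_iff]
  have h' : part F 1 p.1 ≠ 0 := fun h' => h (part_eq_zero_iff.1 h')
  simp only [h, h', false_and, false_or, ne_eq, not_false_eq_true, true_and]
  have key := mem_span_add_add_iff (part_part_of_ne one_ne_zero p.1) (part_part_self 1 p.1)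
    (part_part_of_ne (by norm_num : 1 ≠ 2) p.1) h' (part_part_of_ne two_ne_zero p.1)
    (part_part_of_ne (by norm_num : 2 ≠ 1) p.1) (part_part_self 2 p.1)
  rw [part_add_part_add_part] at key
  rw [gen_eq_span, ← key, map_inf, map_sup, map_sup, Submodule.mem_inf, Submodule.mem_sup,
    Submodule.mem_sup]
  constructor
  · rintro ⟨⟨u1, h1, u2, h2, h3⟩, u3, h4, u4, h5, h6⟩
    exact ⟨((u1, u2), (u3, u4)), ⟨add_mem (part_mem_vanishing (by norm_num) _)
      (part_mem_vanishing (by norm_num) _), h1⟩, ⟨part_mem_vanishing (by norm_num) _, h2⟩,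
      ⟨part_mem_vanishing (by norm_num) _, h4⟩, ⟨add_mem (part_mem_vanishing (by norm_num) _)
      (part_mem_vanishing (by norm_num) _), h5⟩, h3, h6⟩
  · rintro ⟨q, ⟨_, h1⟩, ⟨_, h2⟩, ⟨_, h4⟩, ⟨_, h5⟩, h3, h6⟩
    exact ⟨⟨_, h1, _, h2, h3⟩, _, h4, _, h5, h6⟩

/-- The values of an automorphism of the lattice of c.e. subspaces at lines can be enumerated. -/
theorem cep_apply_gen_eq {Φ : Submodule F (ℕ →₀ F) ≃o Submodule F (ℕ →₀ F)}
    (hΦ : Φ ∈ ceAut (Submodule F (ℕ →₀ F)) I) :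
    CEP I (fun p : (ℕ →₀ F) × (ℕ →₀ F) => Φ (gen p.1) = gen p.2) := by
  refine (((CEP.eq (f := fun p : (ℕ →₀ F) × (ℕ →₀ F) => p.1) (g := fun _ => 0)
    (by fun_prop) (by fun_prop)).and (CEP.eq (f := fun p : (ℕ →₀ F) × (ℕ →₀ F) => p.2)
    (g := fun _ => 0) (by fun_prop) (by fun_prop))).or
    ((CEP.ne (f := fun p : (ℕ →₀ F) × (ℕ →₀ F) => p.2) (g := fun _ => 0) (by fun_prop)
    (by fun_prop)).and (cep_mem_apply_gen hΦ))).of_iff ?_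
  rintro ⟨v, w⟩
  simp only
  -- The zero vector lies in every image without generating it; a nonzero element of the image of a
  -- line generates it.
  by_cases hw : w = 0
  · subst hw
    simp [gen_eq_span]
  · simp only [hw, and_false, false_or, ne_eq, not_false_eq_true, true_and]
    obtain ⟨y, hy⟩ := exists_gen_eq_orderIso Φ v
    rw [hy]
    constructor
    · intro h
      rw [h]
      exact mem_gen _ w
    · intro h
      exact (gen_eq_of_le (S := Submodule F (ℕ →₀ F)) (gen_le_iff.2 h)
        (by simpa [gen_eq_span] using hw)).symm

theorem cep_mem_gen_sup_gen (x y : ℕ →₀ F) :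
    CEP I (· ∈ (gen x ⊔ gen y : Submodule F (ℕ →₀ F))) := by
  refine (cep_mem_span (G := fun v => v = x ∨ v = y)
    ((CEP.eq Eff.id (Eff.const x)).or (CEP.eq Eff.id (Eff.const y)))).of_iff fun v => ?_
  rw [gen_eq_span, gen_eq_span, ← Submodule.span_union]
  rfl

end

/-! ### Permutations of the unit vectors and the equivalence for subspaces. -/

section

variable (F : Type*) [Field F]

/-- The action of the permutations of the indices on the lattice of subspaces. -/
noncomputable def permSubspace :
    Equiv.Perm ℕ →* (Submodule F (ℕ →₀ F) ≃o Submodule F (ℕ →₀ F)) where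
  toFun π := Submodule.orderIsoMapComap (Finsupp.domLCongr π : (ℕ →₀ F) ≃ₗ[F] (ℕ →₀ F))
  map_one' := by
    ext W v
    simp [Submodule.orderIsoMapComap]
    rw [show Equiv.symm (1 : Equiv.Perm ℕ) = Equiv.refl ℕ from rfl, Finsupp.equivMapDomain_refl]
  map_mul' π σ := by
    ext W v
    simp [Submodule.orderIsoMapComap]
    rw [← Finsupp.equivMapDomain_trans]
    rfl

variable {F}

theorem permSubspace_gen (π : Equiv.Perm ℕ) (v : ℕ →₀ F) :
    permSubspace F π (gen v) = gen (Finsupp.domLCongr (R := F) (M := F) π v) := by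
  simp only [permSubspace, gen_eq_span]
  exact (Submodule.map_span _ _).trans (by rw [Set.image_singleton]; rfl)

variable (F) [EffField F]

theorem permIdeal_embeds_subspace (I : TuringIdeal) :
    GroupEmbeds (permIdeal I ℕ) (ceAut (Submodule F (ℕ →₀ F)) I) := by
  refine ⟨((permSubspace F).comp (permIdeal I ℕ).subtype).codRestrict _ fun π => ?_, ?_⟩
  · have hπ : Eff I (π : Equiv.Perm ℕ) := π.2
    have hπ' : Eff I ((π : Equiv.Perm ℕ)⁻¹ : Equiv.Perm ℕ) := (π⁻¹).2
    have hf : Eff I (Finsupp.domLCongr (R := F) (M := F) (π : Equiv.Perm ℕ)) := by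
      -- Equality with the permuted sequence is checked on finitely many indices: those below the
      -- length of the source, moved by `π`, and those below the length of the target, moved back by
      -- its inverse.
      refine ((CEP.forall_lt (P := fun (p : (ℕ →₀ F) × (ℕ →₀ F)) k => p.2 (π.1 k) = p.1 k)
        (CEP.eq (by fun_prop) (by fun_prop)) (f := fun p => vecLen p.1) (by fun_prop)).and
        (CEP.forall_lt (P := fun (p : (ℕ →₀ F) × (ℕ →₀ F)) k => p.1 (π.1⁻¹ k) = p.2 k)
        (CEP.eq (by fun_prop) (by fun_prop)) (f := fun p => vecLen p.2) (by fun_prop))).of_iff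
        fun p => ?_
      constructor
      · intro h
        rw [← h]
        simp [Finsupp.domLCongr_apply, Finsupp.domCongr_apply, Finsupp.equivMapDomain_apply]
      · rintro ⟨h1, h2⟩
        ext k
        have e : Finsupp.domLCongr (R := F) (M := F) π.1 p.1 k = p.1 (π.1⁻¹ k) := by
          simp [Finsupp.domLCongr_apply, Finsupp.domCongr_apply, Finsupp.equivMapDomain_apply]
        rw [e]
        rcases lt_or_ge k (vecLen p.2) with hk | hk
        · exact h2 k hk
        · rcases lt_or_ge (π.1⁻¹ k) (vecLen p.1) with hk' | hk'
          · rw [← h1 _ hk', Equiv.Perm.inv_def, Equiv.apply_symm_apply]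
          · rw [apply_eq_zero hk, apply_eq_zero hk']
    refine mem_ceAut_of_cep ((CEP.ex (R := fun (p : (ℕ →₀ F) × (ℕ →₀ F)) (c : F × F) =>
      c.1 • p.2 = Finsupp.domLCongr (R := F) (M := F) π.1 p.1 ∧
      c.2 • Finsupp.domLCongr (R := F) (M := F) π.1 p.1 = p.2)
      ((CEP.eq (by fun_prop) (by fun_prop)).and (CEP.eq (by fun_prop) (by fun_prop)))).of_iff
      fun p => ?_)
    show permSubspace F π.1 (gen p.1) = gen p.2 ↔ _
    rw [permSubspace_gen, le_antisymm_iff, gen_le_iff, gen_le_iff, gen_eq_span, gen_eq_span,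
      Submodule.mem_span_singleton, Submodule.mem_span_singleton]
    exact ⟨fun ⟨⟨a, ha⟩, b, hb⟩ => ⟨(a, b), ha, hb⟩, fun ⟨c, h1, h2⟩ => ⟨⟨_, h1⟩, _, h2⟩⟩
  · rw [injective_iff_map_eq_one]
    intro π h
    have h1 : permSubspace F π.1 = 1 := congrArg Subtype.val h
    refine Subtype.ext (Equiv.ext fun k => ?_)
    have h2 := permSubspace_gen π.1 (Finsupp.single k (1 : F))
    rw [h1] at h2
    have h3 : Finsupp.domLCongr (R := F) (M := F) π.1 (Finsupp.single k 1) =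
        Finsupp.single (π.1 k) 1 := by simp
    have h4 : Finsupp.single k (1 : F) ∈ (gen (Finsupp.single (π.1 k) 1) :
        Submodule F (ℕ →₀ F)) := by
      rw [← h3, ← h2]
      exact mem_gen (Submodule F (ℕ →₀ F)) (Finsupp.single k 1)
    obtain ⟨c, hc⟩ := Submodule.mem_span_singleton.1 h4
    have h5 := DFunLike.congr_fun hc k
    by_contra h6
    have h7 : π.1 k ≠ k := h6
    simp [h7] at h5

end

theorem groupEmbeds_subspaceLattice_iff {F : Type*} [Field F] (C : ComputableField F)
    (I J : TuringIdeal) : GroupEmbeds (SubspaceLattice C I ≃o SubspaceLattice C I)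
      (SubspaceLattice C J ≃o SubspaceLattice C J) ↔ (I : Set Degree) ⊆ J := by
  let _ := C.effField
  exact groupEmbeds_aut_iff (S := Submodule F (ℕ →₀ F)) (I := I) (J := J)
    (fun _ _ => cep_iff_ceIn.symm)
    (fun _ => cep_mem_gen_sup_gen) (fun _ _ => cep_apply_gen_eq) (permIdeal_embeds_subspace F)

end SubstructureLattice

namespace SubstructureLattice

open Coded

/-! ### Effectiveness of the arithmetic of the rationals -/

instance : Coded ℚ where
  code := ratCode
  code_injective := ratCode_injective
  sig1_range _ := Sig1.of_primrecPred primrecPred_mem_range_ratCode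

section

variable {I : TuringIdeal} {X : Type*} [Coded X]

theorem eff_unpair_fst : Eff I (fun n : ℕ => n.unpair.1) :=
  Eff.of_computable (Computable.fst.comp Primrec.unpair.to_comp)

theorem eff_unpair_snd : Eff I (fun n : ℕ => n.unpair.2) :=
  Eff.of_computable (Computable.snd.comp Primrec.unpair.to_comp)

theorem eff_rat_den : Eff I (fun q : ℚ => q.den) :=
  (eff_unpair_snd.comp Eff.code).of_eq fun q => by
    show (ratCode q).unpair.2 = _
    rw [ratCode, Nat.unpair_pair]

theorem eff_rat_natAbs : Eff I (fun q : ℚ => q.num.natAbs) :=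
  ((eff_unpair_fst.comp Eff.code).nat_div (Eff.const 2)).of_eq fun q => by
    show (ratCode q).unpair.1 / 2 = _
    rw [ratCode, Nat.unpair_pair]
    simp only
    split_ifs <;> omega

theorem eff_rat_sign : Eff I (fun q : ℚ => if q.num < 0 then 1 else 0) :=
  ((eff_unpair_fst.comp Eff.code).nat_mod (Eff.const 2)).of_eq fun q => by
    show (ratCode q).unpair.1 % 2 = _
    rw [ratCode, Nat.unpair_pair]
    simp only
    split_ifs <;> omega

/-- The rational number `(a - b) / (c + 1)`. -/
def ratOf (n : ℕ × ℕ × ℕ) : ℚ := ((n.1 : ℚ) - n.2.1) / (n.2.2 + 1)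

/-- Cross-multiplication, with terms moved so that only natural numbers occur; the first clause in
each case is the sign digit of the code of `q`. -/
theorem ratOf_eq_iff (n : ℕ × ℕ × ℕ) (q : ℚ) : ratOf n = q ↔
    ((if q.num < 0 then 1 else 0) = 0 ∧
      n.1 * q.den = q.num.natAbs * (n.2.2 + 1) + n.2.1 * q.den) ∨
    ((if q.num < 0 then 1 else 0) = 1 ∧
      n.1 * q.den + q.num.natAbs * (n.2.2 + 1) = n.2.1 * q.den) := by
  have h1 : ratOf n = q ↔ ((n.1 : ℤ) - n.2.1) * q.den = q.num * (n.2.2 + 1) := by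
    have hd : (q.den : ℚ) ≠ 0 := Nat.cast_ne_zero.2 q.den_nz
    have hc : ((n.2.2 : ℚ) + 1) ≠ 0 := by positivity
    rw [ratOf]
    conv_lhs => rw [← Rat.num_div_den q]
    rw [div_eq_div_iff hc hd]
    exact_mod_cast Iff.rfl
  rw [h1]
  by_cases hq : q.num < 0
  · have h2 : (q.num.natAbs : ℤ) = -q.num := by omega
    simp only [hq, if_true, one_ne_zero, false_and, false_or, true_and]
    zify
    rw [← Int.natCast_natAbs, h2]
    constructor <;> intro h <;> linarith
  · have h2 : (q.num.natAbs : ℤ) = q.num := by omega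
    simp only [hq, if_false, zero_ne_one, false_and, or_false, true_and]
    zify
    rw [← Int.natCast_natAbs, h2]
    constructor <;> intro h <;> linarith

theorem exists_ratOf_eq (q : ℚ) : ∃ n, ratOf n = q := by
  have hd : q.den - 1 + 1 = q.den := Nat.sub_add_cancel q.pos
  by_cases hq : q.num < 0
  · refine ⟨(0, q.num.natAbs, q.den - 1), (ratOf_eq_iff _ _).2 (Or.inr ?_)⟩
    simp [hq, hd]
  · refine ⟨(q.num.natAbs, 0, q.den - 1), (ratOf_eq_iff _ _).2 (Or.inl ?_)⟩
    simp [hq, hd]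

theorem eff_ratOf : Eff I ratOf := by
  have h1 := eff_rat_den (I := I)
  have h2 := eff_rat_natAbs (I := I)
  have h3 := eff_rat_sign (I := I)
  refine CEP.of_iff (((CEP.eq (f := fun p : (ℕ × ℕ × ℕ) × ℚ => if p.2.num < 0 then 1 else 0)
    (g := fun _ => 0) (h3.comp Eff.snd') (by fun_prop)).and (CEP.eq ?_ ?_)).or
    ((CEP.eq (f := fun p : (ℕ × ℕ × ℕ) × ℚ => if p.2.num < 0 then 1 else 0)
    (g := fun _ => 1) (h3.comp Eff.snd') (by fun_prop)).and (CEP.eq ?_ ?_)))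
    fun p => ratOf_eq_iff _ _
  · exact (by fun_prop : Eff I fun p : (ℕ × ℕ × ℕ) × ℚ => p.1.1).nat_mul (h1.comp Eff.snd')
  · exact ((h2.comp Eff.snd').nat_mul (by fun_prop)).nat_add
      ((by fun_prop : Eff I fun p : (ℕ × ℕ × ℕ) × ℚ => p.1.2.1).nat_mul (h1.comp Eff.snd'))
  · exact ((by fun_prop : Eff I fun p : (ℕ × ℕ × ℕ) × ℚ => p.1.1).nat_mul
      (h1.comp Eff.snd')).nat_add ((h2.comp Eff.snd').nat_mul (by fun_prop))
  · exact (by fun_prop : Eff I fun p : (ℕ × ℕ × ℕ) × ℚ => p.1.2.1).nat_mul (h1.comp Eff.snd')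

/-- Representatives of the arguments are found by search. Since `f` is a function on the rationals,
any choice gives the same result. -/
theorem eff_rat_lift₂ {f : ℚ → ℚ → ℚ} {g : (ℕ × ℕ × ℕ) × (ℕ × ℕ × ℕ) → ℕ × ℕ × ℕ} (hg : Eff I g)
    (h : ∀ n m, f (ratOf n) (ratOf m) = ratOf (g (n, m))) :
    Eff I (fun p : ℚ × ℚ => f p.1 p.2) := by
  have hr := eff_ratOf (I := I)
  refine (CEP.ex (R := fun (p : (ℚ × ℚ) × ℚ) (n : (ℕ × ℕ × ℕ) × (ℕ × ℕ × ℕ)) =>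
    ratOf n.1 = p.1.1 ∧ ratOf n.2 = p.1.2 ∧ ratOf (g n) = p.2)
    ((CEP.eq (by fun_prop) (by fun_prop)).and ((CEP.eq (by fun_prop) (by fun_prop)).and
      (CEP.eq (by fun_prop) (by fun_prop))))).of_iff ?_
  rintro ⟨⟨p, q⟩, r⟩
  constructor
  · intro h'
    obtain ⟨n, rfl⟩ := exists_ratOf_eq p
    obtain ⟨m, rfl⟩ := exists_ratOf_eq q
    exact ⟨(n, m), rfl, rfl, (h n m).symm.trans h'⟩
  · rintro ⟨⟨n, m⟩, rfl, rfl, h'⟩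
    exact (h n m).trans h'

namespace Eff

@[fun_prop]
theorem rat_add {f g : X → ℚ} (hf : Eff I f) (hg : Eff I g) : Eff I (fun x => f x + g x) := by
  -- Denominators are stored minus one, so the last component is the product of the two denominators
  -- minus one.
  refine Eff.comp (eff_rat_lift₂ (f := fun p q => p + q) (g := fun n =>
    (n.1.1 * (n.2.2.2 + 1) + n.2.1 * (n.1.2.2 + 1),
      n.1.2.1 * (n.2.2.2 + 1) + n.2.2.1 * (n.1.2.2 + 1),
      n.1.2.2 * n.2.2.2 + n.1.2.2 + n.2.2.2)) (by fun_prop) fun n m => ?_) (hf.prodMk hg)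
  have h1 : ((n.2.2 : ℚ) + 1) ≠ 0 := by positivity
  have h2 : ((m.2.2 : ℚ) + 1) ≠ 0 := by positivity
  have h3 : ((n.2.2 : ℚ) * m.2.2 + n.2.2 + m.2.2 + 1) = (n.2.2 + 1) * (m.2.2 + 1) := by ring
  simp only [ratOf]
  push_cast
  rw [h3]
  field_simp
  ring

@[fun_prop]
theorem rat_mul {f g : X → ℚ} (hf : Eff I f) (hg : Eff I g) : Eff I (fun x => f x * g x) := by
  refine Eff.comp (eff_rat_lift₂ (f := fun p q => p * q) (g := fun n =>
    (n.1.1 * n.2.1 + n.1.2.1 * n.2.2.1, n.1.1 * n.2.2.1 + n.1.2.1 * n.2.1,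
      n.1.2.2 * n.2.2.2 + n.1.2.2 + n.2.2.2)) (by fun_prop) fun n m => ?_) (hf.prodMk hg)
  have h1 : ((n.2.2 : ℚ) + 1) ≠ 0 := by positivity
  have h2 : ((m.2.2 : ℚ) + 1) ≠ 0 := by positivity
  have h3 : ((n.2.2 : ℚ) * m.2.2 + n.2.2 + m.2.2 + 1) = (n.2.2 + 1) * (m.2.2 + 1) := by ring
  simp only [ratOf]
  push_cast
  rw [h3]
  field_simp
  ring

@[fun_prop]
theorem rat_sub {f g : X → ℚ} (hf : Eff I f) (hg : Eff I g) : Eff I (fun x => f x - g x) := by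
  refine Eff.comp (f := fun p : ℚ × ℚ => p.1 - p.2) ?_ (hf.prodMk hg)
  exact (CEP.eq (f := fun p : (ℚ × ℚ) × ℚ => p.1.1) (g := fun p => p.2 + p.1.2) (by fun_prop)
    (by fun_prop)).of_iff fun p => sub_eq_iff_eq_add

@[fun_prop]
theorem rat_neg {f : X → ℚ} (hf : Eff I f) : Eff I (fun x => - f x) :=
  ((Eff.const 0).rat_sub hf).of_eq fun _ => zero_sub _

@[fun_prop]
theorem rat_inv {f : X → ℚ} (hf : Eff I f) : Eff I (fun x => (f x)⁻¹) := by
  refine Eff.comp (f := fun p : ℚ => p⁻¹) ?_ hf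
  refine ((CEP.eq (f := fun p : ℚ × ℚ => p.1 * p.2) (g := fun _ => 1) (by fun_prop)
    (by fun_prop)).or ((CEP.eq (f := fun p : ℚ × ℚ => p.1) (g := fun _ => 0) (by fun_prop)
    (by fun_prop)).and (CEP.eq (f := fun p : ℚ × ℚ => p.2) (g := fun _ => 0) (by fun_prop)
    (by fun_prop)))).of_iff ?_
  rintro ⟨p, q⟩
  by_cases hp : p = 0
  · simp [hp, eq_comm]
  · simp only [hp, false_and, or_false]
    exact ⟨fun h => by rw [← h, mul_inv_cancel₀ hp], fun h => inv_eq_of_mul_eq_one_right h⟩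

@[fun_prop]
theorem rat_div {f g : X → ℚ} (hf : Eff I f) (hg : Eff I g) : Eff I (fun x => f x / g x) :=
  (hf.rat_mul hg.rat_inv).of_eq fun _ => (div_eq_mul_inv _ _).symm

@[fun_prop]
theorem rat_natCast {f : X → ℕ} (hf : Eff I f) : Eff I (fun x => (f x : ℚ)) :=
  ((eff_ratOf (I := I)).comp (hf.prodMk ((Eff.const 0).prodMk (Eff.const 0)))).of_eq fun x => by
    simp [ratOf]

end Eff

/-- A rational is positive exactly if it is `(m + 1) / (n + 1)` for some natural numbers `m` and
`n`. -/
theorem CEP.rat_lt {f g : X → ℚ} (hf : Eff I f) (hg : Eff I g) : CEP I (fun x => f x < g x) := by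
  refine (CEP.ex (R := fun x (n : ℕ × ℕ) => g x - f x = ((n.1 : ℚ) + 1) / (n.2 + 1))
    (CEP.eq (by fun_prop) (by fun_prop))).of_iff fun x => ?_
  constructor
  · intro h
    have h1 : 0 < g x - f x := sub_pos.2 h
    generalize g x - f x = q at h1
    have h2 : 0 < q.num := Rat.num_pos.2 h1
    refine ⟨(q.num.natAbs - 1, q.den - 1), ?_⟩
    have h3 : q.num.natAbs - 1 + 1 = q.num.natAbs := by omega
    have h4 : q.den - 1 + 1 = q.den := Nat.sub_add_cancel q.pos
    have h5 : (q.num.natAbs : ℚ) = q.num := by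
      have : (q.num.natAbs : ℤ) = q.num := by omega
      rw [← this, Int.cast_natCast, Int.natAbs_natCast]
    have h6 : ((q.num.natAbs - 1 : ℕ) : ℚ) + 1 = q.num := by
      rw [← h5]; exact_mod_cast congrArg (Nat.cast (R := ℚ)) h3
    have h7 : ((q.den - 1 : ℕ) : ℚ) + 1 = q.den := by exact_mod_cast congrArg (Nat.cast (R := ℚ)) h4
    simp only [h6, h7, Rat.num_div_den]
  · rintro ⟨n, h⟩
    rw [← sub_pos, h]
    positivity

theorem CEP.rat_le {f g : X → ℚ} (hf : Eff I f) (hg : Eff I g) : CEP I (fun x => f x ≤ g x) :=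
  ((CEP.rat_lt hf hg).or (CEP.eq hf hg)).of_iff fun _ => le_iff_lt_or_eq

end

end SubstructureLattice

namespace SubstructureLattice

open Coded
open scoped symmDiff

/-! ### Jumps and symmetric differences in the interval algebra -/

noncomputable instance : Coded Beta where
  code := betaCode
  code_injective := betaCode_injective
  sig1_range _ := Sig1.of_primrecPred primrecPred_mem_range_betaCode

theorem beta_ext {b c : Beta} (h : ∀ x, x ∈ b.1 ↔ x ∈ c.1) : b = c := Subtype.ext (Set.ext h)

@[simp] theorem mem_beta_bot (x : ℚ) : x ∈ (⊥ : Beta).1 ↔ False := Iff.rfl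

@[simp] theorem mem_beta_top (x : ℚ) : x ∈ (⊤ : Beta).1 ↔ True := Iff.rfl

@[simp] theorem mem_beta_compl (b : Beta) (x : ℚ) : x ∈ (bᶜ).1 ↔ x ∉ b.1 := Iff.rfl

@[simp] theorem mem_beta_symmDiff (b c : Beta) (x : ℚ) :
    x ∈ (b ∆ c).1 ↔ ¬ (x ∈ b.1 ↔ x ∈ c.1) := by
  have : x ∈ (b ∆ c).1 ↔ (x ∈ b.1 ∧ x ∉ c.1) ∨ (x ∈ c.1 ∧ x ∉ b.1) := Iff.rfl
  rw [this]
  tauto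

theorem beta_eq_bot {b : Beta} (h : ∀ x, x ∉ b.1) : b = ⊥ := beta_ext fun x => by simp [h x]

theorem beta_eq_top {b : Beta} (h : ∀ x, x ∈ b.1) : b = ⊤ := beta_ext fun x => by simp [h x]

/-- The rationals that are at least `q`. -/
def ray (q : ℚ) : Beta := ⟨Set.Ici q, Ici_mem_intervalAlgebra q⟩

@[simp] theorem mem_ray (q x : ℚ) : x ∈ (ray q).1 ↔ q ≤ x := Iff.rfl

/-- The set of the jumps of an element of the interval algebra. -/
noncomputable def jumps (b : Beta) : Finset ℚ := (jumpEquiv.symm b).2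

theorem jumpEquiv_insert {e : Bool} {S : Finset ℚ} {q : ℚ} (hq : q ∉ S) :
    jumpEquiv (e, insert q S) = jumpEquiv (e, S) ∆ ray q := beta_ext fun x => by
  rw [mem_beta_symmDiff, mem_ray, jumpEquiv_coe, jumpEquiv_coe]
  rcases le_or_gt q x with h | h
  · rw [jumpSet_insert_of_le hq h]; tauto
  · rw [jumpSet_insert_of_lt h]; simp [not_le.2 h]

theorem symmDiff_ray_of_notMem {b : Beta} {q : ℚ} (hq : q ∉ jumps b) :
    jumpEquiv.symm (b ∆ ray q) = ((jumpEquiv.symm b).1, insert q (jumps b)) := by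
  rw [Equiv.symm_apply_eq, jumpEquiv_insert hq]
  exact congrArg (· ∆ ray q) (jumpEquiv.apply_symm_apply b).symm

theorem symmDiff_ray_of_mem {b : Beta} {q : ℚ} (hq : q ∈ jumps b) :
    jumpEquiv.symm (b ∆ ray q) = ((jumpEquiv.symm b).1, (jumps b).erase q) := by
  have h := jumpEquiv_insert (e := (jumpEquiv.symm b).1) (Finset.notMem_erase q (jumps b))
  rw [Finset.insert_erase hq] at h
  have h' : b = jumpEquiv ((jumpEquiv.symm b).1, (jumps b).erase q) ∆ ray q :=
    (jumpEquiv.apply_symm_apply b).symm.trans h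
  rw [Equiv.symm_apply_eq]
  conv_lhs => rw [h']
  rw [symmDiff_symmDiff_cancel_right]

theorem mem_jumps_symmDiff_ray {b : Beta} {q r : ℚ} :
    r ∈ jumps (b ∆ ray q) ↔ ¬ (r ∈ jumps b ↔ r = q) := by
  by_cases hq : q ∈ jumps b
  · rw [jumps, symmDiff_ray_of_mem hq, Finset.mem_erase]
    by_cases h : r = q
    · subst h; simp [hq]
    · simp [h]
  · rw [jumps, symmDiff_ray_of_notMem hq, Finset.mem_insert]
    by_cases h : r = q
    · subst h; simp [hq]
    · simp [h]

theorem jumpEquiv_empty (e : Bool) : jumpEquiv (e, ∅) = if e then ⊤ else ⊥ := beta_ext fun x => by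
  rw [jumpEquiv_coe]
  cases e <;> simp [jumpSet]

theorem jumps_bot : jumps ⊥ = ∅ := by
  have := jumpEquiv_empty false
  simp only [Bool.false_eq_true, if_false] at this
  rw [jumps, ← this, Equiv.symm_apply_apply]

theorem jumps_top : jumps ⊤ = ∅ := by
  have := jumpEquiv_empty true
  simp only [if_true] at this
  rw [jumps, ← this, Equiv.symm_apply_apply]

theorem jumpEquiv_not (e : Bool) (S : Finset ℚ) : jumpEquiv (!e, S) = (jumpEquiv (e, S))ᶜ :=
  beta_ext fun x => by
    rw [mem_beta_compl, jumpEquiv_coe, jumpEquiv_coe]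
    cases e <;> simp [jumpSet]

theorem symm_compl (b : Beta) :
    jumpEquiv.symm bᶜ = (!(jumpEquiv.symm b).1, (jumpEquiv.symm b).2) := by
  rw [Equiv.symm_apply_eq, jumpEquiv_not, Prod.mk.eta, Equiv.apply_symm_apply]

/-- Up to complement, the algebra is generated by rays under symmetric difference alone.
Computations in it therefore become reachability by toggling rays. -/
theorem beta_induction {P : Beta → Prop} (bot : P ⊥) (top : P ⊤)
    (ray : ∀ b q, P b → P (b ∆ ray q)) (b : Beta) : P b := by
  obtain ⟨⟨e, S⟩, rfl⟩ := jumpEquiv.surjective b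
  induction S using Finset.induction_on with
  | empty =>
    rw [jumpEquiv_empty]
    cases e
    · exact bot
    · exact top
  | insert q S hq ih =>
    rw [jumpEquiv_insert hq]
    exact ray _ _ ih

theorem jumps_compl (b : Beta) : jumps bᶜ = jumps b := by rw [jumps, symm_compl]; rfl

theorem mem_jumps_symmDiff {b c : Beta} {r : ℚ} :
    r ∈ jumps (b ∆ c) ↔ ¬ (r ∈ jumps b ↔ r ∈ jumps c) := by
  induction c using beta_induction with
  | bot => simp [jumps_bot]
  | top => simp [jumps_top, jumps_compl]
  | ray c q ih =>
    rw [← symmDiff_assoc, mem_jumps_symmDiff_ray, mem_jumps_symmDiff_ray, ih]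
    tauto

@[simp] theorem mem_jumps_ray {q r : ℚ} : r ∈ jumps (ray q) ↔ r = q := by
  have := mem_jumps_symmDiff_ray (b := ⊥) (q := q) (r := r)
  rw [bot_symmDiff] at this
  simpa [jumps_bot] using this

theorem mem_iff_mem_of_no_jumps {b : Beta} {x y : ℚ} (hxy : x ≤ y)
    (h : ∀ q ∈ jumps b, x < q → y < q) : x ∈ b.1 ↔ y ∈ b.1 := by
  have e : b = jumpEquiv ((jumpEquiv.symm b).1, jumps b) := (jumpEquiv.apply_symm_apply b).symm
  have : (jumps b).filter (· ≤ x) = (jumps b).filter (· ≤ y) :=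
    Finset.filter_congr fun q hq => ⟨fun h' => h'.trans hxy, fun h' => by
      by_contra h''
      exact absurd (h q hq (not_le.1 h'')) (not_lt.2 h')⟩
  rw [e, jumpEquiv_coe]
  simp only [jumpSet, Set.mem_ofPred_eq, this]

/-- Continuity from the right holds at every point, because the generating intervals are closed on
the left. Continuity from the left, in `exists_lt_mem_iff`, needs the absence of a jump. -/
theorem exists_gt_mem_iff (b : Beta) (x : ℚ) :
    ∃ y, x < y ∧ ∀ z, x ≤ z → z < y → (x ∈ b.1 ↔ z ∈ b.1) := by
  obtain ⟨y, hy, h⟩ : ∃ y, x < y ∧ ∀ q ∈ jumps b, x < q → y ≤ q := by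
    rcases ((jumps b).filter (x < ·)).eq_empty_or_nonempty with h0 | hne
    · refine ⟨x + 1, by linarith, fun q hq hxq => ?_⟩
      have := Finset.filter_eq_empty_iff.1 h0 hq
      exact absurd hxq this
    · refine ⟨((jumps b).filter (x < ·)).min' hne, ?_, fun q hq hxq => ?_⟩
      · exact (Finset.mem_filter.1 (Finset.min'_mem _ hne)).2
      · exact Finset.min'_le _ _ (Finset.mem_filter.2 ⟨hq, hxq⟩)
  exact ⟨y, hy, fun z hz hzy => mem_iff_mem_of_no_jumps hz fun q hq hxq =>
    hzy.trans_le (h q hq hxq)⟩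

theorem exists_lt_mem_iff (b : Beta) {x : ℚ} (hx : x ∉ jumps b) :
    ∃ y, y < x ∧ ∀ z, y ≤ z → z ≤ x → (z ∈ b.1 ↔ x ∈ b.1) := by
  obtain ⟨y, hy, h⟩ : ∃ y, y < x ∧ ∀ q ∈ jumps b, q < x → q ≤ y := by
    rcases ((jumps b).filter (· < x)).eq_empty_or_nonempty with h0 | hne
    · refine ⟨x - 1, by linarith, fun q hq hxq => ?_⟩
      have := Finset.filter_eq_empty_iff.1 h0 hq
      exact absurd hxq this
    · refine ⟨((jumps b).filter (· < x)).max' hne, ?_, fun q hq hxq => ?_⟩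
      · exact (Finset.mem_filter.1 (Finset.max'_mem _ hne)).2
      · exact Finset.le_max' _ _ (Finset.mem_filter.2 ⟨hq, hxq⟩)
  refine ⟨y, hy, fun z hz hzy => mem_iff_mem_of_no_jumps hzy fun q hq hxq => ?_⟩
  by_contra h'
  rcases lt_or_eq_of_le (not_lt.1 h') with h1 | rfl
  · have := h q hq h1
    linarith
  · exact hx hq

/-! ### Effectiveness of the operations of the interval algebra -/

section

variable {I : TuringIdeal} {X : Type*} [Coded X]

theorem betaCode_eq (b : Beta) :
    betaCode b = 2 * (∑ q ∈ jumps b, 2 ^ ratCode q) + (jumpEquiv.symm b).1.toNat := rfl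

theorem bit_betaCode (b : Beta) (q : ℚ) :
    betaCode b / 2 / 2 ^ ratCode q % 2 = 1 ↔ q ∈ jumps b := by
  have h1 : betaCode b / 2 = ∑ q ∈ jumps b, 2 ^ ratCode q := by
    have : (jumpEquiv.symm b).1.toNat ≤ 1 := Bool.toNat_le _
    rw [betaCode_eq]
    omega
  have h2 := testBit_sum (jumps b) (ratCode q)
  rw [Nat.testBit_eq_decide_div_mod_eq, decide_eq_true_iff] at h2
  rw [h1, h2]
  exact ⟨fun ⟨r, hr, h⟩ => ratCode_injective h ▸ hr, fun h => ⟨q, h, rfl⟩⟩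

/-- Adding a ray toggles one binary digit of the code; the factor `2` skips the last digit, which
records the behaviour near minus infinity. -/
theorem betaCode_symmDiff_ray (b : Beta) (q : ℚ) : betaCode (b ∆ ray q) =
    if betaCode b / 2 / 2 ^ ratCode q % 2 = 1 then betaCode b - 2 * 2 ^ ratCode q
    else betaCode b + 2 * 2 ^ ratCode q := by
  by_cases hq : q ∈ jumps b
  · rw [if_pos ((bit_betaCode b q).2 hq), betaCode, symmDiff_ray_of_mem hq, betaCode_eq,
      ← Finset.add_sum_erase _ _ hq]
    simp only
    omega
  · rw [if_neg ((bit_betaCode b q).not.2 hq), betaCode, symmDiff_ray_of_notMem hq, betaCode_eq,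
      Finset.sum_insert hq]
    simp only
    omega

theorem betaCode_compl (b : Beta) : betaCode bᶜ =
    if betaCode b % 2 = 1 then betaCode b - 1 else betaCode b + 1 := by
  rw [betaCode, symm_compl, betaCode_eq]
  have : (jumpEquiv.symm b).2 = jumps b := rfl
  rw [this]
  cases (jumpEquiv.symm b).1
  · simp
  · simp

namespace Eff

theorem beta_symmDiff_ray {f : X → Beta} {g : X → ℚ} (hf : Eff I f) (hg : Eff I g) :
    Eff I (fun x => f x ∆ ray (g x)) := by
  refine Eff.comp (f := fun p : Beta × ℚ => p.1 ∆ ray p.2) ?_ (hf.prodMk hg)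
  have pow2 : Primrec fun k : ℕ => 2 ^ k :=
    (Primrec₂.unpaired'.1 Nat.Primrec.pow).comp (.const 2) .id
  have h1 : Primrec fun p : ℕ × ℕ => 2 ^ p.2 := pow2.comp .snd
  have h2 : Primrec fun p : ℕ × ℕ => 2 * 2 ^ p.2 := Primrec.nat_mul.comp (.const 2) h1
  have h : Primrec₂ fun n k : ℕ => if n / 2 / 2 ^ k % 2 = 1 then n - 2 * 2 ^ k
      else n + 2 * 2 ^ k :=
    Primrec.ite (Primrec.eq.comp (Primrec.nat_mod.comp (Primrec.nat_div.comp
      (Primrec.nat_div.comp .fst (.const 2)) h1) (.const 2)) (.const 1))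
      (Primrec.nat_sub.comp .fst h2) (Primrec.nat_add.comp .fst h2)
  exact Eff.of_code (((Eff.of_primrec₂ h).comp (g := fun p : Beta × ℚ =>
    (Coded.code p.1, Coded.code p.2)) ((Eff.code.comp Eff.fst').prodMk
    (Eff.code.comp Eff.snd'))).of_eq fun p => (betaCode_symmDiff_ray _ _).symm)

@[fun_prop]
theorem beta_compl {f : X → Beta} (hf : Eff I f) : Eff I (fun x => (f x)ᶜ) := by
  refine Eff.comp (f := fun b : Beta => bᶜ) ?_ hf
  have h : Primrec fun n : ℕ => if n % 2 = 1 then n - 1 else n + 1 :=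
    Primrec.ite (Primrec.eq.comp (Primrec.nat_mod.comp .id (.const 2)) (.const 1))
      (Primrec.nat_sub.comp .id (.const 1)) (Primrec.nat_add.comp .id (.const 1))
  exact Eff.of_code (((Eff.of_computable h.to_comp).comp Eff.code).of_eq
    fun b => (betaCode_compl b).symm)

@[fun_prop]
theorem beta_ray {f : X → ℚ} (hf : Eff I f) : Eff I (fun x => ray (f x)) :=
  (beta_symmDiff_ray (Eff.const ⊥) hf).of_eq fun _ => bot_symmDiff _

@[fun_prop]
theorem beta_symmDiff {f g : X → Beta} (hf : Eff I f) (hg : Eff I g) :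
    Eff I (fun x => f x ∆ g x) := by
  refine Eff.comp (f := fun p : Beta × Beta => p.1 ∆ p.2) ?_ (hf.prodMk hg)
  -- A step adds the same ray to both components or complements both. From `(⊥, b)` this reaches
  -- exactly the pairs `(c, b ∆ c)`.
  let R : Beta × Beta → Beta × Beta → Prop := fun p p' =>
    (∃ q, p' = (p.1 ∆ ray q, p.2 ∆ ray q)) ∨ p' = (p.1ᶜ, p.2ᶜ)
  have hR : CEP I (fun s : (Beta × Beta) × (Beta × Beta) => R s.1 s.2) :=
    (CEP.ex (R := fun (s : (Beta × Beta) × (Beta × Beta)) (q : ℚ) =>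
      s.2 = (s.1.1 ∆ ray q, s.1.2 ∆ ray q)) (CEP.eq (by fun_prop)
      ((beta_symmDiff_ray (by fun_prop) (by fun_prop)).prodMk
        (beta_symmDiff_ray (by fun_prop) (by fun_prop))))).or
      (CEP.eq (by fun_prop) (by fun_prop))
  refine (hR.reflTransGen.comp (f := fun s : (Beta × Beta) × Beta =>
    (((⊥ : Beta), s.1.1), (s.1.2, s.2))) (by fun_prop)).of_iff ?_
  rintro ⟨⟨b, c⟩, d⟩
  simp only
  constructor
  · rintro rfl
    induction c using beta_induction with
    | bot =>
      rw [symmDiff_bot]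
    | top =>
      refine .single (Or.inr ?_)
      simp
    | ray c q ih =>
      refine ih.tail (Or.inl ⟨q, ?_⟩)
      rw [symmDiff_assoc]
  · intro h
    have key : ∀ p, Relation.ReflTransGen R (⊥, b) p → b ∆ p.1 = p.2 := fun p hp => by
      induction hp with
      | refl => exact symmDiff_bot _
      | tail _ h ih =>
        rcases h with ⟨q, rfl⟩ | rfl
        · rw [← symmDiff_assoc, ih]
        · rw [← ih]
          exact beta_ext fun x => by simp only [mem_beta_symmDiff, mem_beta_compl]; tauto
    exact key _ h

end Eff

end

end SubstructureLattice

namespace SubstructureLattice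

open GenLattice
open scoped symmDiff

/-! ### The lattice of subalgebras -/

/-- The subalgebra generated by one element of a Boolean algebra. -/
def oneGenerated {B : Type*} [BooleanAlgebra B] (b : B) : BooleanSubalgebra B where
  carrier := {x | x = ⊥ ∨ x = ⊤ ∨ x = b ∨ x = bᶜ}
  supClosed' := by
    rintro _ (rfl | rfl | rfl | rfl) _ (rfl | rfl | rfl | rfl) <;> simp
  infClosed' := by
    rintro _ (rfl | rfl | rfl | rfl) _ (rfl | rfl | rfl | rfl) <;> simp
  compl_mem' := by
    rintro _ (rfl | rfl | rfl | rfl) <;> simp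
  bot_mem' := Or.inl rfl

theorem mem_oneGenerated {B : Type*} [BooleanAlgebra B] {b x : B} :
    x ∈ oneGenerated b ↔ x = ⊥ ∨ x = ⊤ ∨ x = b ∨ x = bᶜ := Iff.rfl

theorem oneGenerated_le_iff {B : Type*} [BooleanAlgebra B] {b : B} {W : BooleanSubalgebra B} :
    oneGenerated b ≤ W ↔ b ∈ W := by
  refine ⟨fun h => h (Or.inr (Or.inr (Or.inl rfl))), fun h => ?_⟩
  rintro _ (rfl | rfl | rfl | rfl)
  · exact W.bot_mem
  · exact BooleanSubalgebra.top_mem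
  · exact h
  · exact W.compl_mem h

instance {B : Type*} [BooleanAlgebra B] : GenLattice (BooleanSubalgebra B) B where
  gen := oneGenerated
  gen_le_iff := oneGenerated_le_iff
  le_iff := SetLike.le_def
  gen_eq_of_le := by
    intro x y h h0
    rcases mem_oneGenerated.1 (oneGenerated_le_iff.1 h) with rfl | rfl | rfl | rfl
    · exact absurd (le_bot_iff.1 (oneGenerated_le_iff.2 (BooleanSubalgebra.bot_mem))) h0
    · exact absurd (le_bot_iff.1 (oneGenerated_le_iff.2 (BooleanSubalgebra.top_mem))) h0
    · rfl
    · refine le_antisymm h (oneGenerated_le_iff.2 ?_)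
      rw [← BooleanSubalgebra.compl_mem_iff]
      exact oneGenerated_le_iff.1 le_rfl
  exists_gen_eq_bot := ⟨⊥, le_bot_iff.1 (oneGenerated_le_iff.2 BooleanSubalgebra.bot_mem)⟩
  exists_coe_eq := by
    intro T hT h
    refine ⟨{ carrier := T, supClosed' := ?_, infClosed' := ?_, compl_mem' := ?_,
              bot_mem' := ?_ }, rfl⟩
    · intro x hx y hy
      exact h x hx y hy _ (BooleanSubalgebra.sup_mem
        (oneGenerated_le_iff.1 le_sup_left) (oneGenerated_le_iff.1 le_sup_right))
    · intro x hx y hy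
      exact h x hx y hy _ (BooleanSubalgebra.inf_mem
        (oneGenerated_le_iff.1 le_sup_left) (oneGenerated_le_iff.1 le_sup_right))
    · intro x hx
      exact h x hx x hx _ (BooleanSubalgebra.compl_mem (oneGenerated_le_iff.1 le_sup_left))
    · obtain ⟨x, hx⟩ := hT
      exact h x hx x hx _ BooleanSubalgebra.bot_mem

/-! ### One-generated subalgebras and symmetric differences. -/

section

variable {B : Type*} [BooleanAlgebra B]

theorem mem_gen_iff {b x : B} :
    x ∈ (gen b : BooleanSubalgebra B) ↔ x = ⊥ ∨ x = ⊤ ∨ x = b ∨ x = bᶜ := Iff.rfl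

theorem gen_compl (b : B) : (gen bᶜ : BooleanSubalgebra B) = gen b := by
  refine le_antisymm (gen_le_iff.2 (mem_gen_iff.2 ?_)) (gen_le_iff.2 (mem_gen_iff.2 ?_)) <;> simp

theorem gen_eq_bot_iff {b : B} : (gen b : BooleanSubalgebra B) = ⊥ ↔ b = ⊥ ∨ b = ⊤ := by
  rw [← le_bot_iff, gen_le_iff]
  rfl

theorem gen_eq_gen_iff {b c : B} : (gen b : BooleanSubalgebra B) = gen c ↔
    b = c ∨ b = cᶜ ∨ ((b = ⊥ ∨ b = ⊤) ∧ (c = ⊥ ∨ c = ⊤)) := by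
  constructor
  · intro h
    have h1 : b ∈ (gen c : BooleanSubalgebra B) := h ▸ mem_gen _ b
    rcases mem_gen_iff.1 h1 with h2 | h2 | h2 | h2
    · exact Or.inr (Or.inr ⟨Or.inl h2, gen_eq_bot_iff.1 (h ▸ gen_eq_bot_iff.2 (Or.inl h2))⟩)
    · exact Or.inr (Or.inr ⟨Or.inr h2, gen_eq_bot_iff.1 (h ▸ gen_eq_bot_iff.2 (Or.inr h2))⟩)
    · exact Or.inl h2
    · exact Or.inr (Or.inl h2)
  · rintro (rfl | rfl | ⟨h1, h2⟩)
    · rfl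
    · exact gen_compl c
    · rw [gen_eq_bot_iff.2 h1, gen_eq_bot_iff.2 h2]

theorem symmDiff_mem {W : BooleanSubalgebra B} {x y : B} (hx : x ∈ W) (hy : y ∈ W) :
    x ∆ y ∈ W := W.sup_mem (W.sdiff_mem hx hy) (W.sdiff_mem hy hx)

theorem gen_sup_gen_symmDiff (x y : B) :
    (gen (x ∆ y) ⊔ gen x : BooleanSubalgebra B) = gen x ⊔ gen y := by
  have hx : x ∈ (gen (x ∆ y) ⊔ gen x : BooleanSubalgebra B) := gen_le_iff.1 le_sup_right
  have hz : x ∆ y ∈ (gen (x ∆ y) ⊔ gen x : BooleanSubalgebra B) := gen_le_iff.1 le_sup_left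
  have hx' : x ∈ (gen x ⊔ gen y : BooleanSubalgebra B) := gen_le_iff.1 le_sup_left
  have hy' : y ∈ (gen x ⊔ gen y : BooleanSubalgebra B) := gen_le_iff.1 le_sup_right
  refine le_antisymm (sup_le (gen_le_iff.2 (symmDiff_mem hx' hy')) (gen_le_iff.2 hx'))
    (sup_le (gen_le_iff.2 hx) (gen_le_iff.2 ?_))
  have := symmDiff_mem hx hz
  rwa [symmDiff_symmDiff_cancel_left] at this

end

/-- The subalgebra of the elements of the interval algebra that do not separate points related
by `r`. -/
def invariant (r : ℚ → ℚ → Prop) : BooleanSubalgebra Beta where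
  carrier := {b | ∀ x y, r x y → (x ∈ b.1 ↔ y ∈ b.1)}
  supClosed' _ hb _ hc x y h := or_congr (hb x y h) (hc x y h)
  infClosed' _ hb _ hc x y h := and_congr (hb x y h) (hc x y h)
  compl_mem' hb x y h := not_congr (hb x y h)
  bot_mem' _ _ _ := Iff.rfl

/-- An element generated by `b` and `c` cannot separate points that neither `b` nor `c` separates.
This inclusion is all that is needed about joins. -/
theorem gen_sup_gen_le (b c : Beta) : (gen b ⊔ gen c : BooleanSubalgebra Beta) ≤
    invariant fun x y => (x ∈ b.1 ↔ y ∈ b.1) ∧ (x ∈ c.1 ↔ y ∈ c.1) :=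
  sup_le (gen_le_iff.2 fun _ _ h => h.1) (gen_le_iff.2 fun _ _ h => h.2)

theorem agree_of_mem {b c d : Beta} (h : d ∈ (gen b ⊔ gen c : BooleanSubalgebra Beta)) {x y : ℚ}
    (hb : x ∈ b.1 ↔ y ∈ b.1) (hc : x ∈ c.1 ↔ y ∈ c.1) : x ∈ d.1 ↔ y ∈ d.1 :=
  gen_sup_gen_le b c h x y ⟨hb, hc⟩

/-- Three elements of the interval algebra each two of which generate the same subalgebra are
dependent. -/
theorem gen_eq_gen_symmDiff {p t z : Beta}
    (hp : (gen z ⊔ gen p : BooleanSubalgebra Beta) = gen p ⊔ gen t)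
    (ht : (gen z ⊔ gen t : BooleanSubalgebra Beta) = gen p ⊔ gen t)
    (hpt : (gen p : BooleanSubalgebra Beta) ≠ gen t) :
    (gen z : BooleanSubalgebra Beta) = gen (p ∆ t) := by
  have hz' : z ∈ (gen p ⊔ gen t : BooleanSubalgebra Beta) := hp ▸ gen_le_iff.1 le_sup_left
  have hp' : p ∈ (gen z ⊔ gen t : BooleanSubalgebra Beta) := ht ▸ gen_le_iff.1 le_sup_left
  have ht' : t ∈ (gen z ⊔ gen p : BooleanSubalgebra Beta) := hp ▸ gen_le_iff.1 le_sup_right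
  have az : ∀ x y, (x ∈ p.1 ↔ y ∈ p.1) → (x ∈ t.1 ↔ y ∈ t.1) → (x ∈ z.1 ↔ y ∈ z.1) :=
    fun x y => agree_of_mem hz'
  have ap : ∀ x y, (x ∈ z.1 ↔ y ∈ z.1) → (x ∈ t.1 ↔ y ∈ t.1) → (x ∈ p.1 ↔ y ∈ p.1) :=
    fun x y => agree_of_mem hp'
  have at' : ∀ x y, (x ∈ z.1 ↔ y ∈ z.1) → (x ∈ p.1 ↔ y ∈ p.1) → (x ∈ t.1 ↔ y ∈ t.1) :=
    fun x y => agree_of_mem ht'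
  -- If one pair of points is separated by all three elements, then `p` and `t` separate every `w`
  -- from `x` simultaneously: a `w` separated from `x` by `z` is compared with `y` instead. Thus `p`
  -- and `t` agree up to complement, against `hpt`.
  by_cases H : ∃ x y, ¬ (x ∈ p.1 ↔ y ∈ p.1) ∧ ¬ (x ∈ t.1 ↔ y ∈ t.1) ∧ ¬ (x ∈ z.1 ↔ y ∈ z.1)
  · obtain ⟨x, y, h1, h2, h3⟩ := H
    refine absurd (gen_eq_gen_iff.2 ?_) hpt
    have key : ∀ w, ((w ∈ p.1 ↔ x ∈ p.1) ↔ (w ∈ t.1 ↔ x ∈ t.1)) := fun w => by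
      by_cases hz : w ∈ z.1 ↔ x ∈ z.1
      · exact ⟨at' w x hz, ap w x hz⟩
      · have hz' : w ∈ z.1 ↔ y ∈ z.1 := by clear * - hz h3; tauto
        have h5 : (w ∈ p.1 ↔ y ∈ p.1) ↔ (w ∈ t.1 ↔ y ∈ t.1) := ⟨at' w y hz', ap w y hz'⟩
        clear * - h5 h1 h2; grind
    by_cases h4 : x ∈ p.1 ↔ x ∈ t.1
    · exact Or.inl (beta_ext fun w => by
        have := key w; clear * - this h4; grind)
    · exact Or.inr (Or.inl (beta_ext fun w => by
        have := key w; rw [mem_beta_compl]; clear * - this h4; grind))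
  -- Otherwise `z` separates two points exactly if just one of `p` and `t` does, so `z` is `p ∆ t`
  -- up to complement.
  · replace H : ∀ x y, ¬ (x ∈ p.1 ↔ y ∈ p.1) → ¬ (x ∈ t.1 ↔ y ∈ t.1) → (x ∈ z.1 ↔ y ∈ z.1) :=
      fun x y h1 h2 => by_contra fun h3 => H ⟨x, y, h1, h2, h3⟩
    have key : ∀ w, ((w ∈ z.1 ↔ (0 : ℚ) ∈ z.1) ↔ (w ∈ (p ∆ t).1 ↔ (0 : ℚ) ∈ (p ∆ t).1)) :=
      fun w => by
        have h1 := H w 0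
        have h2 := az w 0
        have h3 := ap w 0
        have h4 := at' w 0
        rw [mem_beta_symmDiff, mem_beta_symmDiff]
        by_cases h5 : w ∈ p.1 ↔ (0 : ℚ) ∈ p.1
        · by_cases h6 : w ∈ t.1 ↔ (0 : ℚ) ∈ t.1
          · have := h2 h5 h6
            rw [h5, h6]; simp [this]
          · have : ¬ (w ∈ z.1 ↔ (0 : ℚ) ∈ z.1) := fun h => h6 (h4 h h5)
            rw [h5]
            clear * - this h6
            grind
        · by_cases h6 : w ∈ t.1 ↔ (0 : ℚ) ∈ t.1
          · have : ¬ (w ∈ z.1 ↔ (0 : ℚ) ∈ z.1) := fun h => h5 (h3 h h6)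
            rw [h6]
            clear * - this h5
            grind
          · have := h1 h5 h6
            clear * - this h5 h6
            grind
    refine gen_eq_gen_iff.2 ?_
    by_cases h4 : (0 : ℚ) ∈ z.1 ↔ (0 : ℚ) ∈ (p ∆ t).1
    · exact Or.inl (beta_ext fun w => by
        have := key w; clear * - this h4; grind)
    · exact Or.inr (Or.inl (beta_ext fun w => by
        have := key w; rw [mem_beta_compl]; clear * - this h4; grind))

/-- Automorphisms of the lattice of subalgebras respect symmetric differences. -/
theorem apply_gen_symmDiff (Φ : BooleanSubalgebra Beta ≃o BooleanSubalgebra Beta) {p t c d : Beta}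
    (hc : Φ (gen p) = gen c) (hd : Φ (gen t) = gen d) : Φ (gen (p ∆ t)) = gen (c ∆ d) := by
  by_cases hpt : (gen p : BooleanSubalgebra Beta) = gen t
  · have triv : ∀ {p t : Beta}, (gen p : BooleanSubalgebra Beta) = gen t →
        (gen (p ∆ t) : BooleanSubalgebra Beta) = ⊥ := fun {p t} h => by
      rw [gen_eq_bot_iff]
      rcases gen_eq_gen_iff.1 h with rfl | rfl | ⟨rfl | rfl, rfl | rfl⟩ <;> simp
    rw [triv hpt, triv (by rw [← hc, ← hd, hpt]), map_bot]
  -- The preimage of `gen (c ∆ d)` inherits the lattice relations characterizing `gen (p ∆ t)`.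
  · obtain ⟨z, hz⟩ := exists_gen_eq_orderIso Φ.symm (c ∆ d)
    rw [OrderIso.symm_apply_eq] at hz
    rw [hz, ← gen_eq_gen_symmDiff (z := z) ?_ ?_ hpt]
    · apply Φ.injective
      rw [map_sup, map_sup, ← hz, hc, hd, gen_sup_gen_symmDiff]
    · apply Φ.injective
      rw [map_sup, map_sup, ← hz, hc, hd, symmDiff_comm, gen_sup_gen_symmDiff, sup_comm]

/-- The preimage `gen z` of `gen e` satisfies `z ∈ L` and `z ∆ s ∈ D`, just as `y` does. Hence `z ∆
y` lies in `L ⊓ D`, and `z` is `y` up to complement. -/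
theorem gen_transport (Φ : BooleanSubalgebra Beta ≃o BooleanSubalgebra Beta)
    {L D : BooleanSubalgebra Beta} (hLD : L ⊓ D = ⊥) {s y c e : Beta} (hy : y ∈ L)
    (hys : y ∆ s ∈ D) (hc : Φ (gen s) = gen c) (he : e ∈ Φ L) (hec : e ∆ c ∈ Φ D) :
    Φ (gen y) = gen e := by
  obtain ⟨z, hzL, hz⟩ := (mem_apply_iff Φ).1 he
  have h1 := apply_gen_symmDiff Φ hz hc
  have h2 : z ∆ s ∈ D := (mem_apply_of_gen h1).1 hec
  have h3 : z ∆ y ∈ L ⊓ D := by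
    refine ⟨symmDiff_mem hzL hy, ?_⟩
    have := symmDiff_mem h2 hys
    rwa [symmDiff_symmDiff_symmDiff_comm, symmDiff_self, symmDiff_bot] at this
  rw [hLD, BooleanSubalgebra.mem_bot] at h3
  rw [← hz]
  congr 1
  refine gen_eq_gen_iff.2 ?_
  rcases h3 with h3 | h3
  · exact Or.inl (symmDiff_eq_bot.1 h3).symm
  · exact Or.inr (Or.inl ((symmDiff_eq_top _ _).1 h3).compl_eq.symm)

theorem exists_gen_transport (Φ : BooleanSubalgebra Beta ≃o BooleanSubalgebra Beta)
    {L D : BooleanSubalgebra Beta} {s y c : Beta} (hy : y ∈ L)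
    (hys : y ∆ s ∈ D) (hc : Φ (gen s) = gen c) : ∃ e ∈ Φ L, e ∆ c ∈ Φ D := by
  obtain ⟨e, he⟩ := exists_gen_eq_orderIso Φ y
  exact ⟨e, (mem_apply_of_gen he).2 hy, (mem_apply_of_gen (apply_gen_symmDiff Φ he hc)).2 hys⟩

variable {I : TuringIdeal}

/-- The join is finite: an element is determined by which of the four cells cut out by `b` and `c`
it meets. -/
theorem cep_mem_gen_sup_gen_beta (b c : Beta) :
    CEP I (· ∈ (gen b ⊔ gen c : BooleanSubalgebra Beta)) := by
  refine CEP.of_finite (Set.Finite.subset ?_ (gen_sup_gen_le b c))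
  refine Set.Finite.of_finite_image (f := fun z : Beta =>
    (fun x => ((x ∈ b.1 : Prop), (x ∈ c.1 : Prop))) '' z.1) (Set.toFinite _) ?_
  have key : ∀ z z' : Beta, z' ∈ invariant (fun x y => (x ∈ b.1 ↔ y ∈ b.1) ∧
      (x ∈ c.1 ↔ y ∈ c.1)) → (fun x => ((x ∈ b.1 : Prop), (x ∈ c.1 : Prop))) '' z.1 =
      (fun x => ((x ∈ b.1 : Prop), (x ∈ c.1 : Prop))) '' z'.1 → ∀ x ∈ z.1, x ∈ z'.1 := by
    intro z z' hz' h x hx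
    obtain ⟨y, hy, hxy⟩ := h.subset ⟨x, hx, rfl⟩
    rw [Prod.mk.injEq] at hxy
    exact (hz' y x ⟨hxy.1.to_iff, hxy.2.to_iff⟩).1 hy
  intro z hz z' hz' h
  exact beta_ext fun x => ⟨key z z' hz' h x, key z' z hz h.symm x⟩

theorem cep_gen_eq_gen {X : Type*} [Coded X] {f g : X → Beta} (hf : Eff I f) (hg : Eff I g) :
    CEP I (fun x => (gen (f x) : BooleanSubalgebra Beta) = gen (g x)) :=
  ((CEP.eq hf hg).or ((CEP.eq hf hg.beta_compl).or
    (((CEP.eq hf (Eff.const ⊥)).or (CEP.eq hf (Eff.const ⊤))).and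
      ((CEP.eq hg (Eff.const ⊥)).or (CEP.eq hg (Eff.const ⊤)))))).of_iff fun _ => gen_eq_gen_iff

/-- A subalgebra is c.e. if it has sufficiently many elements with a jump at just one of certain
points. -/
theorem cep_mem_of_pivot {L : BooleanSubalgebra Beta} {P : ℚ → Prop} {G : ℚ → Beta → Prop}
    (hG : CEP I (fun p : ℚ × Beta => G p.1 p.2)) (mem : ∀ p b, G p b → b ∈ L)
    (jump : ∀ p b, G p b → ∀ q, P q → (q ∈ jumps b ↔ q = p)) (ex : ∀ p, P p → ∃ b, G p b)
    (triv : ∀ b ∈ L, (∀ p, P p → p ∉ jumps b) → b = ⊥ ∨ b = ⊤) : CEP I (· ∈ L) := by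
  classical
  let R : Beta → Beta → Prop := fun b c => ∃ q : ℚ × Beta, G q.1 q.2 ∧ c = b ∆ q.2
  have hR : CEP I (fun s : Beta × Beta => R s.1 s.2) :=
    CEP.ex (R := fun (s : Beta × Beta) (q : ℚ × Beta) => G q.1 q.2 ∧ s.2 = s.1 ∆ q.2)
      (hG.snd.and (CEP.eq (by fun_prop) (by fun_prop)))
  refine ((hR.reach ⊥).or (hR.reach ⊤)).of_iff fun b => ⟨fun hb => ?_, ?_⟩
  -- Elimination of jumps: adding the generator for `p` removes the jump at `p` and leaves the other
  -- jumps in `P` untouched.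
  · suffices H : ∀ n b, b ∈ L → ((jumps b).filter P).card = n →
        Relation.ReflTransGen R ⊥ b ∨ Relation.ReflTransGen R ⊤ b from H _ b hb rfl
    intro n
    induction n with
    | zero =>
      intro b hb hn
      rw [Finset.card_eq_zero, Finset.filter_eq_empty_iff] at hn
      rcases triv b hb fun p hp hpb => hn hpb hp with rfl | rfl
      · exact Or.inl .refl
      · exact Or.inr .refl
    | succ n ih =>
      intro b hb hn
      obtain ⟨p, hp⟩ := Finset.card_pos.1 (by omega : 0 < ((jumps b).filter P).card)
      obtain ⟨hpb, hpP⟩ := Finset.mem_filter.1 hp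
      obtain ⟨g, hg⟩ := ex p hpP
      have e : (jumps (b ∆ g)).filter P = ((jumps b).filter P).erase p := by
        ext q
        simp only [Finset.mem_filter, Finset.mem_erase, mem_jumps_symmDiff]
        by_cases hq : P q
        · simp only [hq, and_true, jump p g hg q hq]
          by_cases hqp : q = p
          · subst hqp; simp [hpb]
          · simp [hqp]
        · simp [hq]
      have h1 := ih (b ∆ g) (symmDiff_mem hb (mem p g hg)) (by
        rw [e, Finset.card_erase_of_mem hp, hn]; rfl)
      have h2 : R (b ∆ g) b := ⟨(p, g), hg, (symmDiff_symmDiff_cancel_right _ _).symm⟩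
      exact h1.imp (fun h => h.tail h2) fun h => h.tail h2
  · have key : ∀ c ∈ L, Relation.ReflTransGen R c b → b ∈ L := fun c hc h => by
      induction h with
      | refl => exact hc
      | tail _ h ih =>
        obtain ⟨q, hq, rfl⟩ := h
        exact symmDiff_mem ih (mem _ _ hq)
    rintro (h | h)
    · exact key _ L.bot_mem h
    · exact key _ BooleanSubalgebra.top_mem h

end SubstructureLattice

namespace SubstructureLattice

open GenLattice
open scoped symmDiff

/-! ### Effectiveness of automorphisms of lattices of subalgebras of the interval algebra -/

theorem eq_bot_or_eq_top {b : Beta} {a : ℚ} (h : ∀ x, x ∈ b.1 ↔ a ∈ b.1) : b = ⊥ ∨ b = ⊤ := by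
  by_cases ha : a ∈ b.1
  · exact Or.inr (beta_eq_top fun x => (h x).2 ha)
  · exact Or.inl (beta_eq_bot fun x hx => ha ((h x).1 hx))

theorem exists_between_mem_iff (b : Beta) {x y : ℚ} (hxy : x < y) :
    ∃ z, x < z ∧ z < y ∧ (x ∈ b.1 ↔ z ∈ b.1) := by
  obtain ⟨w, hw, h⟩ := exists_gt_mem_iff b x
  obtain ⟨z, hz, hz'⟩ := exists_between (lt_min hw hxy)
  exact ⟨z, hz, hz'.trans_le (min_le_right _ _), h z hz.le (hz'.trans_le (min_le_left _ _))⟩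

theorem exists_between_mem_iff' {b : Beta} {x y : ℚ} (hxy : x < y) (hy : y ∉ jumps b) :
    ∃ z, x < z ∧ z < y ∧ (z ∈ b.1 ↔ y ∈ b.1) := by
  obtain ⟨w, hw, h⟩ := exists_lt_mem_iff b hy
  obtain ⟨z, hz, hz'⟩ := exists_between (max_lt hw hxy)
  exact ⟨z, (le_max_right _ _).trans_lt hz, hz', h z ((le_max_left _ _).trans hz.le) hz'.le⟩

/-! ### Three pairs of enumerable subalgebras with trivial intersection. -/

/-- The elements of the interval algebra that are constant on the nonnegative rationals. -/
def constNonneg : BooleanSubalgebra Beta := invariant fun x y => 0 ≤ x ∧ 0 ≤ y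

/-- The elements of the interval algebra that are constant on the rationals below `1`. -/
def constBelowOne : BooleanSubalgebra Beta := invariant fun x y => x < 1 ∧ y < 1

/-- The elements of the interval algebra that are constant outside of `[0, 1)`. -/
def constOffUnit : BooleanSubalgebra Beta :=
  invariant fun x y => (x < 0 ∨ 1 ≤ x) ∧ (y < 0 ∨ 1 ≤ y)

/-- The elements that are invariant under `x ↦ -1/x`. -/
def invariantInv : BooleanSubalgebra Beta := invariant fun x y => x < 0 ∧ y = -x⁻¹

/-- The elements that are invariant under the map `x ↦ 1 - 1/x` on the negative rationals. -/
def invariantOneSubInv : BooleanSubalgebra Beta := invariant fun x y => x < 0 ∧ y = 1 - x⁻¹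

/-- The elements that are invariant under the map `x ↦ 1/(1 - x)` on the negative rationals. -/
def invariantInvOneSub : BooleanSubalgebra Beta := invariant fun x y => x < 0 ∧ y = (1 - x)⁻¹

/-- The map carries the negative rationals into the region where the element is constant, so the
element is constant everywhere. The next two intersections are trivial for similar reasons. -/
theorem constNonneg_inf : constNonneg ⊓ invariantInv = ⊥ := by
  refine eq_bot_iff.2 fun b hb => ?_
  obtain ⟨h1, h2⟩ := hb
  refine eq_bot_or_eq_top (a := 0) fun x => ?_
  rcases lt_or_ge x 0 with hx | hx
  · rw [h2 x _ ⟨hx, rfl⟩]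
    exact h1 _ _ ⟨by simpa using (inv_lt_zero.2 hx).le, le_rfl⟩
  · exact h1 _ _ ⟨hx, le_rfl⟩

theorem constBelowOne_inf : constBelowOne ⊓ invariantOneSubInv = ⊥ := by
  refine eq_bot_iff.2 fun b hb => ?_
  obtain ⟨h1, h2⟩ := hb
  have above : ∀ x, 1 < x → (x ∈ b.1 ↔ (0 : ℚ) ∈ b.1) := fun x hx => by
    have hx' : (1 - x)⁻¹ < 0 := inv_lt_zero.2 (by linarith)
    rw [← h1 _ 0 ⟨hx'.trans one_pos, one_pos⟩, h2 _ x ⟨hx', by rw [inv_inv]; ring⟩]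
  refine eq_bot_or_eq_top (a := 0) fun x => ?_
  rcases lt_trichotomy x 1 with hx | rfl | hx
  · exact h1 _ _ ⟨hx, one_pos⟩
  -- The point `1` is not a value of `x ↦ 1 - 1/x` on the negative rationals; it is reached by
  -- continuity from the right.
  · obtain ⟨z, hz, _, h⟩ := exists_between_mem_iff b one_lt_two
    rw [h, above z hz]
  · exact above x hx

theorem constOffUnit_inf : constOffUnit ⊓ invariantInvOneSub = ⊥ := by
  refine eq_bot_iff.2 fun b hb => ?_
  obtain ⟨h1, h2⟩ := hb
  have off : ∀ x, x < 0 ∨ 1 ≤ x → (x ∈ b.1 ↔ (1 : ℚ) ∈ b.1) := fun x hx =>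
    h1 _ _ ⟨hx, Or.inr le_rfl⟩
  have unit : ∀ x, 0 < x → x < 1 → (x ∈ b.1 ↔ (1 : ℚ) ∈ b.1) := fun x hx hx' => by
    have h3 : 1 - x⁻¹ < 0 := sub_neg.2 ((one_lt_inv₀ hx).2 hx')
    rw [← off _ (Or.inl h3), h2 _ x ⟨h3, by rw [sub_sub_cancel, inv_inv]⟩]
  refine eq_bot_or_eq_top (a := 1) fun x => ?_
  rcases lt_trichotomy x 0 with hx | rfl | hx
  · exact off x (Or.inl hx)
  · obtain ⟨z, hz, hz', h⟩ := exists_between_mem_iff b zero_lt_one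
    rw [h, unit z hz hz']
  · rcases lt_or_ge x 1 with hx' | hx'
    · exact unit x hx hx'
    · exact off x (Or.inr hx')

/-- The map `x ↦ -1/x` is increasing on the negative rationals and takes `-1/p` to `p`, so a jump at
the former is balanced by one at the latter. The ray at `0` adjusts the values between the two
parts. -/
theorem mem_invariantInv {p : ℚ} (hp : 0 < p) :
    ray (-p⁻¹) ∆ (ray 0 ∆ ray p) ∈ invariantInv := by
  rintro x y ⟨hx, rfl⟩
  have h0 : 0 < -x⁻¹ := by simpa using inv_lt_zero.2 hx
  have h1 : -p⁻¹ < 0 := by simpa using hp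
  have h2 : p ≤ -x⁻¹ ↔ -p⁻¹ ≤ x := by
    rw [← inv_neg, le_inv_comm₀ hp (by linarith), neg_le]
  simp only [mem_beta_symmDiff, mem_ray, h2, h0.le, (h1.trans h0).le, not_le.2 hx,
    not_le.2 (hx.trans hp)]
  tauto

theorem mem_invariantOneSubInv {p : ℚ} (hp : p < 0) :
    (ray 1 ∆ ray (1 - p⁻¹)) ∆ ray p ∈ invariantOneSubInv := by
  rintro x y ⟨hx, rfl⟩
  have h0 : 0 < -x⁻¹ := by simpa using inv_lt_zero.2 hx
  have h1 : 0 < -p⁻¹ := by simpa using inv_lt_zero.2 hp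
  have h2 : 1 - p⁻¹ ≤ 1 - x⁻¹ ↔ p ≤ x := by
    rw [sub_le_sub_iff_left, inv_le_inv_of_neg hx hp]
  have h3 : p ≤ 1 - x⁻¹ := by linarith
  have h4 : 1 ≤ 1 - x⁻¹ := by linarith
  have h5 : ¬ 1 ≤ x := by linarith
  have h6 : ¬ 1 - p⁻¹ ≤ x := by linarith
  simp only [mem_beta_symmDiff, mem_ray, h2, h3, h4, h5, h6]
  tauto

theorem mem_invariantInvOneSub {p : ℚ} (hp : p < 0) :
    (ray 0 ∆ ray (1 - p)⁻¹) ∆ ray p ∈ invariantInvOneSub := by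
  rintro x y ⟨hx, rfl⟩
  have h0 : 0 < (1 - x)⁻¹ := inv_pos.2 (by linarith)
  have h1 : 0 < (1 - p)⁻¹ := inv_pos.2 (by linarith)
  have h2 : (1 - p)⁻¹ ≤ (1 - x)⁻¹ ↔ p ≤ x := by
    rw [inv_le_inv₀ (by linarith) (by linarith), sub_le_sub_iff_left]
  have h3 : p ≤ (1 - x)⁻¹ := by linarith
  have h6 : ¬ (1 - p)⁻¹ ≤ x := by linarith
  simp only [mem_beta_symmDiff, mem_ray, h2, h3, h0.le, not_le.2 hx, h6]
  tauto

variable {I : TuringIdeal}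

theorem cep_mem_constNonneg : CEP I (· ∈ constNonneg) := by
  refine cep_mem_of_pivot (P := fun p => p ≤ 0) (G := fun p b => p ≤ 0 ∧ b = ray p)
    ((CEP.rat_le (by fun_prop) (by fun_prop)).and (CEP.eq (by fun_prop) (by fun_prop)))
    ?_ ?_ (fun p hp => ⟨_, hp, rfl⟩) ?_
  · rintro p _ ⟨hp, rfl⟩ x y ⟨hx, hy⟩
    exact iff_of_true (hp.trans hx) (hp.trans hy)
  · rintro p _ ⟨hp, rfl⟩ q _
    exact mem_jumps_ray
  · intro b hb h
    refine eq_bot_or_eq_top (a := 0) fun x => ?_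
    rcases le_total x 0 with hx | hx
    · exact mem_iff_mem_of_no_jumps hx fun q hq _ => not_le.1 fun hq' => h q hq' hq
    · exact hb _ _ ⟨hx, le_rfl⟩

theorem cep_mem_constBelowOne : CEP I (· ∈ constBelowOne) := by
  refine cep_mem_of_pivot (P := fun p => 1 ≤ p) (G := fun p b => 1 ≤ p ∧ b = ray p)
    ((CEP.rat_le (by fun_prop) (by fun_prop)).and (CEP.eq (by fun_prop) (by fun_prop)))
    ?_ ?_ (fun p hp => ⟨_, hp, rfl⟩) ?_
  · rintro p _ ⟨hp, rfl⟩ x y ⟨hx, hy⟩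
    exact iff_of_false (not_le.2 (hx.trans_le hp)) (not_le.2 (hy.trans_le hp))
  · rintro p _ ⟨hp, rfl⟩ q _
    exact mem_jumps_ray
  · intro b hb h
    refine eq_bot_or_eq_top (a := 0) fun x => ?_
    rcases lt_or_ge x 1 with hx | hx
    · exact hb _ _ ⟨hx, one_pos⟩
    · obtain ⟨z, _, hz, hzb⟩ := exists_between_mem_iff' zero_lt_one (h 1 le_rfl)
      rw [← hb z 0 ⟨hz, one_pos⟩, hzb]
      exact (mem_iff_mem_of_no_jumps hx fun q hq hq' => absurd hq (h q hq'.le)).symm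

theorem cep_mem_constOffUnit : CEP I (· ∈ constOffUnit) := by
  refine cep_mem_of_pivot (P := fun p => 0 ≤ p ∧ p < 1)
    (G := fun p b => (0 ≤ p ∧ p < 1) ∧ b = ray p ∆ ray 1)
    (((CEP.rat_le (by fun_prop) (by fun_prop)).and (CEP.rat_lt (by fun_prop) (by fun_prop))).and
      (CEP.eq (by fun_prop) (by fun_prop))) ?_ ?_ (fun p hp => ⟨_, hp, rfl⟩) ?_
  · have key : ∀ p x : ℚ, 0 ≤ p → p < 1 → (x < 0 ∨ 1 ≤ x) → (p ≤ x ↔ 1 ≤ x) := by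
      rintro p x hp hp' (hx | hx)
      · exact iff_of_false (by linarith) (by linarith)
      · exact iff_of_true (by linarith) hx
    rintro p _ ⟨⟨hp, hp'⟩, rfl⟩ x y ⟨hx, hy⟩
    simp only [mem_beta_symmDiff, mem_ray, key p x hp hp' hx, key p y hp hp' hy]
  · rintro p _ ⟨⟨hp, hp'⟩, rfl⟩ q ⟨_, hq⟩
    simp [mem_jumps_symmDiff, hq.ne]
  · intro b hb h
    refine eq_bot_or_eq_top (a := 1) fun x => ?_
    by_cases hx : x < 0 ∨ 1 ≤ x
    · exact hb _ _ ⟨hx, Or.inr le_rfl⟩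
    · push Not at hx
      obtain ⟨z, _, hz, hzb⟩ := exists_between_mem_iff' neg_one_lt_zero
        (h 0 ⟨le_rfl, one_pos⟩)
      rw [← hb z 1 ⟨Or.inl hz, Or.inr le_rfl⟩, hzb]
      exact (mem_iff_mem_of_no_jumps hx.1 fun q hq hq' => not_le.1 fun hq'' =>
        h q ⟨hq'.le, hq''.trans_lt hx.2⟩ hq).symm

theorem cep_mem_invariantInv : CEP I (· ∈ invariantInv) := by
  refine cep_mem_of_pivot (P := fun p => 0 < p)
    (G := fun p b => 0 < p ∧ b = ray (-p⁻¹) ∆ (ray 0 ∆ ray p))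
    ((CEP.rat_lt (by fun_prop) (by fun_prop)).and (CEP.eq (by fun_prop) (by fun_prop)))
    ?_ ?_ (fun p hp => ⟨_, hp, rfl⟩) ?_
  · rintro p _ ⟨hp, rfl⟩
    exact mem_invariantInv hp
  · rintro p _ ⟨hp, rfl⟩ q hq
    have h1 : -p⁻¹ < 0 := by simpa using hp
    simp [mem_jumps_symmDiff, hq.ne', (h1.trans hq).ne']
  · intro b hb h
    have pos : ∀ x, 0 ≤ x → (x ∈ b.1 ↔ (0 : ℚ) ∈ b.1) := fun x hx =>
      (mem_iff_mem_of_no_jumps hx fun q hq hq' => absurd hq (h q hq')).symm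
    refine eq_bot_or_eq_top (a := 0) fun x => ?_
    rcases lt_or_ge x 0 with hx | hx
    · rw [hb x _ ⟨hx, rfl⟩]
      exact pos _ (by simpa using (inv_lt_zero.2 hx).le)
    · exact pos x hx

theorem cep_mem_invariantOneSubInv : CEP I (· ∈ invariantOneSubInv) := by
  -- A jump below `0` forces a matching one above `1`, whereas `[p, 1)` with `0 ≤ p` meets neither
  -- the domain nor the range of the map.
  refine cep_mem_of_pivot (P := fun p => p < 1)
    (G := fun p b => (p < 0 ∧ b = (ray 1 ∆ ray (1 - p⁻¹)) ∆ ray p) ∨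
      ((0 ≤ p ∧ p < 1) ∧ b = ray p ∆ ray 1))
    (((CEP.rat_lt (by fun_prop) (by fun_prop)).and (CEP.eq (by fun_prop) (by fun_prop))).or
      (((CEP.rat_le (by fun_prop) (by fun_prop)).and (CEP.rat_lt (by fun_prop) (by fun_prop))).and
      (CEP.eq (by fun_prop) (by fun_prop)))) ?_ ?_ ?_ ?_
  · rintro p _ (⟨hp, rfl⟩ | ⟨⟨hp, hp'⟩, rfl⟩)
    · exact mem_invariantOneSubInv hp
    · rintro x y ⟨hx, rfl⟩
      have h0 : 0 < -x⁻¹ := by simpa using inv_lt_zero.2 hx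
      have h1 : ¬ p ≤ x := by linarith
      have h2 : ¬ 1 ≤ x := by linarith
      have h3 : p ≤ 1 - x⁻¹ := by linarith
      have h4 : 1 ≤ 1 - x⁻¹ := by linarith
      simp only [mem_beta_symmDiff, mem_ray, h1, h2, h3, h4]
  · rintro p _ (⟨hp, rfl⟩ | ⟨⟨hp, hp'⟩, rfl⟩) q hq
    · have h1 : 0 < -p⁻¹ := by simpa using inv_lt_zero.2 hp
      have h2 : q ≠ 1 - p⁻¹ := by linarith
      simp [mem_jumps_symmDiff, hq.ne, h2]
    · simp [mem_jumps_symmDiff, hq.ne]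
  · intro p hp
    rcases lt_or_ge p 0 with hp' | hp'
    · exact ⟨_, Or.inl ⟨hp', rfl⟩⟩
    · exact ⟨_, Or.inr ⟨⟨hp', hp⟩, rfl⟩⟩
  · intro b hb h
    have below : ∀ x, x < 1 → (x ∈ b.1 ↔ (0 : ℚ) ∈ b.1) := fun x hx => by
      rcases le_total x 0 with hx' | hx'
      · exact mem_iff_mem_of_no_jumps hx' fun q hq _ => not_le.1 fun hq' =>
          h q (hq'.trans_lt one_pos) hq
      · exact (mem_iff_mem_of_no_jumps hx' fun q hq _ => not_le.1 fun hq' =>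
          h q (hq'.trans_lt hx) hq).symm
    have above : ∀ x, 1 < x → (x ∈ b.1 ↔ (0 : ℚ) ∈ b.1) := fun x hx => by
      have hx' : (1 - x)⁻¹ < 0 := inv_lt_zero.2 (by linarith)
      rw [← below _ (hx'.trans one_pos), hb _ x ⟨hx', by rw [inv_inv]; ring⟩]
    refine eq_bot_or_eq_top (a := 0) fun x => ?_
    rcases lt_trichotomy x 1 with hx | rfl | hx
    · exact below x hx
    · obtain ⟨z, hz, _, h⟩ := exists_between_mem_iff b one_lt_two
      rw [h, above z hz]
    · exact above x hx

theorem cep_mem_invariantInvOneSub : CEP I (· ∈ invariantInvOneSub) := by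
  -- The range of the map is the open unit interval, so the behaviour there is determined by the
  -- negative part and the behaviour from `1` on is free.
  refine cep_mem_of_pivot (P := fun p => p < 0 ∨ 1 ≤ p)
    (G := fun p b => (p < 0 ∧ b = (ray 0 ∆ ray (1 - p)⁻¹) ∆ ray p) ∨ (1 ≤ p ∧ b = ray p))
    (((CEP.rat_lt (by fun_prop) (by fun_prop)).and (CEP.eq (by fun_prop) (by fun_prop))).or
      ((CEP.rat_le (by fun_prop) (by fun_prop)).and
      (CEP.eq (by fun_prop) (by fun_prop)))) ?_ ?_ ?_ ?_
  · rintro p _ (⟨hp, rfl⟩ | ⟨hp, rfl⟩)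
    · exact mem_invariantInvOneSub hp
    · rintro x y ⟨hx, rfl⟩
      have h0 : (1 - x)⁻¹ < 1 := inv_lt_one_of_one_lt₀ (by linarith)
      have h1 : ¬ p ≤ x := by linarith
      have h2 : ¬ p ≤ (1 - x)⁻¹ := by linarith
      simp only [mem_ray, h1, h2]
  · rintro p _ (⟨hp, rfl⟩ | ⟨hp, rfl⟩) q hq
    · have h0 : (1 - p)⁻¹ < 1 := inv_lt_one_of_one_lt₀ (by linarith)
      have h1 : 0 < (1 - p)⁻¹ := inv_pos.2 (by linarith)
      have h2 : q ≠ 0 := by rintro rfl; rcases hq with hq | hq <;> linarith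
      have h3 : q ≠ (1 - p)⁻¹ := by rintro rfl; rcases hq with hq | hq <;> linarith
      simp [mem_jumps_symmDiff, h2, h3]
    · exact mem_jumps_ray
  · rintro p (hp | hp)
    · exact ⟨_, Or.inl ⟨hp, rfl⟩⟩
    · exact ⟨_, Or.inr ⟨hp, rfl⟩⟩
  · intro b hb h
    have neg : ∀ x, x < 0 → (x ∈ b.1 ↔ (-1 : ℚ) ∈ b.1) := fun x hx => by
      rcases le_total x (-1) with hx' | hx'
      · exact mem_iff_mem_of_no_jumps hx' fun q hq _ => not_le.1 fun hq' =>
          h q (Or.inl (by linarith)) hq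
      · exact (mem_iff_mem_of_no_jumps hx' fun q hq _ => not_le.1 fun hq' =>
          h q (Or.inl (by linarith)) hq).symm
    have unit : ∀ x, 0 < x → x < 1 → (x ∈ b.1 ↔ (-1 : ℚ) ∈ b.1) := fun x hx hx' => by
      have h3 : 1 - x⁻¹ < 0 := sub_neg.2 ((one_lt_inv₀ hx).2 hx')
      rw [← neg _ h3, hb _ x ⟨h3, by rw [sub_sub_cancel, inv_inv]⟩]
    refine eq_bot_or_eq_top (a := -1) fun x => ?_
    rcases lt_trichotomy x 0 with hx | rfl | hx
    · exact neg x hx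
    · obtain ⟨z, hz, hz', h⟩ := exists_between_mem_iff b zero_lt_one
      rw [h, unit z hz hz']
    · rcases lt_or_ge x 1 with hx' | hx'
      · exact unit x hx hx'
      · obtain ⟨z, hz, hz', hzb⟩ := exists_between_mem_iff' zero_lt_one (h 1 (Or.inr le_rfl))
        rw [← unit z hz hz', hzb]
        exact (mem_iff_mem_of_no_jumps hx' fun q hq hq' =>
          absurd hq (h q (Or.inr hq'.le))).symm

/-- An automorphism of the lattice of subalgebras that preserves being c.e. can be followed
effectively along a subalgebra `D`. -/
theorem exists_gen_step {Φ : BooleanSubalgebra Beta ≃o BooleanSubalgebra Beta}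
    (hΦ : Φ ∈ ceAut (BooleanSubalgebra Beta) I) {L D : BooleanSubalgebra Beta}
    (hLD : L ⊓ D = ⊥) (hL : CEP I (· ∈ L)) (hD : CEP I (· ∈ D)) :
    ∃ T : Beta → Beta → Prop, CEP I (fun p : Beta × Beta => T p.1 p.2) ∧
      ∀ s y c, y ∈ L → y ∆ s ∈ D → Φ (gen s) = gen c →
        (∀ e, T c e → Φ (gen y) = gen e) ∧ ∃ e, T c e :=
  ⟨fun c e => e ∈ Φ L ∧ e ∆ c ∈ Φ D,
    ((cep_mem_apply hΦ hL).comp (by fun_prop)).and ((cep_mem_apply hΦ hD).comp (by fun_prop)),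
    fun _ _ _ hy hys hc => ⟨fun _ he => gen_transport Φ hLD hy hys hc he.1 he.2,
      exists_gen_transport Φ hy hys hc⟩⟩

/-- The Euclidean algorithm, by induction on `a + b`: the fraction `a/b` comes from `(a - b)/b` by
adding `1`, or from `a/(b - a)` by `q ↦ q/(q + 1)`. -/
theorem rat_pos_induction {P : ℚ → Prop} (one : P 1) (add : ∀ q, 0 < q → P q → P (q + 1))
    (inv : ∀ q, 0 < q → P q → P (1 + q⁻¹)⁻¹) {q : ℚ} (hq : 0 < q) : P q := by
  have key : ∀ n a b : ℕ, a + b = n → 0 < a → 0 < b → P ((a : ℚ) / b) := by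
    intro n
    induction n using Nat.strong_induction_on with
    | _ n ih =>
      intro a b hn ha hb
      have ha' : (0 : ℚ) < a := Nat.cast_pos.2 ha
      have hb' : (0 : ℚ) < b := Nat.cast_pos.2 hb
      rcases lt_trichotomy a b with h | rfl | h
      · obtain ⟨c, rfl⟩ := Nat.exists_eq_add_of_lt h
        have hc : (0 : ℚ) < (c + 1 : ℕ) := Nat.cast_pos.2 c.succ_pos
        have h1 := inv _ (div_pos ha' hc) (ih (a + (c + 1)) (by omega) a (c + 1) rfl ha c.succ_pos)
        have h2 : (1 + ((a : ℚ) / (c + 1 : ℕ))⁻¹)⁻¹ = (a : ℚ) / (a + c + 1 : ℕ) := by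
          rw [inv_div, inv_eq_iff_eq_inv, inv_div]
          field_simp
          push_cast
          ring
        rwa [h2] at h1
      · rw [div_self ha'.ne']
        exact one
      · obtain ⟨c, rfl⟩ := Nat.exists_eq_add_of_lt h
        have hc : (0 : ℚ) < (c + 1 : ℕ) := Nat.cast_pos.2 c.succ_pos
        have h1 := add _ (div_pos hc hb') (ih (c + 1 + b) (by omega) (c + 1) b rfl c.succ_pos hb)
        have h2 : ((c + 1 : ℕ) : ℚ) / b + 1 = ((b + c + 1 : ℕ) : ℚ) / b := by
          field_simp
          push_cast
          ring
        rwa [h2] at h1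
  have h1 := key _ q.num.natAbs q.den rfl (Int.natAbs_pos.2 (Rat.num_pos.2 hq).ne') q.pos
  have h2 : (q.num.natAbs : ℚ) = q.num := by
    have : (q.num.natAbs : ℤ) = q.num := by have := Rat.num_pos.2 hq; omega
    rw [← this, Int.cast_natCast, Int.natAbs_natCast]
  rwa [h2, Rat.num_div_den] at h1

/-- The values of an automorphism at the subalgebras generated by `[0, q)` and by `[-1/q, ∞)` can
be enumerated. -/
theorem exists_cep_gen_interval {Φ : BooleanSubalgebra Beta ≃o BooleanSubalgebra Beta}
    (hΦ : Φ ∈ ceAut (BooleanSubalgebra Beta) I) : ∃ Z N : ℚ → Beta → Prop,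
      CEP I (fun p : ℚ × Beta => Z p.1 p.2) ∧ CEP I (fun p : ℚ × Beta => N p.1 p.2) ∧
      (∀ q c, Z q c → 0 < q ∧ Φ (gen (ray 0 ∆ ray q)) = gen c) ∧
      (∀ q c, N q c → 0 < q ∧ Φ (gen (ray (-q⁻¹))) = gen c) ∧
      ∀ q, 0 < q → (∃ c, Z q c) ∧ ∃ c, N q c := by
  -- The three transports: `T` leads from `[0, q)` to `[-1/q, ∞)`, and from there `U` leads to `[1,
  -- q + 1)` and `V` to `[0, q/(q + 1))`.
  obtain ⟨T, hT, T_spec⟩ := exists_gen_step hΦ constNonneg_inf cep_mem_constNonneg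
    cep_mem_invariantInv
  obtain ⟨U, hU, U_spec⟩ := exists_gen_step hΦ constBelowOne_inf cep_mem_constBelowOne
    cep_mem_invariantOneSubInv
  obtain ⟨V, hV, V_spec⟩ := exists_gen_step hΦ constOffUnit_inf cep_mem_constOffUnit
    cep_mem_invariantInvOneSub
  have hT' : ∀ q c, 0 < q → Φ (gen (ray 0 ∆ ray q)) = gen c →
      (∀ e, T c e → Φ (gen (ray (-q⁻¹))) = gen e) ∧ ∃ e, T c e := fun q c hq h => by
    have h1 : 0 < q⁻¹ := inv_pos.2 hq
    refine T_spec _ _ c (fun x y hxy => ?_) (mem_invariantInv hq) h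
    exact iff_of_true (show -q⁻¹ ≤ x by linarith [hxy.1]) (show -q⁻¹ ≤ y by linarith [hxy.2])
  have hU' : ∀ q c, 0 < q → Φ (gen (ray (-q⁻¹))) = gen c →
      (∀ e, U c e → Φ (gen (ray 1 ∆ ray (q + 1))) = gen e) ∧ ∃ e, U c e := fun q c hq h => by
    have h1 : -q⁻¹ < 0 := by simpa using hq
    refine U_spec _ _ c (fun x y hxy => ?_) ?_ h
    · have h2 : ∀ x : ℚ, x < 1 → ¬ 1 ≤ x ∧ ¬ q + 1 ≤ x := fun x hx =>
        ⟨by linarith, by linarith⟩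
      simp only [mem_beta_symmDiff, mem_ray, (h2 x hxy.1).1, (h2 x hxy.1).2, (h2 y hxy.2).1,
        (h2 y hxy.2).2]
    · have := mem_invariantOneSubInv h1
      rwa [inv_neg, inv_inv, sub_neg_eq_add, add_comm 1 q] at this
  have hV' : ∀ q c, 0 < q → Φ (gen (ray (-q⁻¹))) = gen c →
      (∀ e, V c e → Φ (gen (ray 0 ∆ ray (1 + q⁻¹)⁻¹)) = gen e) ∧ ∃ e, V c e := fun q c hq h => by
    have h1 : -q⁻¹ < 0 := by simpa using hq
    refine V_spec _ _ c (fun x y hxy => ?_) ?_ h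
    · have h2 : ∀ x : ℚ, x < 0 ∨ 1 ≤ x → ((0 ≤ x) ↔ (1 + q⁻¹)⁻¹ ≤ x) := by
        have h3 : (1 + q⁻¹)⁻¹ < 1 := inv_lt_one_of_one_lt₀ (by linarith)
        have h4 : 0 < (1 + q⁻¹)⁻¹ := inv_pos.2 (by linarith)
        rintro x (hx | hx)
        · exact iff_of_false (by linarith) (by linarith)
        · exact iff_of_true (by linarith) (by linarith)
      simp only [mem_beta_symmDiff, mem_ray, h2 x hxy.1, h2 y hxy.2]
    · have := mem_invariantInvOneSub h1
      rwa [sub_neg_eq_add] at this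
  obtain ⟨c₁, hc₁⟩ := exists_gen_eq_orderIso Φ (ray 0 ∆ ray 1)
  let R : ℚ × Beta → ℚ × Beta → Prop := fun s t => ∃ e f, T s.2 e ∧
    ((t.1 = s.1 + 1 ∧ U e f ∧ t.2 = c₁ ∆ f) ∨ (t.1 = (1 + s.1⁻¹)⁻¹ ∧ V e f ∧ t.2 = f))
  have hR : CEP I (fun s : (ℚ × Beta) × (ℚ × Beta) => R s.1 s.2) :=
    CEP.ex (CEP.ex ((hT.comp₂ (by fun_prop) (by fun_prop)).and
      (((CEP.eq (by fun_prop) (by fun_prop)).and ((hU.comp₂ (by fun_prop) (by fun_prop)).and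
        (CEP.eq (by fun_prop) (by fun_prop)))).or
      ((CEP.eq (by fun_prop) (by fun_prop)).and ((hV.comp₂ (by fun_prop) (by fun_prop)).and
        (CEP.eq (by fun_prop) (by fun_prop)))))))
  let Z : ℚ → Beta → Prop := fun q c => Relation.ReflTransGen R (1, c₁) (q, c)
  have hZ : CEP I (fun p : ℚ × Beta => Z p.1 p.2) :=
    (hR.reach (1, c₁)).of_iff fun p => Iff.rfl
  -- The symmetric difference of `[0, 1)` and `[1, q + 1)` is `[0, q + 1)`.
  have add_one : ∀ q f, Φ (gen (ray 1 ∆ ray (q + 1))) = gen f →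
      Φ (gen (ray 0 ∆ ray (q + 1))) = gen (c₁ ∆ f) := fun q f h => by
    have := apply_gen_symmDiff Φ hc₁ h
    rwa [symmDiff_assoc, symmDiff_symmDiff_cancel_left] at this
  have sound : ∀ s : ℚ × Beta, Relation.ReflTransGen R (1, c₁) s →
      0 < s.1 ∧ Φ (gen (ray 0 ∆ ray s.1)) = gen s.2 := fun s hs => by
    induction hs with
    | refl => exact ⟨one_pos, hc₁⟩
    | @tail s t _ h ih =>
      obtain ⟨e, f, he, ⟨h1, hf, h2⟩ | ⟨h1, hf, h2⟩⟩ := h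
      · have h3 := (hT' _ _ ih.1 ih.2).1 e he
        have h4 := (hU' _ _ ih.1 h3).1 f hf
        rw [h1, h2]
        exact ⟨by linarith [ih.1], add_one _ _ h4⟩
      · have h3 := (hT' _ _ ih.1 ih.2).1 e he
        have h4 := (hV' _ _ ih.1 h3).1 f hf
        have h5 : 0 < s.1⁻¹ := inv_pos.2 ih.1
        rw [h1, h2]
        exact ⟨by positivity, h4⟩
  have complete : ∀ q, 0 < q → ∃ c, Z q c := fun q hq => by
    refine rat_pos_induction (P := fun q => ∃ c, Z q c) ⟨c₁, .refl⟩ (fun q hq ih => ?_)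
      (fun q hq ih => ?_) hq
    · obtain ⟨c, hc⟩ := ih
      have h1 := (sound (q, c) hc).2
      obtain ⟨e, he⟩ := (hT' q c hq h1).2
      obtain ⟨f, hf⟩ := (hU' q e hq ((hT' q c hq h1).1 e he)).2
      have h2 : R (q, c) (q + 1, c₁ ∆ f) := ⟨e, f, he, Or.inl ⟨rfl, hf, rfl⟩⟩
      exact ⟨_, hc.tail h2⟩
    · obtain ⟨c, hc⟩ := ih
      have h1 := (sound (q, c) hc).2
      obtain ⟨e, he⟩ := (hT' q c hq h1).2
      obtain ⟨f, hf⟩ := (hV' q e hq ((hT' q c hq h1).1 e he)).2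
      have h2 : R (q, c) ((1 + q⁻¹)⁻¹, f) := ⟨e, f, he, Or.inr ⟨rfl, hf, rfl⟩⟩
      exact ⟨_, hc.tail h2⟩
  refine ⟨Z, fun q e => ∃ c, Z q c ∧ T c e, hZ, CEP.ex ((hZ.comp₂ (by fun_prop)
    (by fun_prop)).and (hT.comp₂ (by fun_prop) (by fun_prop))), fun q c h => sound (q, c) h, ?_, ?_⟩
  · rintro q e ⟨c, hc, he⟩
    have h1 := sound (q, c) hc
    exact ⟨h1.1, (hT' q c h1.1 h1.2).1 e he⟩
  · intro q hq
    obtain ⟨c, hc⟩ := complete q hq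
    obtain ⟨e, he⟩ := (hT' q c hq (sound (q, c) hc).2).2
    exact ⟨⟨c, hc⟩, e, c, hc, he⟩

/-- The values of an automorphism of the lattice of c.e. subalgebras at one-generated subalgebras
can be enumerated. -/
theorem cep_apply_gen_eq_beta {Φ : BooleanSubalgebra Beta ≃o BooleanSubalgebra Beta}
    (hΦ : Φ ∈ ceAut (BooleanSubalgebra Beta) I) :
    CEP I (fun p : Beta × Beta => Φ (gen p.1) = gen p.2) := by
  obtain ⟨Z, N, hZ, hN, hZ', hN', complete⟩ := exists_cep_gen_interval hΦ
  obtain ⟨c₀, hc₀⟩ := exists_gen_eq_orderIso Φ (ray 0)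
  -- The reachable pairs satisfy `Φ (gen s.1) = gen s.2`. Complementing only the first component is
  -- harmless, since complements generate the same subalgebra.
  let R : Beta × Beta → Beta × Beta → Prop := fun s t =>
    t = (s.1ᶜ, s.2) ∨ t = (s.1 ∆ ray 0, s.2 ∆ c₀) ∨
    ∃ p : ℚ × Beta, (Z p.1 p.2 ∧ t = (s.1 ∆ (ray 0 ∆ ray p.1), s.2 ∆ p.2)) ∨
      (N p.1 p.2 ∧ t = (s.1 ∆ ray (-p.1⁻¹), s.2 ∆ p.2))
  have hR : CEP I (fun s : (Beta × Beta) × (Beta × Beta) => R s.1 s.2) :=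
    (CEP.eq (by fun_prop) (by fun_prop)).or ((CEP.eq (by fun_prop) (by fun_prop)).or
      (CEP.ex (((hZ.comp₂ (by fun_prop) (by fun_prop)).and (CEP.eq (by fun_prop) (by fun_prop))).or
        ((hN.comp₂ (by fun_prop) (by fun_prop)).and (CEP.eq (by fun_prop) (by fun_prop))))))
  have sound : ∀ s : Beta × Beta, Relation.ReflTransGen R (⊥, ⊥) s →
      Φ (gen s.1) = gen s.2 := fun s hs => by
    induction hs with
    | refl => rw [gen_eq_bot_iff.2 (Or.inl rfl), map_bot]
    | tail _ h ih =>
      rcases h with rfl | rfl | ⟨p, ⟨h, rfl⟩ | ⟨h, rfl⟩⟩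
      · rwa [gen_compl]
      · exact apply_gen_symmDiff Φ ih hc₀
      · exact apply_gen_symmDiff Φ ih (hZ' _ _ h).2
      · exact apply_gen_symmDiff Φ ih (hN' _ _ h).2
  have ex : ∀ b, ∃ c, Relation.ReflTransGen R (⊥, ⊥) (b, c) := fun b => by
    induction b using beta_induction with
    | bot => exact ⟨⊥, .refl⟩
    | top =>
      have h : R (⊥, ⊥) (⊤, ⊥) := Or.inl (by simp)
      exact ⟨⊥, .single h⟩
    | ray b q ih =>
      obtain ⟨c, hc⟩ := ih
      rcases lt_trichotomy q 0 with hq | rfl | hq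
      -- A negative `q` is `-1/p` for the positive `p = -1/q`.
      · obtain ⟨e, he⟩ := (complete (-q⁻¹) (by simpa using hq)).2
        have h : R (b, c) (b ∆ ray q, c ∆ e) :=
          Or.inr (Or.inr ⟨(-q⁻¹, e), Or.inr ⟨he, by simp⟩⟩)
        exact ⟨_, hc.tail h⟩
      · have h : R (b, c) (b ∆ ray 0, c ∆ c₀) := Or.inr (Or.inl rfl)
        exact ⟨_, hc.tail h⟩
      · obtain ⟨e, he⟩ := (complete q hq).1
        have h1 : R (b, c) (b ∆ ray 0, c ∆ c₀) := Or.inr (Or.inl rfl)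
        have h2 : R (b ∆ ray 0, c ∆ c₀) (b ∆ ray q, (c ∆ c₀) ∆ e) :=
          Or.inr (Or.inr ⟨(q, e), Or.inl ⟨he, by
            simp only [symmDiff_assoc, symmDiff_symmDiff_cancel_left]⟩⟩)
        exact ⟨_, (hc.tail h1).tail h2⟩
  refine (CEP.ex (R := fun (p : Beta × Beta) c => Relation.ReflTransGen R (⊥, ⊥) (p.1, c) ∧
    (gen c : BooleanSubalgebra Beta) = gen p.2) (((hR.reach (⊥, ⊥)).comp (by fun_prop)).and
      (cep_gen_eq_gen (by fun_prop) (by fun_prop)))).of_iff fun p => ?_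
  constructor
  · intro h
    obtain ⟨c, hc⟩ := ex p.1
    exact ⟨c, hc, (sound (p.1, c) hc).symm.trans h⟩
  · rintro ⟨c, hc, h⟩
    exact (sound (p.1, c) hc).trans h

end SubstructureLattice

namespace SubstructureLattice

open GenLattice Coded
open scoped symmDiff

/-! ### Permutations of the unit intervals -/

/-- The map that moves the interval `[k, k + 1)` to `[π k, π k + 1)` for each natural number `k`
and fixes the negative rationals. -/
def blockMap (π : Equiv.Perm ℕ) (x : ℚ) : ℚ :=
  if x < 0 then x else (π ⌊x⌋₊ : ℚ) + (x - (⌊x⌋₊ : ℚ))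

theorem blockMap_of_neg (π : Equiv.Perm ℕ) {x : ℚ} (hx : x < 0) : blockMap π x = x := if_pos hx

theorem blockMap_add (π : Equiv.Perm ℕ) (j : ℕ) {u : ℚ} (h0 : 0 ≤ u) (h1 : u < 1) :
    blockMap π (j + u) = π j + u := by
  have h2 : ⌊(j : ℚ) + u⌋₊ = j := (Nat.floor_eq_iff (by positivity)).2 ⟨by linarith, by linarith⟩
  rw [blockMap, if_neg (not_lt.2 (by positivity)), h2, add_sub_cancel_left]

theorem neg_or_exists_add (x : ℚ) : x < 0 ∨ ∃ (j : ℕ) (u : ℚ), 0 ≤ u ∧ u < 1 ∧ x = j + u := by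
  rcases lt_or_ge x 0 with hx | hx
  · exact Or.inl hx
  · exact Or.inr ⟨⌊x⌋₊, x - ⌊x⌋₊, sub_nonneg.2 (Nat.floor_le hx),
      by linarith [Nat.lt_floor_add_one x], by ring⟩

theorem blockMap_mul (π σ : Equiv.Perm ℕ) (x : ℚ) :
    blockMap (π * σ) x = blockMap π (blockMap σ x) := by
  rcases neg_or_exists_add x with hx | ⟨j, u, h0, h1, rfl⟩
  · simp only [blockMap_of_neg _ hx]
  · simp only [blockMap_add _ _ h0 h1, Equiv.Perm.mul_apply]

theorem blockMap_one (x : ℚ) : blockMap 1 x = x := by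
  rcases neg_or_exists_add x with hx | ⟨j, u, h0, h1, rfl⟩
  · simp only [blockMap_of_neg _ hx]
  · simp only [blockMap_add _ _ h0 h1, Equiv.Perm.one_apply]

/-- The set of the rationals between `k + s` and `k + t`. -/
def segment (k : ℕ) (s t : ℚ) : Beta := ray (k + s) ∆ ray (k + t)

theorem mem_segment_of_neg {k : ℕ} {s t x : ℚ} (hs : 0 ≤ s) (ht : 0 ≤ t) (hx : x < 0) :
    x ∉ (segment k s t).1 := by
  have h1 : ¬ (k : ℚ) + s ≤ x := not_le.2 (hx.trans_le (by positivity))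
  have h2 : ¬ (k : ℚ) + t ≤ x := not_le.2 (hx.trans_le (by positivity))
  simp only [segment, mem_beta_symmDiff, mem_ray, h1, h2]
  tauto

theorem add_mem_segment {k j : ℕ} {s t u : ℚ} (hs : 0 ≤ s) (ht : 0 ≤ t) (hs' : s ≤ 1) (ht' : t ≤ 1)
    (hu : 0 ≤ u) (hu' : u < 1) : (j : ℚ) + u ∈ (segment k s t).1 ↔ j = k ∧ ¬ (s ≤ u ↔ t ≤ u) := by
  simp only [segment, mem_beta_symmDiff, mem_ray]
  rcases lt_trichotomy j k with h | rfl | h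
  · have h3 : (j : ℚ) + 1 ≤ k := by exact_mod_cast h
    have h1 : ¬ (k : ℚ) + s ≤ j + u := by linarith
    have h2 : ¬ (k : ℚ) + t ≤ j + u := by linarith
    simp [h1, h2, h.ne]
  · simp only [add_le_add_iff_left, true_and]
  · have h3 : (k : ℚ) + 1 ≤ j := by exact_mod_cast h
    have h1 : (k : ℚ) + s ≤ j + u := by linarith
    have h2 : (k : ℚ) + t ≤ j + u := by linarith
    simp [h1, h2, h.ne']

/-- A ray at a positive point is obtained from the ray at `0` by adding finitely many segments
inside unit blocks. On these generators the block permutation is explicit. -/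
theorem segment_induction {P : Beta → Prop} (bot : P ⊥) (top : P ⊤)
    (ray : ∀ b q, q ≤ 0 → P b → P (b ∆ ray q))
    (segment : ∀ b k s t, 0 ≤ s → 0 ≤ t → s ≤ 1 → t ≤ 1 → P b → P (b ∆ segment k s t))
    (b : Beta) : P b := by
  induction b using beta_induction with
  | bot => exact bot
  | top => exact top
  | ray b q ih =>
    have nat : ∀ k : ℕ, P (b ∆ SubstructureLattice.ray k) := fun k => by
      induction k with
      | zero => exact ray _ _ (by simp) ih
      | succ k ihk =>
        have := segment _ k 0 1 le_rfl zero_le_one zero_le_one le_rfl ihk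
        rwa [SubstructureLattice.segment, add_zero, symmDiff_assoc, symmDiff_symmDiff_cancel_left,
          ← Nat.cast_succ] at this
    rcases neg_or_exists_add q with hq | ⟨k, u, h0, h1, rfl⟩
    · exact ray _ _ hq.le ih
    · have := segment _ k 0 u le_rfl h0 zero_le_one h1.le (nat k)
      rwa [SubstructureLattice.segment, add_zero, symmDiff_assoc,
        symmDiff_symmDiff_cancel_left] at this

theorem blockMap_mem_ray (π : Equiv.Perm ℕ) {q : ℚ} (hq : q ≤ 0) (x : ℚ) :
    blockMap π x ∈ (ray q).1 ↔ x ∈ (ray q).1 := by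
  rcases neg_or_exists_add x with hx | ⟨j, u, h0, h1, rfl⟩
  · rw [blockMap_of_neg _ hx]
  · rw [blockMap_add _ _ h0 h1]
    exact iff_of_true (hq.trans (by positivity)) (hq.trans (by positivity))

theorem blockMap_mem_segment (π : Equiv.Perm ℕ) {k : ℕ} {s t : ℚ} (hs : 0 ≤ s) (ht : 0 ≤ t)
    (hs' : s ≤ 1) (ht' : t ≤ 1) (x : ℚ) :
    blockMap π x ∈ (segment (π k) s t).1 ↔ x ∈ (segment k s t).1 := by
  rcases neg_or_exists_add x with hx | ⟨j, u, h0, h1, rfl⟩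
  · rw [blockMap_of_neg _ hx]
    exact iff_of_false (mem_segment_of_neg hs ht hx) (mem_segment_of_neg hs ht hx)
  · rw [blockMap_add _ _ h0 h1, add_mem_segment hs ht hs' ht' h0 h1,
      add_mem_segment hs ht hs' ht' h0 h1, π.apply_eq_iff_eq]

/-- Although infinitely many blocks may move, preimages have finitely many jumps: rays from
nonpositive points are invariant, and a segment goes to a segment. -/
theorem exists_blockMap_preimage (π : Equiv.Perm ℕ) (b : Beta) :
    ∃ c : Beta, ∀ x, x ∈ c.1 ↔ blockMap π x ∈ b.1 := by
  have symmDiff : ∀ b b' : Beta, (∃ c : Beta, ∀ x, x ∈ c.1 ↔ blockMap π x ∈ b.1) →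
      (∃ c : Beta, ∀ x, x ∈ c.1 ↔ blockMap π x ∈ b'.1) →
      ∃ c : Beta, ∀ x, x ∈ c.1 ↔ blockMap π x ∈ (b ∆ b').1 := by
    rintro b b' ⟨c, hc⟩ ⟨c', hc'⟩
    exact ⟨c ∆ c', fun x => by rw [mem_beta_symmDiff, mem_beta_symmDiff, hc, hc']⟩
  induction b using segment_induction with
  | bot => exact ⟨⊥, fun _ => Iff.rfl⟩
  | top => exact ⟨⊤, fun _ => Iff.rfl⟩
  | ray b q hq ih => exact symmDiff _ _ ih ⟨ray q, fun x => (blockMap_mem_ray π hq x).symm⟩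
  | segment b k s t hs ht hs' ht' ih =>
    refine symmDiff _ _ ih ⟨segment (π⁻¹ k) s t, fun x => ?_⟩
    rw [← blockMap_mem_segment π hs ht hs' ht', Equiv.Perm.inv_def, Equiv.apply_symm_apply]

/-- The image of an element of the interval algebra under a permutation of the unit intervals. -/
noncomputable def blockImage (π : Equiv.Perm ℕ) (b : Beta) : Beta :=
  (exists_blockMap_preimage π⁻¹ b).choose

theorem mem_blockImage {π : Equiv.Perm ℕ} {b : Beta} {x : ℚ} :
    x ∈ (blockImage π b).1 ↔ blockMap π⁻¹ x ∈ b.1 :=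
  (exists_blockMap_preimage π⁻¹ b).choose_spec x

theorem blockImage_one (b : Beta) : blockImage 1 b = b := beta_ext fun x => by
  rw [mem_blockImage, inv_one, blockMap_one]

theorem blockImage_mul (π σ : Equiv.Perm ℕ) (b : Beta) :
    blockImage (π * σ) b = blockImage π (blockImage σ b) := beta_ext fun x => by
  rw [mem_blockImage, mem_blockImage, mem_blockImage, mul_inv_rev, blockMap_mul]

theorem blockImage_mono (π : Equiv.Perm ℕ) : Monotone (blockImage π) := fun _ _ h _ hx =>
  mem_blockImage.2 (h (mem_blockImage.1 hx))

theorem blockImage_symmDiff (π : Equiv.Perm ℕ) (b c : Beta) :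
    blockImage π (b ∆ c) = blockImage π b ∆ blockImage π c := beta_ext fun x => by
  simp only [mem_blockImage, mem_beta_symmDiff]

theorem blockImage_compl (π : Equiv.Perm ℕ) (b : Beta) : blockImage π bᶜ = (blockImage π b)ᶜ :=
  beta_ext fun x => by simp only [mem_blockImage, mem_beta_compl]

theorem blockImage_bot (π : Equiv.Perm ℕ) : blockImage π ⊥ = ⊥ := beta_ext fun x => by
  simp only [mem_blockImage, mem_beta_bot]

theorem blockImage_top (π : Equiv.Perm ℕ) : blockImage π ⊤ = ⊤ := beta_ext fun x => by
  simp only [mem_blockImage, mem_beta_top]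

theorem blockImage_ray (π : Equiv.Perm ℕ) {q : ℚ} (hq : q ≤ 0) : blockImage π (ray q) = ray q :=
  beta_ext fun x => by rw [mem_blockImage, blockMap_mem_ray _ hq]

theorem blockImage_segment (π : Equiv.Perm ℕ) {k : ℕ} {s t : ℚ} (hs : 0 ≤ s) (ht : 0 ≤ t)
    (hs' : s ≤ 1) (ht' : t ≤ 1) : blockImage π (segment k s t) = segment (π k) s t :=
  beta_ext fun x => by
    rw [mem_blockImage]
    exact (blockMap_mem_segment π hs ht hs' ht' _).symm.trans (by
      rw [← blockMap_mul, mul_inv_cancel, blockMap_one])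

/-- The action of the permutations of the unit intervals on the interval algebra. -/
noncomputable def blockAut : Equiv.Perm ℕ →* (Beta ≃o Beta) where
  toFun π :=
    { toFun := blockImage π
      invFun := blockImage π⁻¹
      left_inv := fun b => by rw [← blockImage_mul, inv_mul_cancel, blockImage_one]
      right_inv := fun b => by rw [← blockImage_mul, mul_inv_cancel, blockImage_one]
      map_rel_iff' := fun {b c} => by
        refine ⟨fun h => ?_, fun h => blockImage_mono π h⟩
        have : blockImage π⁻¹ (blockImage π b) ≤ blockImage π⁻¹ (blockImage π c) :=
          blockImage_mono π⁻¹ h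
        rwa [← blockImage_mul, ← blockImage_mul, inv_mul_cancel, blockImage_one,
          blockImage_one] at this }
  map_one' := RelIso.ext blockImage_one
  map_mul' π σ := RelIso.ext (blockImage_mul π σ)

theorem blockAut_apply (π : Equiv.Perm ℕ) (b : Beta) : blockAut π b = blockImage π b := rfl

/-- Equality up to complement is equality here, as no segment contains `-1`. This gives the
faithfulness of the block permutations on `B_η` and on its subalgebras. -/
theorem eq_of_gen_segment {j k : ℕ} (h : (gen (segment j 0 1) : BooleanSubalgebra Beta) =
    gen (segment k 0 1)) : j = k := by
  have h1 : ∀ k, (-1 : ℚ) ∉ (segment k 0 1).1 := fun k =>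
    mem_segment_of_neg le_rfl zero_le_one (by norm_num)
  have h2 : ∀ j k : ℕ, (j : ℚ) ∈ (segment k 0 1).1 ↔ j = k := fun j k => by
    have := add_mem_segment (k := k) (j := j) le_rfl zero_le_one zero_le_one le_rfl le_rfl
      (zero_lt_one (α := ℚ))
    rw [add_zero] at this
    rw [this]
    simp
  rcases gen_eq_gen_iff.1 h with h3 | h3 | ⟨h3 | h3, _⟩
  · rw [← h2, ← h3, h2]
  · have h4 := h1 j
    rw [h3, mem_beta_compl] at h4
    exact absurd (h1 k) h4
  · have h4 := (h2 j j).2 rfl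
    rw [h3] at h4
    exact h4.elim
  · have h4 := h1 j
    rw [h3] at h4
    exact (h4 trivial).elim

section

variable {I J : TuringIdeal}

/-- The pairs `(b, blockImage π b)` are generated from `(⊥, ⊥)` by complementing both components and
by adding a generator to one and its image to the other. -/
theorem eff_blockAut {π : Equiv.Perm ℕ} (hπ : Eff I π) : Eff I (blockAut π) := by
  let R : Beta × Beta → Beta × Beta → Prop := fun s t =>
    t = (s.1ᶜ, s.2ᶜ) ∨ (∃ q : ℚ, q ≤ 0 ∧ t = (s.1 ∆ ray q, s.2 ∆ ray q)) ∨
    ∃ p : ℕ × ℚ × ℚ, ((0 ≤ p.2.1 ∧ 0 ≤ p.2.2) ∧ p.2.1 ≤ 1 ∧ p.2.2 ≤ 1) ∧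
      t = (s.1 ∆ segment p.1 p.2.1 p.2.2, s.2 ∆ segment (π p.1) p.2.1 p.2.2)
  have hR : CEP I (fun s : (Beta × Beta) × (Beta × Beta) => R s.1 s.2) := by
    simp only [R, segment]
    exact (CEP.eq (by fun_prop) (by fun_prop)).or ((CEP.ex ((CEP.rat_le (by fun_prop)
      (by fun_prop)).and (CEP.eq (by fun_prop) (by fun_prop)))).or
      (CEP.ex ((((CEP.rat_le (by fun_prop) (by fun_prop)).and (CEP.rat_le (by fun_prop)
        (by fun_prop))).and ((CEP.rat_le (by fun_prop) (by fun_prop)).and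
        (CEP.rat_le (by fun_prop) (by fun_prop)))).and (CEP.eq (by fun_prop) (by fun_prop)))))
  have sound : ∀ s : Beta × Beta, Relation.ReflTransGen R (⊥, ⊥) s →
      blockImage π s.1 = s.2 := fun s hs => by
    induction hs with
    | refl => exact blockImage_bot π
    | tail _ h ih =>
      rcases h with rfl | ⟨q, hq, rfl⟩ | ⟨p, ⟨⟨h1, h2⟩, h3, h4⟩, rfl⟩
      · rw [blockImage_compl, ih]
      · rw [blockImage_symmDiff, ih, blockImage_ray _ hq]
      · rw [blockImage_symmDiff, ih, blockImage_segment _ h1 h2 h3 h4]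
  have complete : ∀ b, Relation.ReflTransGen R (⊥, ⊥) (b, blockImage π b) := fun b => by
    induction b using segment_induction with
    | bot =>
      rw [blockImage_bot]
    | top =>
      have h : R (⊥, ⊥) (⊤, ⊤) := Or.inl (by simp)
      rw [blockImage_top]
      exact .single h
    | ray b q hq ih =>
      have h : R (b, blockImage π b) (b ∆ ray q, blockImage π b ∆ ray q) :=
        Or.inr (Or.inl ⟨q, hq, rfl⟩)
      rw [blockImage_symmDiff, blockImage_ray _ hq]
      exact ih.tail h
    | segment b k s t hs ht hs' ht' ih =>
      have h : R (b, blockImage π b) (b ∆ segment k s t, blockImage π b ∆ segment (π k) s t) :=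
        Or.inr (Or.inr ⟨(k, s, t), ⟨⟨hs, ht⟩, hs', ht'⟩, rfl⟩)
      rw [blockImage_symmDiff, blockImage_segment _ hs ht hs' ht']
      exact ih.tail h
  refine (hR.reach (⊥, ⊥)).of_iff fun p => ⟨?_, fun h => sound p h⟩
  intro h
  have := complete p.1
  rwa [← blockAut_apply, h] at this

/-! ### The groups of computable automorphisms of the interval algebra -/

theorem mem_autIdeal_iff {φ : Beta ≃o Beta} : φ ∈ autIdeal I ↔ Eff I φ := by
  classical
  constructor
  · rintro ⟨d, hd, g, ⟨A, rfl, hA⟩, hg⟩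
    have hA' : TotIn A g := RecursiveIn.iff_nat.1 hA
    refine ⟨A, hd, (hA'.graph.and (sig1_range (X := Beta × Beta) A)).of_iff fun n => ?_⟩
    constructor
    · rintro ⟨p, rfl, h⟩
      refine ⟨?_, p, rfl⟩
      simp only [code_prod, Nat.unpair_pair]
      exact (hg p.1).trans (congrArg betaCode h)
    · rintro ⟨h, p, rfl⟩
      simp only [code_prod, Nat.unpair_pair] at h
      exact ⟨p, rfl, code_injective ((hg p.1).symm.trans h)⟩
  · rintro ⟨A, hA, h⟩
    -- Outside of the codes the value is `0`; since the set of codes is decidable, this extension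
    -- keeps the graph c.e. in `A`.
    let g : ℕ → ℕ := fun m =>
      if h : m ∈ Set.range betaCode then betaCode (φ h.choose) else 0
    have hg : ∀ b, g (betaCode b) = betaCode (φ b) := fun b => by
      have hm : betaCode b ∈ Set.range betaCode := ⟨b, rfl⟩
      have hG : g (betaCode b) = betaCode (φ hm.choose) := dif_pos hm
      rw [hG, betaCode_injective hm.choose_spec]
    have hg0 : ∀ m, m ∉ Set.range betaCode → g m = 0 := fun m hm => dif_neg hm
    have u1 : Primrec fun n : ℕ => n.unpair.1 := Primrec.fst.comp Primrec.unpair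
    have u2 : Primrec fun n : ℕ => n.unpair.2 := Primrec.snd.comp Primrec.unpair
    have hs : Sig1 A (fun n => g n.unpair.1 = n.unpair.2) := by
      refine (h.or (Sig1.of_primrecPred ((primrecPred_mem_range_betaCode.comp u1).not.and
        (Primrec.eq.comp u2 (.const 0))))).of_iff fun n => ?_
      by_cases hn : n.unpair.1 ∈ Set.range betaCode
      · simp only [hn, not_true, false_and, or_false]
        obtain ⟨b, hb⟩ := hn
        rw [← hb, hg]
        constructor
        · intro h'
          refine ⟨(b, φ b), ?_, rfl⟩
          rw [code_prod]
          exact (congrArg₂ Nat.pair hb h').trans (Nat.pair_unpair n)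
        · rintro ⟨p, hp, h'⟩
          rw [code_prod] at hp
          have h1 := congrArg Nat.unpair hp
          rw [Nat.unpair_pair] at h1
          have h2 : p.1 = b := betaCode_injective ((congrArg Prod.fst h1).trans hb.symm)
          rw [← h2, h']
          exact congrArg Prod.snd h1
      · simp only [hn, not_false_eq_true, true_and]
        rw [hg0 _ hn]
        constructor
        · intro h'
          exact Or.inr h'.symm
        · rintro (⟨p, hp, _⟩ | h')
          · refine absurd ⟨p.1, ?_⟩ hn
            have h1 := congrArg Nat.unpair hp
            rw [code_prod, Nat.unpair_pair] at h1
            exact congrArg Prod.fst h1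
          · exact h'.symm
    exact ⟨deg A, hA, g, ⟨A, rfl, RecursiveIn.iff_nat.2 (TotIn.of_graph hs)⟩, hg⟩

theorem permIdeal_embeds_autIdeal (I : TuringIdeal) :
    GroupEmbeds (permIdeal I ℕ) (autIdeal I) := by
  refine ⟨(blockAut.comp (permIdeal I ℕ).subtype).codRestrict _ fun π =>
    mem_autIdeal_iff.2 (eff_blockAut π.2), ?_⟩
  rw [injective_iff_map_eq_one]
  intro π h
  have h1 : blockAut π.1 = 1 := congrArg Subtype.val h
  refine Subtype.ext (Equiv.ext fun k => ?_)
  have h2 : blockAut π.1 (segment k 0 1) = segment k 0 1 := by rw [h1]; rfl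
  rw [blockAut_apply, blockImage_segment _ le_rfl zero_le_one zero_le_one le_rfl] at h2
  exact eq_of_gen_segment (congrArg gen h2)

theorem groupEmbeds_autIdeal_iff :
    GroupEmbeds (autIdeal I) (autIdeal J) ↔ (I : Set Degree) ⊆ J := by
  refine ⟨le_of_codesSet permIdeal_embeds_autIdeal fun J A h => ?_, fun h => ?_⟩
  · refine h.deg_mem (X := Beta) (fun φ x y => φ.1 x = y) (fun φ ψ x z => ?_) (fun _ => rfl)
      (fun φ => mem_autIdeal_iff.1 φ.2) fun φ hφ => ?_
    · exact ⟨fun h => ⟨_, rfl, h⟩, fun ⟨y, h1, h2⟩ =>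
        (congrArg φ.1 h1).trans h2⟩
    · obtain ⟨x, hx⟩ : ∃ x, φ.1 x ≠ x := by
        by_contra! h'
        exact hφ (Subtype.ext (RelIso.ext h'))
      exact ⟨x, φ.1 x, rfl, fun h' => hx (Eq.symm h'), hx⟩
  · exact ⟨Subgroup.inclusion fun φ hφ => mem_autIdeal_iff.2 ((mem_autIdeal_iff.1 hφ).mono h),
      Subgroup.inclusion_injective _⟩

/-! ### Block permutations acting on subalgebras and the equivalence for their lattices. -/

/-- The action of the automorphisms of a Boolean algebra on the lattice of subalgebras. -/
def subalgebraAut (B : Type*) [BooleanAlgebra B] :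
    (B ≃o B) →* (BooleanSubalgebra B ≃o BooleanSubalgebra B) where
  toFun φ :=
    { toFun := fun W => W.comap (φ.symm : BoundedLatticeHom B B)
      invFun := fun W => W.comap (φ : BoundedLatticeHom B B)
      left_inv := fun W => BooleanSubalgebra.ext fun b => by
        simp [BooleanSubalgebra.mem_comap]
      right_inv := fun W => BooleanSubalgebra.ext fun b => by
        simp [BooleanSubalgebra.mem_comap]
      map_rel_iff' := fun {V W} => by
        refine ⟨fun h b hb => ?_, fun h b hb => h hb⟩
        have h1 : φ b ∈ V.comap (φ.symm : BoundedLatticeHom B B) := by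
          simpa [BooleanSubalgebra.mem_comap] using hb
        simpa [BooleanSubalgebra.mem_comap] using h h1 }
  map_one' := rfl
  map_mul' _ _ := rfl

theorem mem_subalgebraAut {B : Type*} [BooleanAlgebra B] {φ : B ≃o B} {W : BooleanSubalgebra B}
    {b : B} : b ∈ subalgebraAut B φ W ↔ φ.symm b ∈ W := Iff.rfl

theorem subalgebraAut_gen {B : Type*} [BooleanAlgebra B] (φ : B ≃o B) (b : B) :
    subalgebraAut B φ (gen b) = gen (φ b) := by
  refine BooleanSubalgebra.ext fun c => ?_
  rw [mem_subalgebraAut, mem_gen_iff, mem_gen_iff, φ.symm_apply_eq, φ.symm_apply_eq,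
    φ.symm_apply_eq, φ.symm_apply_eq, map_bot, map_top, map_compl]

theorem permIdeal_embeds_ceAut_beta (I : TuringIdeal) :
    GroupEmbeds (permIdeal I ℕ) (ceAut (BooleanSubalgebra Beta) I) := by
  refine ⟨(((subalgebraAut Beta).comp blockAut).comp (permIdeal I ℕ).subtype).codRestrict _
    fun π => mem_ceAut_of_cep ?_, ?_⟩
  · have hπ : Eff I (blockAut π.1) := eff_blockAut π.2
    refine (cep_gen_eq_gen (X := Beta × Beta) (f := fun p => blockAut π.1 p.1) (g := fun p => p.2)
      (by fun_prop) (by fun_prop)).of_iff fun p => ?_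
    rw [← subalgebraAut_gen]
    rfl
  · rw [injective_iff_map_eq_one]
    intro π h
    have h1 : subalgebraAut Beta (blockAut π.1) = 1 := congrArg Subtype.val h
    refine Subtype.ext (Equiv.ext fun k => ?_)
    have h2 := subalgebraAut_gen (blockAut π.1) (segment k 0 1)
    rw [h1, blockAut_apply, blockImage_segment _ le_rfl zero_le_one zero_le_one le_rfl] at h2
    exact (eq_of_gen_segment h2).symm

theorem groupEmbeds_subalgebraLattice_iff :
    GroupEmbeds (SubalgebraLattice I ≃o SubalgebraLattice I)
      (SubalgebraLattice J ≃o SubalgebraLattice J) ↔ (I : Set Degree) ⊆ J :=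
  groupEmbeds_aut_iff (S := BooleanSubalgebra Beta) (I := I) (J := J)
    (fun _ _ => cep_iff_ceIn.symm) (fun _ => cep_mem_gen_sup_gen_beta)
    (fun _ _ => cep_apply_gen_eq_beta) permIdeal_embeds_ceAut_beta

end

end SubstructureLattice

theorem theorem2p1 {F : Type*} [Field F] (C : SubstructureLattice.ComputableField F)
    (I J : SubstructureLattice.TuringIdeal) :
    (SubstructureLattice.GroupEmbeds
        (SubstructureLattice.SubspaceLattice C I ≃o SubstructureLattice.SubspaceLattice C I)
        (SubstructureLattice.SubspaceLattice C J ≃o SubstructureLattice.SubspaceLattice C J) ↔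
      (I : Set SubstructureLattice.Degree) ⊆ J) ∧
    (SubstructureLattice.GroupEmbeds
        (SubstructureLattice.autIdeal I) (SubstructureLattice.autIdeal J) ↔
      (I : Set SubstructureLattice.Degree) ⊆ J) ∧
    (SubstructureLattice.GroupEmbeds
        (SubstructureLattice.SubalgebraLattice I ≃o SubstructureLattice.SubalgebraLattice I)
        (SubstructureLattice.SubalgebraLattice J ≃o SubstructureLattice.SubalgebraLattice J) ↔
      (I : Set SubstructureLattice.Degree) ⊆ J) :=
  ⟨SubstructureLattice.groupEmbeds_subspaceLattice_iff C I J,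
    SubstructureLattice.groupEmbeds_autIdeal_iff,
    SubstructureLattice.groupEmbeds_subalgebraLattice_iff⟩
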